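/- Let $(M,g)$ be a smooth $n$-dimensional pseudo-Riemannian manifold whose metric is not negative definite, and let $G$ be an $n$-dimensional Lie group acting smoothly and simply transitively on $M$ by isometries ("motions"). Fix $o\in M$ and a basis $e_1,\dots,e_n$ of $\mathfrak g=T_1G$. Let $\xi_i$ be the $G$-invariant vector field on $M$ with $\xi_i(z\cdot o)=\frac{d}{dt}\big|_{t=0}\,z\exp(te_i)\cdot o$, and let $\eta_i$ be the Killing vector field $\eta_i(x)=\frac{d}{dt}\big|_{t=0}\exp(te_i)\cdot x$. Suppose that the regular coadjoint orbits of $G$ (those of maximal dimension) have dimension at most $2$. Then a complete integral of the geodesic Hamilton--Jacobi equation $$g^{ij}\,\frac{\partial S}{\partial x^i}\frac{\partial S}{\partial x^j}=m^2,\qquad m\ge 0,$$ can be found by quadratures, locally near every point of $M$. In detail: for every local coordinate system $(x^1,\dots,x^n)$ on $M$, every point $x_0$ of its domain and every $m_0>0$ there are an open neighbourhood $U$ of $x_0$ in the coordinate domain, an open set $A\subseteq\mathbb R^n$, a smooth function $S(x;\alpha)$ on $U\times A$ and a function $m(\alpha)\ge 0$ on $A$ that takes the value $m_0$, such that $S(\cdot\,;\alpha)$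 solves the equation with $m=m(\alpha)$ for each $\alpha\in A$, $$\det\left\|\frac{\partial^2S(x;\alpha)}{\partial x^i\,\partial\alpha_j}\right\|\ne0\quad\text{on }U\times A,$$ and both $S(x;\alpha)$ and $m(\alpha)$ are obtained by quadratures from the coordinate components $\xi_i^j(x)$, $\eta_i^j(x)$. Here a function is *obtained by quadratures* from given functions if it can be built from them, from constants and from coordinate functions by finitely many algebraic operations ($+$, $\times$, reciprocals of functions without zeros), substitutions, restrictions to smaller open sets, inversions (solving $k$ equations $F_i(x_1,\dots,x_k)=y_i$ for $x$, where $F$ is a bijection between open sets of $\mathbb R^k$ with nowhere vanishing Jacobian) and quadratures (integrals $\int_a^{x_i} f(x_1,\dots,s,\dots,x_k)\,ds$ of functions already obtained with respect to one variable, with a constant lower limit, the other variables being parameters). -/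

import Mathlib

open scoped Manifold ContDiff

noncomputable section

/-- The coordinate space `ℝⁿ`; manifolds of dimension `n` are modelled on it (the choice of a norm
on it plays no role for the smooth structure). -/
abbrev RSpace (n : ℕ) : Type := Fin n → ℝ

/-! ### Functions obtained by quadratures -/

/-- Given a stock `D` of known functions (a member of `D k U` is a function of `k` real variables
on the open set `U ⊆ ℝᵏ`), `ByQuadratures D k U f` says that the function `f`, considered on the
open set `U ⊆ ℝᵏ`, is obtained from the known functions, the constants and the coordinate functions
by finitely many operations of the following kinds:

* algebraic operations and substitution of functions into one another;
* inversion of functions, i.e. solving a nondegenerate system of `k` equations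
  `Fᵢ(x₁, …, x_k) = yᵢ` for the unknowns `x`;
* quadratures, i.e. integration of a function already obtained with respect to one of its variables,
  the others being parameters.

Values of the functions outside the set `U` are irrelevant (`restrict`). -/
inductive ByQuadratures (D : ∀ k : ℕ, Set (RSpace k) → (RSpace k → ℝ) → Prop) :
    ∀ k : ℕ, Set (RSpace k) → (RSpace k → ℝ) → Prop
  /-- known functions -/
  | known {k : ℕ} {U : Set (RSpace k)} {f : RSpace k → ℝ} (hU : IsOpen U) (hf : D k U f) :
      ByQuadratures D k U f
  /-- constants -/
  | const {k : ℕ} {U : Set (RSpace k)} (hU : IsOpen U) (a : ℝ) :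
      ByQuadratures D k U (fun _ => a)
  /-- coordinate functions -/
  | coord {k : ℕ} {U : Set (RSpace k)} (hU : IsOpen U) (i : Fin k) :
      ByQuadratures D k U (fun x => x i)
  /-- sums -/
  | add {k : ℕ} {U : Set (RSpace k)} {f₁ f₂ : RSpace k → ℝ}
      (h₁ : ByQuadratures D k U f₁) (h₂ : ByQuadratures D k U f₂) :
      ByQuadratures D k U (fun x => f₁ x + f₂ x)
  /-- products -/
  | mul {k : ℕ} {U : Set (RSpace k)} {f₁ f₂ : RSpace k → ℝ}
      (h₁ : ByQuadratures D k U f₁) (h₂ : ByQuadratures D k U f₂) :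
      ByQuadratures D k U (fun x => f₁ x * f₂ x)
  /-- reciprocals of functions without zeros -/
  | inv {k : ℕ} {U : Set (RSpace k)} {f : RSpace k → ℝ}
      (h : ByQuadratures D k U f) (h0 : ∀ x ∈ U, f x ≠ 0) :
      ByQuadratures D k U (fun x => (f x)⁻¹)
  /-- restriction to a smaller open set -/
  | restrict {k : ℕ} {U V : Set (RSpace k)} {f f' : RSpace k → ℝ}
      (h : ByQuadratures D k U f) (hV : IsOpen V) (hVU : V ⊆ U) (hff' : Set.EqOn f f' V) :
      ByQuadratures D k V f'
  /-- substitution -/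
  | comp {k l : ℕ} {U : Set (RSpace k)} {V : Set (RSpace l)} {f : RSpace l → ℝ}
      {u : Fin l → RSpace k → ℝ} (hU : IsOpen U)
      (hf : ByQuadratures D l V f) (hu : ∀ i, ByQuadratures D k U (u i))
      (hUV : ∀ x ∈ U, (fun i => u i x) ∈ V) :
      ByQuadratures D k U (fun x => f (fun i => u i x))
  /-- inversion: `F : U → W` is a bijection with nowhere vanishing Jacobian and inverse `X` -/
  | inversion {k : ℕ} {U W : Set (RSpace k)} {F X : Fin k → RSpace k → ℝ}
      (hF : ∀ i, ByQuadratures D k U (F i)) (hU : IsOpen U) (hW : IsOpen W)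
      (hdet : ∀ x ∈ U, (fderiv ℝ (fun x' i => F i x') x).det ≠ 0)
      (hFX : ∀ x ∈ U, (fun i => F i x) ∈ W ∧ (fun j => X j (fun i => F i x)) = x)
      (hXF : ∀ y ∈ W, (fun j => X j y) ∈ U ∧ (fun i => F i (fun j => X j y)) = y)
      (j : Fin k) :
      ByQuadratures D k W (X j)
  /-- quadrature: `x ↦ ∫ f(x₁, …, x_{i-1}, s, x_{i+1}, …, x_k) ds` from a constant `a` to `xᵢ` -/
  | quadrature {k : ℕ} {U V : Set (RSpace k)} {f : RSpace k → ℝ}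
      (hf : ByQuadratures D k U f) (i : Fin k) (a : ℝ) (hV : IsOpen V)
      (hVU : ∀ x ∈ V, ∀ s ∈ Set.uIcc a (x i), Function.update x i s ∈ U) :
      ByQuadratures D k V (fun x => ∫ s in a..(x i), f (Function.update x i s))

/-! ### Pseudo-Riemannian metrics and groups of motions -/

/-- A smooth pseudo-Riemannian metric on an `n`-dimensional manifold: a smooth field of
nondegenerate symmetric bilinear forms on the tangent spaces. -/
structure PseudoRiemannianMetric (n : ℕ) (M : Type*) [TopologicalSpace M]
    [ChartedSpace (RSpace n) M] [IsManifold 𝓘(ℝ, RSpace n) ∞ M] where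
  val (x : M) : TangentSpace 𝓘(ℝ, RSpace n) x →L[ℝ] TangentSpace 𝓘(ℝ, RSpace n) x →L[ℝ] ℝ
  symm (x : M) (v w : TangentSpace 𝓘(ℝ, RSpace n) x) : val x v w = val x w v
  nondegenerate (x : M) (v : TangentSpace 𝓘(ℝ, RSpace n) x) (hv : ∀ w, val x v w = 0) : v = 0
  contMDiff : ContMDiff 𝓘(ℝ, RSpace n)
    (𝓘(ℝ, RSpace n).prod 𝓘(ℝ, RSpace n →L[ℝ] RSpace n →L[ℝ] ℝ)) ∞
    (fun x => Bundle.TotalSpace.mk' (RSpace n →L[ℝ] RSpace n →L[ℝ] ℝ)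
      (E := fun x : M =>
        TangentSpace 𝓘(ℝ, RSpace n) x →L[ℝ] TangentSpace 𝓘(ℝ, RSpace n) x →L[ℝ] ℝ)
      x (val x))

/-- The group `G` acts on `(M, g)` by isometries (motions): `τ_z^* g = g` for all `z ∈ G`. -/
def ActsByMotions {n : ℕ} (G : Type*) {M : Type*} [TopologicalSpace M]
    [ChartedSpace (RSpace n) M] [IsManifold 𝓘(ℝ, RSpace n) ∞ M] [SMul G M]
    (g : PseudoRiemannianMetric n M) : Prop :=
  ∀ (z : G) (x : M) (v w : TangentSpace 𝓘(ℝ, RSpace n) x),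
    g.val (z • x)
      (mfderiv 𝓘(ℝ, RSpace n) 𝓘(ℝ, RSpace n) (fun y : M => z • y) x v)
      (mfderiv 𝓘(ℝ, RSpace n) 𝓘(ℝ, RSpace n) (fun y : M => z • y) x w) = g.val x v w

/-- The action of `G` on `M` is simply transitive. -/
def SimplyTransitive (G M : Type*) [SMul G M] : Prop :=
  ∀ x₁ x₂ : M, ∃! z : G, z • x₁ = x₂

/-! ### Coadjoint orbits -/

section Coadjoint

variable {n : ℕ} {G : Type*} [TopologicalSpace G] [ChartedSpace (RSpace n) G] [Group G]

/-- The adjoint representation: `Ad_z` is the differential at the identity of `w ↦ z w z⁻¹`. The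
underlying vector space of the Lie algebra `𝔤 = T₁G` is `ℝⁿ`. -/
def AdRep (z : G) : RSpace n →L[ℝ] RSpace n :=
  mfderiv 𝓘(ℝ, RSpace n) 𝓘(ℝ, RSpace n) (fun w : G => z * w * z⁻¹) 1

/-- The coadjoint representation on `𝔤*`: `⟨Ad*_z l, Z⟩ = ⟨l, Ad_{z⁻¹} Z⟩`. -/
def coAd (z : G) (l : RSpace n →L[ℝ] ℝ) : RSpace n →L[ℝ] ℝ :=
  l.comp (AdRep z⁻¹)

variable (G) in
/-- The dimension of the coadjoint orbit `{Ad*_z l : z ∈ G}` through `l`: the dimension of its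
tangent space at `l`, which is the image of `T₁G` under the differential of `z ↦ Ad*_z l`. -/
def coadjointOrbitDim (l : RSpace n →L[ℝ] ℝ) : ℕ :=
  Module.finrank ℝ
    (mfderiv 𝓘(ℝ, RSpace n) 𝓘(ℝ, RSpace n →L[ℝ] ℝ) (fun z : G => coAd z l) 1).range

variable (G) in
/-- `l ∈ 𝔤*` is regular if the coadjoint orbit through `l` has the maximal dimension. -/
def IsRegularCovector (l : RSpace n →L[ℝ] ℝ) : Prop :=
  ∀ l' : RSpace n →L[ℝ] ℝ, coadjointOrbitDim G l' ≤ coadjointOrbitDim G l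

end Coadjoint

/-! ### The fields of the action in local coordinates -/

section Fields

variable {n : ℕ} (G : Type*) {M : Type*} [TopologicalSpace G] [ChartedSpace (RSpace n) G] [Group G]
  [TopologicalSpace M] [ChartedSpace (RSpace n) M] [MulAction G M]

/-- The inverse of the map `ψ_o : G → M`, `ψ_o(z) = z • o`. -/
def psiInv (o : M) : M → G :=
  Function.invFun (fun z : G => z • o)

/-- The components, in the local coordinates `c`, of the `G`-invariant vector field `ξ_v` on `M`
that corresponds to the left-invariant field of `v ∈ T₁G` under `ψ_o`:
`ξ_v(z • o) = d/dw (z w • o)` at `w = 1`, in the direction `v`. -/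
def invariantField (c : OpenPartialHomeomorph M (RSpace n)) (o : M) (v : RSpace n)
    (x : RSpace n) : RSpace n :=
  mfderiv 𝓘(ℝ, RSpace n) 𝓘(ℝ, RSpace n)
    (fun w : G => c ((psiInv G o (c.symm x) * w) • o)) 1 v

/-- The components, in the local coordinates `c`, of the Killing vector field `η_v` on `M` that
generates the action of `G` in the direction `v ∈ T₁G`: `η_v(x) = d/dw (w • x)` at `w = 1`. -/
def killingField (c : OpenPartialHomeomorph M (RSpace n)) (v : RSpace n)
    (x : RSpace n) : RSpace n :=
  mfderiv 𝓘(ℝ, RSpace n) 𝓘(ℝ, RSpace n) (fun w : G => c (w • c.symm x)) 1 v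

/-- The known functions: the components `ξ_i^j(x)` and `η_i^j(x)`, in the local coordinates `c`, of
the invariant and of the Killing vector fields that correspond to a basis `e_i` of `T₁G`.
(The components of the metric are rational functions of the `ξ_i^j` with constant coefficients.) -/
inductive ActionData (c : OpenPartialHomeomorph M (RSpace n)) (o : M) :
    ∀ k : ℕ, Set (RSpace k) → (RSpace k → ℝ) → Prop
  | invariant (i j : Fin n) :
      ActionData c o n c.target (fun x => invariantField G c o (Pi.single i 1) x j)
  | killing (i j : Fin n) :
      ActionData c o n c.target (fun x => killingField G c (Pi.single i 1) x j)

end Fields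

/-! ### The geodesic Hamilton–Jacobi equation -/

section HamiltonJacobi

variable {n : ℕ} {M : Type*} [TopologicalSpace M] [ChartedSpace (RSpace n) M]
  [IsManifold 𝓘(ℝ, RSpace n) ∞ M]

/-- The matrix of the covariant components `g_{ij}(x)` of the metric in the local coordinates
`c`. -/
def metricMatrix (g : PseudoRiemannianMetric n M) (c : OpenPartialHomeomorph M (RSpace n))
    (x : RSpace n) : Matrix (Fin n) (Fin n) ℝ :=
  Matrix.of fun i j =>
    g.val (c.symm x)
      (mfderiv 𝓘(ℝ, RSpace n) 𝓘(ℝ, RSpace n) c.symm x (Pi.single i (1 : ℝ) : RSpace n))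
      (mfderiv 𝓘(ℝ, RSpace n) 𝓘(ℝ, RSpace n) c.symm x (Pi.single j (1 : ℝ) : RSpace n))

/-- The partial derivative `∂f/∂xⁱ`. -/
def partialDeriv (i : Fin n) (f : RSpace n → ℝ) (x : RSpace n) : ℝ :=
  fderiv ℝ f x (Pi.single i 1)

/-- `S(x; α)`, `x ∈ U`, `α ∈ A`, is a complete integral, in the local coordinates `c`, of the
geodesic Hamilton–Jacobi equation `g^{ij} ∂ᵢS ∂ⱼS = m²`. The value `m = m(α) ≥ 0` of the parameter of
the equation is determined by the `n` parameters `α` of the complete integral (if it were constant,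
the determinant would vanish wherever `∂S/∂x ≠ 0`). -/
structure IsCompleteIntegral (g : PseudoRiemannianMetric n M)
    (c : OpenPartialHomeomorph M (RSpace n)) (U A : Set (RSpace n))
    (S : RSpace n → RSpace n → ℝ) (m : RSpace n → ℝ) : Prop where
  smooth : ContDiffOn ℝ ∞ (fun y : RSpace n × RSpace n => S y.1 y.2) (U ×ˢ A)
  nonneg : ∀ α ∈ A, 0 ≤ m α
  equation : ∀ x ∈ U, ∀ α ∈ A,
    ∑ i, ∑ j, (metricMatrix g c x)⁻¹ i j *
      partialDeriv i (fun x' => S x' α) x * partialDeriv j (fun x' => S x' α) x = m α ^ 2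
  det_ne_zero : ∀ x ∈ U, ∀ α ∈ A,
    (Matrix.of fun i j : Fin n =>
      partialDeriv j (fun α' => partialDeriv i (fun x' => S x' α') x) α).det ≠ 0

end HamiltonJacobi

end

/-! View the invariant fields and the Killing fields as linear maps ξ(x), η(x) from 𝔤 to ℝⁿ, and let
R = ξ⁻¹η (`transition`). At x = z·o this is Ad of z⁻¹, so composing a covector of 𝔤 with R is the
coadjoint action. A covector p at x has an invariant momentum p∘ξ and a Killing momentum μ = p∘η,
and p∘ξ = μ∘R⁻¹. In the invariant frame the metric has constant coefficients, so the Hamiltonian is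
a constant quadratic form q of p∘ξ (`metricMatrix_inv_apply`). Let B be the differential of z ↦
Ad(z⁻¹) at 1. By the bracket relations of the Killing fields, p = μ∘η⁻¹ is closed as soon as dμ(ηa)c
− dμ(ηc)a = μ(B a c) (`closed_of_momentum`).

The ansatz (`momentum`) is μ = λ∘R(x₀ + t b): a point on a curve in the coadjoint orbit of λ. Here λ
depends on n − 1 of the parameters α, and the time t(x, α) is solved from P(μ∘R(x)⁻¹) = α_k for a
suitable function P of the invariant momentum. Put ω = μ(B · ·), let β be the velocity of the curve
and d the differential of P in the Killing frame. Differentiating the equation for t gives dt(ηa)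
ω(β, d) = ω(a, d). Orbits of dimension at most two mean that ω has rank at most two, i.e. satisfies
the Plücker relation, and this relation turns the formula for dt into the closedness condition
(`integrableByQuadratures_of_solvable`). In symplectic terms: the functions of μ that are constant
along curves in two-dimensional orbits are in involution, and P commutes with all of them because
invariant and Killing momenta commute.

The function P must vary along the orbit, and q must become a function of α alone. Three cases
exhaust the possibilities (`InvariantFrames.integrableByQuadratures`). If q varies along an orbit
somewhere on the level q = m₀², take P = q. Otherwise q is a Casimir function, and any linear
function that varies along an orbit at a point of the level serves as P, while the energy is q(λ).
If there is none, then B = 0 and a constant μ works. A metric that is not negative definite makes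
the level q = m₀² nonempty.

Only permitted operations occur: t comes from an inversion, and S from p by integration along
segments (`exists_isCompleteIntegral`). The geometric input is collected in `invariantFrames`. It
rests on two facts: the orbit map z ↦ z·o is a diffeomorphism (`dmap_orbit_injective`,
`contMDiff_psiInv`), and left and right translations commute (`fderiv_invariantOp_killingOp`). -/

open scoped Manifold ContDiff

noncomputable section

/-! ### Germs of smooth functions obtained by quadratures -/

section Germs

open Filter Topology

/-- A stock of known functions. -/
abbrev KnownFunctions : Type := ∀ k : ℕ, Set (RSpace k) → (RSpace k → ℝ) → Prop

/-- The function `f` is smooth and obtained by quadratures on some open neighbourhood of `y₀`. -/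
def QuadratureAt (D : KnownFunctions) {k : ℕ} (f : RSpace k → ℝ) (y₀ : RSpace k) : Prop :=
  ∃ U : Set (RSpace k), y₀ ∈ U ∧ IsOpen U ∧ ContDiffOn ℝ ∞ f U ∧ ByQuadratures D k U f

namespace QuadratureAt

variable {D : KnownFunctions} {k l : ℕ} {f f₁ f₂ : RSpace k → ℝ} {y₀ : RSpace k}

theorem contDiffAt (h : QuadratureAt D f y₀) : ContDiffAt ℝ ∞ f y₀ := by
  obtain ⟨U, hy, hU, hf, -⟩ := h
  exact hf.contDiffAt (hU.mem_nhds hy)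

theorem differentiableAt (h : QuadratureAt D f y₀) : DifferentiableAt ℝ f y₀ :=
  h.contDiffAt.differentiableAt (by simp)

theorem continuousAt (h : QuadratureAt D f y₀) : ContinuousAt f y₀ :=
  h.contDiffAt.continuousAt

theorem eventually (h : QuadratureAt D f y₀) : ∀ᶠ y in 𝓝 y₀, QuadratureAt D f y := by
  obtain ⟨U, hy, hU, hf, hq⟩ := h
  filter_upwards [hU.mem_nhds hy] with y hyU using ⟨U, hyU, hU, hf, hq⟩

theorem congr (h : QuadratureAt D f₁ y₀) (he : f₁ =ᶠ[𝓝 y₀] f₂) : QuadratureAt D f₂ y₀ := by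
  obtain ⟨U, hy, hU, hf, hq⟩ := h
  obtain ⟨V, hV, hVo, hyV⟩ := eventually_nhds_iff.1 he
  have heq : Set.EqOn f₁ f₂ (U ∩ V) := fun x hx => hV x hx.2
  exact ⟨U ∩ V, ⟨hy, hyV⟩, hU.inter hVo,
    (hf.mono Set.inter_subset_left).congr fun x hx => (heq hx).symm,
    hq.restrict (hU.inter hVo) Set.inter_subset_left heq⟩

theorem const (a : ℝ) : QuadratureAt D (fun _ : RSpace k => a) y₀ :=
  ⟨Set.univ, trivial, isOpen_univ, contDiffOn_const, .const isOpen_univ a⟩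

theorem coord (i : Fin k) : QuadratureAt D (fun y : RSpace k => y i) y₀ :=
  ⟨Set.univ, trivial, isOpen_univ, (contDiff_apply ℝ ℝ i).contDiffOn, .coord isOpen_univ i⟩

theorem add (h₁ : QuadratureAt D f₁ y₀) (h₂ : QuadratureAt D f₂ y₀) :
    QuadratureAt D (fun y => f₁ y + f₂ y) y₀ := by
  obtain ⟨U, hy, hU, hf, hq⟩ := h₁
  obtain ⟨V, hyV, hV, hf', hq'⟩ := h₂
  exact ⟨U ∩ V, ⟨hy, hyV⟩, hU.inter hV,
    (hf.mono Set.inter_subset_left).add (hf'.mono Set.inter_subset_right),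
    (hq.restrict (hU.inter hV) Set.inter_subset_left fun _ _ => rfl).add
      (hq'.restrict (hU.inter hV) Set.inter_subset_right fun _ _ => rfl)⟩

theorem mul (h₁ : QuadratureAt D f₁ y₀) (h₂ : QuadratureAt D f₂ y₀) :
    QuadratureAt D (fun y => f₁ y * f₂ y) y₀ := by
  obtain ⟨U, hy, hU, hf, hq⟩ := h₁
  obtain ⟨V, hyV, hV, hf', hq'⟩ := h₂
  exact ⟨U ∩ V, ⟨hy, hyV⟩, hU.inter hV,
    (hf.mono Set.inter_subset_left).mul (hf'.mono Set.inter_subset_right),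
    (hq.restrict (hU.inter hV) Set.inter_subset_left fun _ _ => rfl).mul
      (hq'.restrict (hU.inter hV) Set.inter_subset_right fun _ _ => rfl)⟩

theorem inv (h : QuadratureAt D f y₀) (h0 : f y₀ ≠ 0) : QuadratureAt D (fun y => (f y)⁻¹) y₀ := by
  obtain ⟨U, hy, hU, hf, hq⟩ := h
  have hV : IsOpen (U ∩ f ⁻¹' {0}ᶜ) :=
    hf.continuousOn.isOpen_inter_preimage hU isOpen_compl_singleton
  exact ⟨U ∩ f ⁻¹' {0}ᶜ, ⟨hy, h0⟩, hV,
    (hf.mono Set.inter_subset_left).inv fun x hx => hx.2,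
    (hq.restrict hV Set.inter_subset_left fun _ _ => rfl).inv fun x hx => hx.2⟩

theorem sum {ι : Type*} (s : Finset ι) {f : ι → RSpace k → ℝ}
    (h : ∀ i ∈ s, QuadratureAt D (f i) y₀) : QuadratureAt D (fun y => ∑ i ∈ s, f i y) y₀ := by
  classical
  induction s using Finset.induction_on with
  | empty => simpa using const 0
  | insert a s ha ih =>
    simp only [Finset.sum_insert ha]
    exact (h a (by simp)).add (ih fun i hi => h i (by simp [hi]))

theorem prod {ι : Type*} (s : Finset ι) {f : ι → RSpace k → ℝ}
    (h : ∀ i ∈ s, QuadratureAt D (f i) y₀) : QuadratureAt D (fun y => ∏ i ∈ s, f i y) y₀ := by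
  classical
  induction s using Finset.induction_on with
  | empty => simpa using const 1
  | insert a s ha ih =>
    simp only [Finset.prod_insert ha]
    exact (h a (by simp)).mul (ih fun i hi => h i (by simp [hi]))

theorem common {ι : Type*} [Finite ι] {f : ι → RSpace k → ℝ}
    (h : ∀ i, QuadratureAt D (f i) y₀) :
    ∃ U : Set (RSpace k), y₀ ∈ U ∧ IsOpen U ∧
      ∀ i, ContDiffOn ℝ ∞ (f i) U ∧ ByQuadratures D k U (f i) := by
  choose U hy hU hf hq using h
  have ho : IsOpen (⋂ i, U i) := isOpen_iInter_of_finite hU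
  exact ⟨⋂ i, U i, Set.mem_iInter.2 hy, ho, fun i =>
    ⟨(hf i).mono (Set.iInter_subset _ i),
      (hq i).restrict ho (Set.iInter_subset _ i) fun _ _ => rfl⟩⟩

theorem comp {g : RSpace l → ℝ} {u : RSpace k → RSpace l}
    (hg : QuadratureAt D g (u y₀)) (hu : ∀ i, QuadratureAt D (fun y => u y i) y₀) :
    QuadratureAt D (fun y => g (u y)) y₀ := by
  obtain ⟨V, hyV, hV, hf', hq'⟩ := hg
  obtain ⟨U, hy, hU, hU'⟩ := common hu
  have hus : ContDiffOn ℝ ∞ u U := contDiffOn_pi.2 fun i => (hU' i).1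
  have ho : IsOpen (U ∩ u ⁻¹' V) := hus.continuousOn.isOpen_inter_preimage hU hV
  exact ⟨U ∩ u ⁻¹' V, ⟨hy, hyV⟩, ho,
    hf'.comp (hus.mono Set.inter_subset_left) fun x hx => hx.2,
    ByQuadratures.comp (u := fun i y => u y i) ho hq'
      (fun i => (hU' i).2.restrict ho Set.inter_subset_left fun _ _ => rfl) fun x hx => hx.2⟩

/-- The local inverse of a map with invertible differential, all of whose components are obtained
by quadratures, is obtained by quadratures. -/
theorem exists_localInverse {F : RSpace k → RSpace k}
    (hF : ∀ i, QuadratureAt D (fun y => F y i) y₀)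
    (hinj : ∀ v, fderiv ℝ F y₀ v = 0 → v = 0) :
    ∃ X : RSpace k → RSpace k, (∀ j, QuadratureAt D (fun y => X y j) (F y₀)) ∧ X (F y₀) = y₀ ∧
      ∀ᶠ y in 𝓝 (F y₀), F (X y) = y := by
  obtain ⟨U, hy, hU, hU'⟩ := common hF
  have hFs : ContDiffOn ℝ ∞ F U := contDiffOn_pi.2 fun i => (hU' i).1
  have hdetc : ContinuousOn (fun y => (fderiv ℝ F y).det) U :=
    ContinuousLinearMap.continuous_det.comp_continuousOn
      (hFs.continuousOn_fderiv_of_isOpen hU (by simp))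
  set V := U ∩ (fun y => (fderiv ℝ F y).det) ⁻¹' {0}ᶜ with hV
  have hVo : IsOpen V := hdetc.isOpen_inter_preimage hU isOpen_compl_singleton
  have hdet : (fderiv ℝ F y₀).det ≠ 0 := by
    have : LinearMap.ker (fderiv ℝ F y₀ : RSpace k →ₗ[ℝ] RSpace k) = ⊥ :=
      LinearMap.ker_eq_bot'.2 hinj
    exact fun h => (LinearMap.bot_lt_ker_of_det_eq_zero h).ne' this
  have hFy : ∀ y ∈ V, ContDiffAt ℝ ∞ F y := fun y hyV => hFs.contDiffAt (hU.mem_nhds hyV.1)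
  have hder : ∀ y (hyV : y ∈ V), HasFDerivAt F
      ((fderiv ℝ F y).toContinuousLinearEquivOfDetNeZero hyV.2 : RSpace k →L[ℝ] RSpace k) y := by
    intro y hyV
    refine HasFDerivAt.congr_fderiv ?_
      (ContinuousLinearMap.coe_toContinuousLinearEquivOfDetNeZero _ _).symm
    exact ((hFy y hyV).differentiableAt (by simp)).hasFDerivAt
  have hyV : y₀ ∈ V := ⟨hy, hdet⟩
  -- The restriction to V makes the Jacobian nonzero on the whole source, as the inversion rule
  -- demands.
  let Φ := ((hFy y₀ hyV).toOpenPartialHomeomorph F (hder y₀ hyV) (by simp)).restrOpen V hVo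
  have hΦs : Φ.source ⊆ V := fun y hy => hy.2
  have hyΦ : y₀ ∈ Φ.source :=
    ⟨(hFy y₀ hyV).mem_toOpenPartialHomeomorph_source (hder y₀ hyV) (by simp), hyV⟩
  have hΦ : ∀ y, Φ y = F y := fun _ => rfl
  have hyT : F y₀ ∈ Φ.target := Φ.map_source hyΦ
  have hX : ContDiffOn ℝ ∞ Φ.symm Φ.target := by
    intro y hy
    have hm : Φ.symm y ∈ V := hΦs (Φ.map_target hy)
    exact (Φ.contDiffAt_symm hy (hder _ hm) (hFy _ hm)).contDiffWithinAt
  refine ⟨Φ.symm, fun j => ⟨Φ.target, hyT, Φ.open_target, ?_, ?_⟩, ?_, ?_⟩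
  · exact contDiffOn_pi.1 hX j
  · refine ByQuadratures.inversion (F := fun i y => F y i) (X := fun j y => Φ.symm y j)
      (U := Φ.source) ?_ Φ.open_source Φ.open_target ?_ ?_ ?_ j
    · exact fun i => (hU' i).2.restrict Φ.open_source (fun y hy => (hΦs hy).1) fun _ _ => rfl
    · exact fun y hy => (hΦs hy).2
    · exact fun y hy => ⟨Φ.map_source hy, Φ.left_inv hy⟩
    · exact fun y hy => ⟨Φ.map_target hy, Φ.right_inv hy⟩
  · exact Φ.left_inv hyΦ
  · filter_upwards [Φ.open_target.mem_nhds hyT] with y hy using Φ.right_inv hy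

/-- Square roots are not among the elementary operations; this one arises as the local inverse of
squaring at the nonzero point √(f y₀). -/
theorem sqrt (h : QuadratureAt D f y₀) (h0 : 0 < f y₀) :
    QuadratureAt D (fun y => √(f y)) y₀ := by
  have hc : QuadratureAt D (fun y : RSpace 1 => y 0) (fun _ => √(f y₀)) := coord 0
  have hsq : ∀ i, QuadratureAt D (fun y : RSpace 1 => (fun _ : Fin 1 => y 0 * y 0) i)
      (fun _ => √(f y₀)) := fun _ => hc.mul hc
  have hd : ∀ y : RSpace 1, HasFDerivAt (fun (y : RSpace 1) (_ : Fin 1) => y 0 * y 0)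
      (ContinuousLinearMap.pi fun _ : Fin 1 => y 0 • ContinuousLinearMap.proj (R := ℝ) (0 : Fin 1)
        + y 0 • ContinuousLinearMap.proj (0 : Fin 1)) y := fun y =>
    hasFDerivAt_pi.2 fun _ => (hasFDerivAt_apply 0 y).mul (hasFDerivAt_apply 0 y)
  have hpos : 0 < √(f y₀) := Real.sqrt_pos.2 h0
  obtain ⟨X, hX, hX0, hXr⟩ := exists_localInverse hsq (by
    intro v hv
    rw [(hd _).fderiv] at hv
    ext i
    have := congrFun hv i
    fin_cases i
    simp at this
    rcases this with h | h
    · nlinarith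
    · simpa using h)
  have hval : (fun _ : Fin 1 => √(f y₀) * √(f y₀)) = fun _ => f y₀ := by
    funext; exact Real.mul_self_sqrt h0.le
  simp only [hval] at hX hX0 hXr
  have hcont : ContinuousAt (fun y (_ : Fin 1) => f y) y₀ :=
    continuousAt_pi.2 fun _ => h.continuousAt
  refine (QuadratureAt.comp (u := fun y _ => f y) (hX 0) fun _ => h).congr ?_
  have hXc : ContinuousAt (fun y => X (fun _ => f y) 0) y₀ :=
    ContinuousAt.comp (g := fun z => X z 0) (f := fun y (_ : Fin 1) => f y)
      (hX 0).continuousAt hcont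
  -- The local inverse is positive at the centre, and positivity nearby selects the right branch of
  -- the root.
  have hev : ∀ᶠ y in 𝓝 y₀, 0 < X (fun _ => f y) 0 :=
    hXc.eventually_const_lt (by simpa only [hX0] using hpos)
  filter_upwards [hcont.eventually hXr, hev] with y hy hy'
  have := congrFun hy 0
  exact ((Real.sqrt_eq_iff_mul_self_eq_of_pos hy').2 this).symm

end QuadratureAt
end Germs

/-! ### Smooth dependence of integrals on parameters -/

section ParametricIntegral

open Filter Topology MeasureTheory

variable {E F : Type} [NormedAddCommGroup E] [NormedSpace ℝ E] [NormedAddCommGroup F]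
  [NormedSpace ℝ F]

/-- Differentiation under the integral sign; the uniform bound on the derivative comes from
compactness of [0, 1]. -/
theorem hasFDerivAt_intervalIntegral_of_contDiffOn {f : E × ℝ → F} {W : Set (E × ℝ)}
    (hW : IsOpen W) (hf : ContDiffOn ℝ ∞ f W) {x : E} (hx : ∀ s ∈ Set.Icc (0 : ℝ) 1, (x, s) ∈ W) :
    HasFDerivAt (fun x => ∫ s in (0 : ℝ)..1, f (x, s))
      (∫ s in (0 : ℝ)..1, (fderiv ℝ f (x, s)).comp (ContinuousLinearMap.inl ℝ E ℝ)) x := by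
  set f' : E × ℝ → E →L[ℝ] F := fun z => (fderiv ℝ f z).comp (ContinuousLinearMap.inl ℝ E ℝ)
    with hf'
  have hf'c : ContinuousOn f' W :=
    (hf.continuousOn_fderiv_of_isOpen hW (by simp)).clm_comp continuousOn_const
  have hsub : ({x} : Set E) ×ˢ Set.Icc (0 : ℝ) 1 ⊆ W := by
    rintro ⟨y, s⟩ ⟨rfl, hs⟩
    exact hx s hs
  obtain ⟨C, hC⟩ := (isCompact_singleton.prod isCompact_Icc).exists_bound_of_continuousOn
    (hf'c.mono hsub)
  have hopen : IsOpen (W ∩ (fun z => ‖f' z‖) ⁻¹' Set.Iio (C + 1)) :=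
    hf'c.norm.isOpen_inter_preimage hW isOpen_Iio
  -- The tube lemma gives a neighbourhood u of x such that the derivative stays below C + 1 on all
  -- of u × [0, 1].
  obtain ⟨u, v, hu, hv, hxu, hIv, huv⟩ := generalized_tube_lemma isCompact_singleton isCompact_Icc
    hopen (s := ({x} : Set E)) (t := Set.Icc (0 : ℝ) 1) (by
      intro z hz
      exact ⟨hsub hz, lt_of_le_of_lt (hC z hz) (by linarith)⟩)
  have hxu' : x ∈ u := hxu rfl
  have hI : Set.uIcc (0 : ℝ) 1 = Set.Icc 0 1 := Set.uIcc_of_le zero_le_one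
  have hIoc : Set.uIoc (0 : ℝ) 1 ⊆ Set.Icc 0 1 := by
    rw [Set.uIoc_of_le zero_le_one]; exact Set.Ioc_subset_Icc_self
  have hslice : ∀ y ∈ u, ∀ s ∈ Set.Icc (0 : ℝ) 1, (y, s) ∈ W := fun y hy s hs =>
    (huv (Set.mk_mem_prod hy (hIv hs))).1
  have hcont : ∀ y ∈ u, ContinuousOn (fun s : ℝ => f (y, s)) (Set.Icc 0 1) := fun y hy =>
    hf.continuousOn.comp (by fun_prop) fun s hs => hslice y hy s hs
  refine intervalIntegral.hasFDerivAt_integral_of_dominated_of_fderiv_le (bound := fun _ => C + 1)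
    (F' := fun y s => f' (y, s)) (hu.mem_nhds hxu') ?_ ?_ ?_ ?_ ?_ ?_
  · filter_upwards [hu.mem_nhds hxu'] with y hy
    exact ((hcont y hy).mono hIoc).aestronglyMeasurable measurableSet_uIoc
  · exact ContinuousOn.intervalIntegrable (hI ▸ hcont x hxu')
  · have : ContinuousOn (fun s : ℝ => f' (x, s)) (Set.Icc 0 1) :=
      hf'c.comp (by fun_prop) fun s hs => hslice x hxu' s hs
    exact (this.mono hIoc).aestronglyMeasurable measurableSet_uIoc
  · refine Eventually.of_forall fun s hs y hy => ?_
    exact (huv (Set.mk_mem_prod hy (hIv (hIoc hs)))).2.le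
  · exact intervalIntegrable_const
  · refine Eventually.of_forall fun s hs y hy => ?_
    have hd : HasFDerivAt f (fderiv ℝ f (y, s)) (y, s) :=
      ((hf.contDiffAt (hW.mem_nhds (hslice y hy s (hIoc hs)))).differentiableAt
        (by simp)).hasFDerivAt
    have hp : HasFDerivAt (fun y : E => (y, s)) (ContinuousLinearMap.inl ℝ E ℝ) y :=
      hasFDerivAt_prodMk_left y s
    exact hd.comp y hp

/-- The derivative of the integral is an integral of the same kind with values in `E →L[ℝ] F`, so
the induction on the order of smoothness must let `F` vary; `E` and `F` share a universe so that
this space stays in it. -/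
theorem contDiffOn_intervalIntegral {W : Set (E × ℝ)} (hW : IsOpen W) {U : Set E} (hU : IsOpen U)
    (hUW : ∀ x ∈ U, ∀ s ∈ Set.Icc (0 : ℝ) 1, (x, s) ∈ W) {f : E × ℝ → F}
    (hf : ContDiffOn ℝ ∞ f W) :
    ContDiffOn ℝ ∞ (fun x => ∫ s in (0 : ℝ)..1, f (x, s)) U := by
  rw [contDiffOn_infty]
  intro m
  induction m generalizing F with
  | zero =>
    refine contDiffOn_zero.2 fun x hx => ContinuousAt.continuousWithinAt ?_
    exact (hasFDerivAt_intervalIntegral_of_contDiffOn hW hf (hUW x hx)).continuousAt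
  | succ m ih =>
    rw [Nat.cast_succ, contDiffOn_succ_iff_fderiv_of_isOpen hU]
    refine ⟨fun x hx => ?_, by simp, ?_⟩
    · exact (hasFDerivAt_intervalIntegral_of_contDiffOn hW hf
        (hUW x hx)).differentiableAt.differentiableWithinAt
    · have hf' : ContDiffOn ℝ ∞
          (fun z => (fderiv ℝ f z).comp (ContinuousLinearMap.inl ℝ E ℝ)) W :=
        (hf.fderiv_of_isOpen hW (by simp)).clm_comp contDiffOn_const
      refine (ih hf').congr fun x hx => ?_
      exact (hasFDerivAt_intervalIntegral_of_contDiffOn hW hf (hUW x hx)).fderiv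

end ParametricIntegral

/-! ### Covectors and linear maps with entries obtained by quadratures -/

section Linear

open Filter Topology

variable {D : KnownFunctions} {k n : ℕ}

/-- The covector with the components `p`. -/
def covector (n : ℕ) : RSpace n →L[ℝ] (RSpace n →L[ℝ] ℝ) :=
  ∑ i, (ContinuousLinearMap.proj i).smulRight (ContinuousLinearMap.proj i)

theorem covector_apply (p v : RSpace n) : covector n p v = ∑ i, p i * v i := by
  simp [covector]

theorem covector_single (p : RSpace n) (i : Fin n) : covector n p (Pi.single i 1) = p i := by
  simp [covector_apply, Pi.single_apply]

theorem clm_apply_eq_sum {F : Type*} [NormedAddCommGroup F] [NormedSpace ℝ F]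
    (l : RSpace n →L[ℝ] F) (v : RSpace n) : l v = ∑ i, v i • l (Pi.single i 1) := by
  conv_lhs => rw [← Finset.univ_sum_single v]
  rw [map_sum]
  refine Finset.sum_congr rfl fun i _ => ?_
  rw [← map_smul, ← Pi.single_smul, smul_eq_mul, mul_one]

theorem covector_components (l : RSpace n →L[ℝ] ℝ) :
    covector n (fun i => l (Pi.single i 1)) = l := by
  ext v
  rw [covector_apply, clm_apply_eq_sum l v]
  simp [mul_comm]

theorem covector_injective : Function.Injective (covector n) := fun p q h => by
  ext i
  rw [← covector_single p, h, covector_single]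

/-- Every linear functional on the dual space is the evaluation at a vector. -/
theorem exists_eval_eq (Λ : (RSpace n →L[ℝ] ℝ) →L[ℝ] ℝ) :
    ∃ d : RSpace n, ∀ l : RSpace n →L[ℝ] ℝ, Λ l = l d := by
  refine ⟨fun i => Λ (ContinuousLinearMap.proj i), fun l => ?_⟩
  conv_lhs => rw [← covector_components l]
  rw [clm_apply_eq_sum l]
  simp only [covector, sum_apply, map_sum, ContinuousLinearMap.smulRight_apply,
    map_smul, ContinuousLinearMap.proj_apply, smul_eq_mul]
  exact Finset.sum_congr rfl fun i _ => mul_comm _ _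

/-- The entries of the field `T` of linear maps are obtained by quadratures near `y₀`. -/
def QuadratureMapAt (D : KnownFunctions) (T : RSpace k → RSpace n →L[ℝ] RSpace n)
    (y₀ : RSpace k) : Prop :=
  ∀ i j, QuadratureAt D (fun y => T y (Pi.single i 1) j) y₀

/-- The components of the field `l` of covectors are obtained by quadratures near `y₀`. -/
def QuadratureCovAt (D : KnownFunctions) (l : RSpace k → RSpace n →L[ℝ] ℝ)
    (y₀ : RSpace k) : Prop :=
  ∀ i, QuadratureAt D (fun y => l y (Pi.single i 1)) y₀

variable {T S : RSpace k → RSpace n →L[ℝ] RSpace n} {l : RSpace k → RSpace n →L[ℝ] ℝ}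
  {y₀ : RSpace k}

theorem QuadratureMapAt.contDiffAt (h : QuadratureMapAt D T y₀) : ContDiffAt ℝ ∞ T y₀ := by
  have : T = fun y => ∑ i, ∑ j, T y (Pi.single i 1) j •
      (ContinuousLinearMap.proj (R := ℝ) (φ := fun _ : Fin n => ℝ) i).smulRight
        (Pi.single j (1 : ℝ) : RSpace n) := by
    funext y
    ext v m
    rw [clm_apply_eq_sum (T y) v]
    simp [Finset.sum_apply, Pi.single_apply, mul_comm]
  rw [this]
  exact ContDiffAt.sum fun i _ => ContDiffAt.sum fun j _ =>
    (h i j).contDiffAt.smul contDiffAt_const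

theorem QuadratureCovAt.contDiffAt (h : QuadratureCovAt D l y₀) : ContDiffAt ℝ ∞ l y₀ := by
  have : l = fun y => covector n fun i => l y (Pi.single i 1) := by
    funext y
    exact (covector_components _).symm
  rw [this]
  exact (covector n).contDiff.contDiffAt.comp y₀ (contDiffAt_pi.2 fun i => (h i).contDiffAt)

theorem QuadratureMapAt.eventually (h : QuadratureMapAt D T y₀) :
    ∀ᶠ y in 𝓝 y₀, QuadratureMapAt D T y := by
  simp only [QuadratureMapAt, eventually_all]
  exact fun i j => (h i j).eventually

theorem QuadratureCovAt.eventually (h : QuadratureCovAt D l y₀) :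
    ∀ᶠ y in 𝓝 y₀, QuadratureCovAt D l y := by
  simp only [QuadratureCovAt, eventually_all]
  exact fun i => (h i).eventually

theorem QuadratureMapAt.apply (h : QuadratureMapAt D T y₀) {v : RSpace k → RSpace n}
    (hv : ∀ i, QuadratureAt D (fun y => v y i) y₀) (j : Fin n) :
    QuadratureAt D (fun y => T y (v y) j) y₀ := by
  have : (fun y => T y (v y) j) = fun y => ∑ i, v y i * T y (Pi.single i 1) j := by
    funext y
    rw [clm_apply_eq_sum (T y)]
    simp [Finset.sum_apply]
  rw [this]
  exact QuadratureAt.sum _ fun i _ => (hv i).mul (h i j)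

theorem QuadratureCovAt.apply (h : QuadratureCovAt D l y₀) {v : RSpace k → RSpace n}
    (hv : ∀ i, QuadratureAt D (fun y => v y i) y₀) :
    QuadratureAt D (fun y => l y (v y)) y₀ := by
  have : (fun y => l y (v y)) = fun y => ∑ i, v y i * l y (Pi.single i 1) := by
    funext y
    rw [clm_apply_eq_sum (l y)]
    simp
  rw [this]
  exact QuadratureAt.sum _ fun i _ => (hv i).mul (h i)

theorem QuadratureMapAt.comp (hT : QuadratureMapAt D T y₀) (hS : QuadratureMapAt D S y₀) :
    QuadratureMapAt D (fun y => (T y).comp (S y)) y₀ := fun i j =>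
  hT.apply (v := fun y => S y (Pi.single i 1)) (hS i) j

theorem QuadratureCovAt.comp (hl : QuadratureCovAt D l y₀) (hT : QuadratureMapAt D T y₀) :
    QuadratureCovAt D (fun y => (l y).comp (T y)) y₀ := fun i =>
  hl.apply (v := fun y => T y (Pi.single i 1)) (hT i)

theorem QuadratureMapAt.substitution {m : ℕ} {u : RSpace m → RSpace k} {z₀ : RSpace m}
    (hT : QuadratureMapAt D T (u z₀)) (hu : ∀ i, QuadratureAt D (fun z => u z i) z₀) :
    QuadratureMapAt D (fun z => T (u z)) z₀ := fun i j =>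
  (hT i j).comp hu

theorem QuadratureAt.det {A : RSpace k → Matrix (Fin n) (Fin n) ℝ}
    (hA : ∀ i j, QuadratureAt D (fun y => A y i j) y₀) :
    QuadratureAt D (fun y => (A y).det) y₀ := by
  simp only [Matrix.det_apply, Units.smul_def, zsmul_eq_mul]
  exact QuadratureAt.sum _ fun σ _ => (QuadratureAt.const _).mul
    (QuadratureAt.prod _ fun i _ => hA _ _)

/-- Cramer's rule: the entries are determinants with one row replaced by a basis vector, divided by
the full determinant. -/
theorem QuadratureAt.matrix_inv {A : RSpace k → Matrix (Fin n) (Fin n) ℝ}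
    (hA : ∀ i j, QuadratureAt D (fun y => A y i j) y₀) (h0 : (A y₀).det ≠ 0) (i j : Fin n) :
    QuadratureAt D (fun y => (A y)⁻¹ i j) y₀ := by
  simp only [Matrix.inv_def, Matrix.smul_apply, Ring.inverse_eq_inv', smul_eq_mul,
    Matrix.adjugate_apply]
  refine ((QuadratureAt.det hA).inv h0).mul (QuadratureAt.det fun a b => ?_)
  by_cases h : a = j
  · subst h
    simpa using QuadratureAt.const _
  · simpa [Matrix.updateRow_ne h] using hA a b

theorem inverse_apply_single (L : RSpace n →L[ℝ] RSpace n) (hL : L.IsInvertible) (i j : Fin n) :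
    L.inverse (Pi.single i 1) j = (LinearMap.toMatrix' (L : RSpace n →ₗ[ℝ] RSpace n))⁻¹ j i := by
  have h1 : LinearMap.toMatrix' (L : RSpace n →ₗ[ℝ] RSpace n) *
      LinearMap.toMatrix' (L.inverse : RSpace n →ₗ[ℝ] RSpace n) = 1 := by
    rw [← LinearMap.toMatrix'_comp, ← LinearMap.toMatrix'_id]
    congr 1
    ext1 v
    ext i
    exact congrFun (congrFun (congrArg DFunLike.coe hL.self_comp_inverse) _) i
  rw [Matrix.inv_eq_right_inv h1, LinearMap.toMatrix'_apply]
  simp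

theorem isInvertible_of_forall_eq_zero {L : RSpace n →L[ℝ] RSpace n}
    (hL : ∀ v, L v = 0 → v = 0) : L.IsInvertible := by
  have h := (injective_iff_map_eq_zero (L : RSpace n →ₗ[ℝ] RSpace n)).2 hL
  exact ⟨(LinearEquiv.ofInjectiveEndo (L : RSpace n →ₗ[ℝ] RSpace n) h).toContinuousLinearEquiv,
    by ext; rfl⟩

theorem ContinuousLinearMap.IsInvertible.eventually {X : Type*} [TopologicalSpace X]
    {L : X → RSpace n →L[ℝ] RSpace n} {x : X} (h : (L x).IsInvertible) (hL : ContinuousAt L x) :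
    ∀ᶠ y in 𝓝 x, (L y).IsInvertible := by
  obtain ⟨e, he⟩ := h
  have := hL.eventually_mem (he ▸ ContinuousLinearEquiv.nhds e)
  exact this

theorem ContinuousLinearMap.IsInvertible.apply_inverse {L : RSpace n →L[ℝ] RSpace n}
    (h : L.IsInvertible) (v : RSpace n) : L (L.inverse v) = v :=
  congrFun (congrArg DFunLike.coe h.self_comp_inverse) v

theorem ContinuousLinearMap.IsInvertible.inverse_apply {L : RSpace n →L[ℝ] RSpace n}
    (h : L.IsInvertible) (v : RSpace n) : L.inverse (L v) = v :=
  congrFun (congrArg DFunLike.coe h.inverse_comp_self) v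

theorem det_toMatrix_ne_zero (L : RSpace n →L[ℝ] RSpace n) (hL : L.IsInvertible) :
    (LinearMap.toMatrix' (L : RSpace n →ₗ[ℝ] RSpace n)).det ≠ 0 := by
  obtain ⟨e, rfl⟩ := hL
  rw [LinearMap.det_toMatrix']
  exact (LinearEquiv.isUnit_det' e.toLinearEquiv).ne_zero

theorem QuadratureMapAt.inverse (hT : QuadratureMapAt D T y₀) (h0 : (T y₀).IsInvertible) :
    QuadratureMapAt D (fun y => (T y).inverse) y₀ := fun i j => by
  have hA : ∀ i j, QuadratureAt D
      (fun y => LinearMap.toMatrix' (T y : RSpace n →ₗ[ℝ] RSpace n) i j) y₀ := fun i j => by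
    simpa [LinearMap.toMatrix'_apply] using hT j i
  refine (QuadratureAt.matrix_inv hA (det_toMatrix_ne_zero _ h0) j i).congr ?_
  filter_upwards [h0.eventually hT.contDiffAt.continuousAt] with y hy
    using (inverse_apply_single _ hy i j).symm

end Linear

/-! ### Points of the product of x-space and α-space -/

section Join

variable {n : ℕ}

/-- The pair of points `x`, `α` of `ℝⁿ` as a point of `ℝⁿ⁺ⁿ`. -/
def joinL (n : ℕ) : (RSpace n × RSpace n) →L[ℝ] RSpace (n + n) :=
  ContinuousLinearMap.pi fun i => Fin.addCases
    (fun i => (ContinuousLinearMap.proj i).comp (ContinuousLinearMap.fst ℝ (RSpace n) (RSpace n)))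
    (fun i => (ContinuousLinearMap.proj i).comp (ContinuousLinearMap.snd ℝ (RSpace n) (RSpace n)))
    i

/-- The first half of the coordinates. -/
def fstL (n : ℕ) : RSpace (n + n) →L[ℝ] RSpace n :=
  ContinuousLinearMap.pi fun i => ContinuousLinearMap.proj (Fin.castAdd n i)

/-- The second half of the coordinates. -/
def sndL (n : ℕ) : RSpace (n + n) →L[ℝ] RSpace n :=
  ContinuousLinearMap.pi fun i => ContinuousLinearMap.proj (Fin.natAdd n i)

@[simp] theorem joinL_castAdd (z : RSpace n × RSpace n) (i : Fin n) :
    joinL n z (Fin.castAdd n i) = z.1 i := by simp [joinL]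

theorem joinL_natAdd (z : RSpace n × RSpace n) (i : Fin n) :
    joinL n z (Fin.natAdd n i) = z.2 i := by
  simp only [joinL, ContinuousLinearMap.coe_pi', Fin.addCases_right]
  rfl

theorem fstL_apply (y : RSpace (n + n)) (i : Fin n) : fstL n y i = y (Fin.castAdd n i) := rfl

theorem sndL_apply (y : RSpace (n + n)) (i : Fin n) : sndL n y i = y (Fin.natAdd n i) := rfl

@[simp] theorem fstL_joinL (z : RSpace n × RSpace n) : fstL n (joinL n z) = z.1 := by
  ext i; simp [fstL_apply]

@[simp] theorem sndL_joinL (z : RSpace n × RSpace n) : sndL n (joinL n z) = z.2 := by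
  ext i; exact joinL_natAdd z i

@[simp] theorem joinL_fstL_sndL (y : RSpace (n + n)) : joinL n (fstL n y, sndL n y) = y := by
  ext i
  induction i using Fin.addCases with
  | left i => simp [fstL_apply]
  | right i => exact joinL_natAdd _ i

/-- For the sup norm a ball in ℝⁿ⁺ⁿ is a product of balls; this produces the neighbourhoods U × A
later. -/
theorem mem_ball_iff_fstL_sndL {y y₀ : RSpace (n + n)} {r : ℝ} (hr : 0 < r) :
    y ∈ Metric.ball y₀ r ↔
      fstL n y ∈ Metric.ball (fstL n y₀) r ∧ sndL n y ∈ Metric.ball (sndL n y₀) r := by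
  simp only [Metric.mem_ball, dist_pi_lt_iff hr, fstL_apply, sndL_apply]
  refine ⟨fun h => ⟨fun i => h _, fun i => h _⟩, fun h i => ?_⟩
  induction i using Fin.addCases with
  | left i => exact h.1 i
  | right i => exact h.2 i

end Join

/-! ### Integration of closed forms by quadratures -/

section Integration

open Filter Topology

variable {D : KnownFunctions} {n : ℕ}

theorem ByQuadratures.sum {k : ℕ} {U : Set (RSpace k)} (hU : IsOpen U) {ι : Type*} (s : Finset ι)
    {f : ι → RSpace k → ℝ} (h : ∀ i, ByQuadratures D k U (f i)) :
    ByQuadratures D k U (fun y => ∑ i ∈ s, f i y) := by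
  classical
  induction s using Finset.induction_on with
  | empty => simpa using ByQuadratures.const hU 0
  | insert a s ha ih =>
    simp only [Finset.sum_insert ha]
    exact (h a).add ih

/-- The point `(x₀ + s (x - x₀), α)`, where `y = (x, α)`. -/
def segmentPoint (x₀ : RSpace n) (y : RSpace (n + n)) (s : ℝ) : RSpace (n + n) :=
  joinL n (x₀ + s • (fstL n y - x₀), sndL n y)

theorem continuous_segmentPoint (x₀ : RSpace n) :
    Continuous fun z : RSpace (n + n) × ℝ => segmentPoint x₀ z.1 z.2 := by
  unfold segmentPoint; fun_prop

theorem contDiff_segmentPoint (x₀ : RSpace n) :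
    ContDiff ℝ ∞ fun z : RSpace (n + n) × ℝ => segmentPoint x₀ z.1 z.2 := by
  unfold segmentPoint; fun_prop

/-- The integration variable has to range over an open set around the endpoint s = 1; |s| < 2 gives
this room at the cost of doubling the radius. -/
theorem segmentPoint_mem_ball {x₀ α₀ : RSpace n} {y : RSpace (n + n)} {s ε : ℝ} (hε : 0 < ε)
    (hy : y ∈ Metric.ball (joinL n (x₀, α₀)) ε) (hs : |s| < 2) :
    segmentPoint x₀ y s ∈ Metric.ball (joinL n (x₀, α₀)) (2 * ε) := by
  rw [mem_ball_iff_fstL_sndL hε] at hy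
  rw [mem_ball_iff_fstL_sndL (by positivity)]
  simp only [fstL_joinL, sndL_joinL, segmentPoint, mem_ball_iff_norm, add_sub_cancel_left,
    norm_smul, Real.norm_eq_abs] at hy ⊢
  refine ⟨?_, by linarith [hy.2]⟩
  have := norm_nonneg (fstL n y - x₀)
  nlinarith [hy.1, abs_nonneg s]

/-- The primitive `∫₀¹ p(x₀ + s (x - x₀), α) (x - x₀) ds` of a field of covectors. -/
def radialPrimitive (p : RSpace (n + n) → RSpace n →L[ℝ] ℝ) (x₀ : RSpace n)
    (y : RSpace (n + n)) : ℝ :=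
  ∫ s in (0 : ℝ)..1, p (segmentPoint x₀ y s) (fstL n y - x₀)

variable {p : RSpace (n + n) → RSpace n →L[ℝ] ℝ} {x₀ α₀ : RSpace n} {ε : ℝ}

theorem contDiffOn_radialPrimitive (hε : 0 < ε)
    (hp : ContDiffOn ℝ ∞ p (Metric.ball (joinL n (x₀, α₀)) (2 * ε))) :
    ContDiffOn ℝ ∞ (radialPrimitive p x₀) (Metric.ball (joinL n (x₀, α₀)) ε) := by
  refine contDiffOn_intervalIntegral (W := (fun z : RSpace (n + n) × ℝ => segmentPoint x₀ z.1 z.2)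
    ⁻¹' Metric.ball (joinL n (x₀, α₀)) (2 * ε))
    (f := fun z => p (segmentPoint x₀ z.1 z.2) (fstL n z.1 - x₀)) ?_ Metric.isOpen_ball ?_ ?_
  · exact Metric.isOpen_ball.preimage (continuous_segmentPoint x₀)
  · intro y hy s hs
    exact segmentPoint_mem_ball hε hy (by rw [abs_of_nonneg hs.1]; linarith [hs.2])
  · refine ContDiffOn.clm_apply ?_ (by fun_prop)
    exact hp.comp (contDiff_segmentPoint x₀).contDiffOn fun z hz => hz

/-- A quadrature integrates over one coordinate, up to the value of that coordinate. So s is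
adjoined as a last variable, the integrand is integrated from 0 to s, and then s = 1 is substituted.
-/
theorem byQuadratures_radialPrimitive (hε : 0 < ε)
    (hp : ∀ i, ByQuadratures D (n + n) (Metric.ball (joinL n (x₀, α₀)) (2 * ε))
      (fun y => p y (Pi.single i 1))) :
    ByQuadratures D (n + n) (Metric.ball (joinL n (x₀, α₀)) ε) (radialPrimitive p x₀) := by
  let init : RSpace (n + n + 1) → RSpace (n + n) := fun z i => z i.castSucc
  have hinit : Continuous init := by fun_prop
  let h : RSpace (n + n + 1) → RSpace (n + n) := fun z =>
    segmentPoint x₀ (init z) (z (Fin.last (n + n)))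
  have hh : Continuous h :=
    (continuous_segmentPoint x₀).comp (hinit.prodMk (continuous_apply _))
  set W := h ⁻¹' Metric.ball (joinL n (x₀, α₀)) (2 * ε) with hW
  have hWo : IsOpen W := Metric.isOpen_ball.preimage hh
  have hcomp : ∀ i, ByQuadratures D (n + n + 1) W (fun z => h z i) := by
    intro i
    induction i using Fin.addCases with
    | left i =>
      simp only [h, segmentPoint, joinL_castAdd, Pi.add_apply, Pi.smul_apply,
        fstL_apply, smul_eq_mul, sub_eq_add_neg, init]
      exact (ByQuadratures.const hWo _).add ((ByQuadratures.coord hWo _).mul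
        ((ByQuadratures.coord hWo _).add (ByQuadratures.const hWo _)))
    | right i =>
      simp only [h, segmentPoint, joinL_natAdd, sndL_apply, init]
      exact ByQuadratures.coord hWo _
  have hf : ByQuadratures D (n + n + 1) W (fun z => p (h z) (fstL n (init z) - x₀)) := by
    have : (fun z => p (h z) (fstL n (init z) - x₀)) = fun z => ∑ i,
        (z (Fin.castAdd n i).castSucc + -x₀ i) * p (h z) (Pi.single i 1) := by
      funext z
      rw [clm_apply_eq_sum]
      simp [fstL_apply, init, sub_eq_add_neg]
    rw [this]
    refine ByQuadratures.sum hWo _ fun i => ((ByQuadratures.coord hWo _).add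
      (ByQuadratures.const hWo _)).mul ?_
    exact ByQuadratures.comp (u := fun i z => h z i) hWo (hp i) hcomp fun z hz => hz
  set V := {z : RSpace (n + n + 1) | init z ∈ Metric.ball (joinL n (x₀, α₀)) ε ∧
    |z (Fin.last (n + n))| < 2} with hV
  have hVo : IsOpen V := (Metric.isOpen_ball.preimage hinit).inter
    (isOpen_lt (continuous_apply (Fin.last (n + n))).abs continuous_const)
  have hupd : ∀ (z : RSpace (n + n + 1)) (s : ℝ),
      init (Function.update z (Fin.last (n + n)) s) = init z := by
    intro z s
    funext i
    exact Function.update_of_ne (Fin.castSucc_lt_last i).ne _ _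
  have hq := ByQuadratures.quadrature hf (Fin.last (n + n)) 0 hVo (by
    intro z hz s hs
    refine Set.mem_preimage.2 ?_
    simp only [h, hupd, Function.update_self]
    refine segmentPoint_mem_ball hε hz.1 (lt_of_le_of_lt ?_ hz.2)
    rcases Set.mem_uIcc.1 hs with h | h
    · rw [abs_of_nonneg h.1, abs_of_nonneg (h.1.trans h.2)]; exact h.2
    · rw [abs_of_nonpos h.2, abs_of_nonpos (h.1.trans h.2)]; linarith [h.1])
  have hc := ByQuadratures.comp (u := fun i y => (Fin.snoc y (1 : ℝ) : Fin (n + n + 1) → ℝ) i)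
    (Metric.isOpen_ball (x := joinL n (x₀, α₀)) (ε := ε)) hq (by
      intro i
      induction i using Fin.lastCases with
      | last => simpa using ByQuadratures.const Metric.isOpen_ball 1
      | cast i => simpa using ByQuadratures.coord Metric.isOpen_ball i) (by
      intro y hy
      refine ⟨?_, by simp⟩
      have : init (Fin.snoc y (1 : ℝ) : Fin (n + n + 1) → ℝ) = y := by funext i; simp [init]
      simpa [this] using hy)
  refine hc.restrict Metric.isOpen_ball subset_rfl fun y hy => ?_
  simp only [radialPrimitive, Fin.snoc_last, Fin.update_snoc_last, h, init, Fin.snoc_castSucc]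

/-- The Poincaré lemma on a ball, with α as a parameter: the primitive is the curve integral along
the segment from x₀ to x. -/
theorem hasFDerivAt_radialPrimitive (hε : 0 < ε)
    (hp : ContDiffOn ℝ ∞ p (Metric.ball (joinL n (x₀, α₀)) ε))
    (hclosed : ∀ y ∈ Metric.ball (joinL n (x₀, α₀)) ε, ∀ v w : RSpace n,
      fderiv ℝ p y (joinL n (v, 0)) w = fderiv ℝ p y (joinL n (w, 0)) v)
    {x α : RSpace n} (hx : x ∈ Metric.ball x₀ ε) (hα : α ∈ Metric.ball α₀ ε) :
    HasFDerivAt (fun x' => radialPrimitive p x₀ (joinL n (x', α))) (p (joinL n (x, α))) x := by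
  have hmem : ∀ x' ∈ Metric.ball x₀ ε, joinL n (x', α) ∈ Metric.ball (joinL n (x₀, α₀)) ε :=
    fun x' hx' => (mem_ball_iff_fstL_sndL hε).2 (by simpa using ⟨hx', hα⟩)
  have hd : ∀ x' ∈ Metric.ball x₀ ε, HasFDerivAt (fun x' => p (joinL n (x', α)))
      ((fderiv ℝ p (joinL n (x', α))).comp
        ((joinL n).comp (ContinuousLinearMap.inl ℝ (RSpace n) (RSpace n)))) x' := by
    intro x' hx'
    have h1 := ((hp.contDiffAt (Metric.isOpen_ball.mem_nhds (hmem x' hx'))).differentiableAt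
      (by simp)).hasFDerivAt
    exact h1.comp x' ((joinL n).hasFDerivAt.comp x' (hasFDerivAt_prodMk_left x' α))
  have hd' : ∀ x' ∈ Metric.ball x₀ ε, HasFDerivWithinAt (fun x' => p (joinL n (x', α)))
      ((fderiv ℝ p (joinL n (x', α))).comp
        ((joinL n).comp (ContinuousLinearMap.inl ℝ (RSpace n) (RSpace n)))) (Metric.ball x₀ ε) x' :=
    fun x' hx' => (hd x' hx').hasFDerivWithinAt
  have key := (convex_ball x₀
    ε).hasFDerivWithinAt_curveIntegral_segment_of_hasFDerivWithinAt_symmetric hd'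
    (fun a ha v _ w _ => by simpa using hclosed _ (hmem a ha) v w)
    (Metric.mem_ball_self hε) hx
  have key' := key.hasFDerivAt (Metric.isOpen_ball.mem_nhds hx)
  refine key'.congr_of_eventuallyEq (Eventually.of_forall fun x' => ?_)
  simp only [radialPrimitive, curveIntegral_segment, segmentPoint, fstL_joinL, sndL_joinL,
    AffineMap.lineMap_apply_module']
  simp only [add_comm]

variable {M : Type*} [TopologicalSpace M] [ChartedSpace (RSpace n) M]
  [IsManifold 𝓘(ℝ, RSpace n) ∞ M]

/-- A field of closed forms `p(x, α) dx` that depends on `n` parameters in a nondegenerate way,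
solves the Hamilton–Jacobi equation and is obtained by quadratures yields a complete integral that
is obtained by quadratures. -/
theorem exists_isCompleteIntegral (g : PseudoRiemannianMetric n M)
    (c : OpenPartialHomeomorph M (RSpace n)) {m : RSpace n → ℝ}
    (hp : QuadratureCovAt D p (joinL n (x₀, α₀))) (hm : QuadratureAt D m α₀)
    (hm0 : ∀ᶠ α in 𝓝 α₀, 0 ≤ m α)
    (hclosed : ∀ᶠ y in 𝓝 (joinL n (x₀, α₀)), ∀ v w : RSpace n,
      fderiv ℝ p y (joinL n (v, 0)) w = fderiv ℝ p y (joinL n (w, 0)) v)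
    (heq : ∀ᶠ y in 𝓝 (joinL n (x₀, α₀)), ∑ i, ∑ j, (metricMatrix g c (fstL n y))⁻¹ i j *
      p y (Pi.single i 1) * p y (Pi.single j 1) = m (sndL n y) ^ 2)
    (hinj : ∀ δ : RSpace n, fderiv ℝ p (joinL n (x₀, α₀)) (joinL n (0, δ)) = 0 → δ = 0)
    {T : Set (RSpace n)} (hT : T ∈ 𝓝 x₀) :
    ∃ (U A : Set (RSpace n)) (S : RSpace n → RSpace n → ℝ),
      IsOpen U ∧ IsOpen A ∧ U ⊆ T ∧ x₀ ∈ U ∧ α₀ ∈ A ∧ IsCompleteIntegral g c U A S m ∧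
      ByQuadratures D (n + n)
        {y | (fun i => y (Fin.castAdd n i)) ∈ U ∧ (fun i => y (Fin.natAdd n i)) ∈ A}
        (fun y => S (fun i => y (Fin.castAdd n i)) (fun i => y (Fin.natAdd n i))) ∧
      ByQuadratures D n A m := by
  set y₀ := joinL n (x₀, α₀) with hy₀
  obtain ⟨W, hyW, hWo, hW⟩ := QuadratureAt.common hp
  obtain ⟨A', hαA, hA'o, -, hmA⟩ := hm
  -- Since ∂S/∂x = p, this is the mixed Hessian of S; `hinj` makes it nonsingular at y₀, hence
  -- nearby.
  let J : RSpace (n + n) → Matrix (Fin n) (Fin n) ℝ := fun y =>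
    Matrix.of fun i j => fderiv ℝ p y (joinL n (0, Pi.single j 1)) (Pi.single i 1)
  have hJ0 : (J y₀).det ≠ 0 := by
    intro h0
    obtain ⟨δ, hδ, hJδ⟩ := Matrix.exists_mulVec_eq_zero_iff.2 h0
    refine hδ (hinj δ ?_)
    have hcov : ∀ i, fderiv ℝ p y₀ (joinL n (0, δ)) (Pi.single i 1) = 0 := by
      intro i
      have h1 := congrFun hJδ i
      have h2 := clm_apply_eq_sum ((fderiv ℝ p y₀).comp ((joinL n).comp
        (ContinuousLinearMap.inr ℝ (RSpace n) (RSpace n)))) δ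
      simp only [ContinuousLinearMap.comp_apply, ContinuousLinearMap.inr_apply] at h2
      rw [h2]
      simpa [J, Matrix.mulVec, dotProduct, mul_comm] using h1
    ext v
    rw [clm_apply_eq_sum]
    simp [hcov]
  have hJc : ContinuousAt (fun y => (J y).det) y₀ := by
    have hpc : ContinuousAt (fderiv ℝ p) y₀ :=
      hp.contDiffAt.continuousAt_fderiv (by simp)
    refine (continuous_id.matrix_det (A := fun B : Matrix (Fin n) (Fin n) ℝ => B)).continuousAt.comp
      (continuousAt_pi.2 fun i => continuousAt_pi.2 fun j => ?_)
    exact (hpc.clm_apply continuousAt_const).clm_apply continuousAt_const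
  have hJ := hJc.eventually_ne hJ0
  have hfst : Tendsto (fstL n) (𝓝 y₀) (𝓝 x₀) := by
    have := (fstL n).continuous.tendsto y₀
    rwa [hy₀, fstL_joinL] at this
  have hsnd : Tendsto (sndL n) (𝓝 y₀) (𝓝 α₀) := by
    have := (sndL n).continuous.tendsto y₀
    rwa [hy₀, sndL_joinL] at this
  obtain ⟨r, hr, hball⟩ := Metric.eventually_nhds_iff_ball.1
    ((((hclosed.and heq).and hJ).and (hWo.mem_nhds hyW)).and
      ((hfst.eventually hT).and (hsnd.eventually (hm0.and (hA'o.mem_nhds hαA)))))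
  -- All conditions hold on radius 2ε, while S is built on radius ε, in accordance with
  -- `segmentPoint_mem_ball`.
  obtain ⟨ε, hε, rfl⟩ : ∃ ε : ℝ, 0 < ε ∧ r = 2 * ε := ⟨r / 2, by positivity, by ring⟩
  have hsub : Metric.ball y₀ ε ⊆ Metric.ball y₀ (2 * ε) := Metric.ball_subset_ball (by linarith)
  have hpW : ContDiffOn ℝ ∞ p (Metric.ball y₀ (2 * ε)) := by
    intro y hy
    have : QuadratureCovAt D p y := fun i =>
      ⟨W, (hball y hy).1.2, hWo, (hW i).1, (hW i).2⟩
    exact this.contDiffAt.contDiffWithinAt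
  have hjoin : ∀ {x α : RSpace n}, x ∈ Metric.ball x₀ ε → α ∈ Metric.ball α₀ ε →
      joinL n (x, α) ∈ Metric.ball y₀ ε := fun hx hα =>
    (mem_ball_iff_fstL_sndL hε).2 (by simpa [hy₀] using ⟨hx, hα⟩)
  have hpartial : ∀ {x α : RSpace n}, x ∈ Metric.ball x₀ ε → α ∈ Metric.ball α₀ ε → ∀ i,
      partialDeriv i (fun x' => radialPrimitive p x₀ (joinL n (x', α))) x =
        p (joinL n (x, α)) (Pi.single i 1) := by
    intro x α hx hα i
    rw [partialDeriv, (hasFDerivAt_radialPrimitive hε (hpW.mono hsub)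
      (fun y hy => (hball y (hsub hy)).1.1.1.1) hx hα).fderiv]
  refine ⟨Metric.ball x₀ ε, Metric.ball α₀ ε, fun x α => radialPrimitive p x₀ (joinL n (x, α)),
    Metric.isOpen_ball, Metric.isOpen_ball, ?_, Metric.mem_ball_self hε, Metric.mem_ball_self hε,
    ⟨?_, ?_, ?_, ?_⟩, ?_, ?_⟩
  · intro x hx
    have := (hball _ (hsub (hjoin hx (Metric.mem_ball_self hε)))).2.1
    rwa [fstL_joinL] at this
  · exact (contDiffOn_radialPrimitive hε hpW).comp (joinL n).contDiff.contDiffOn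
      fun y hy => hjoin hy.1 hy.2
  · intro α hα
    simpa using (hball _ (hsub (hjoin (Metric.mem_ball_self hε) hα))).2.2.1
  · intro x hx α hα
    simp only [hpartial hx hα]
    simpa using (hball _ (hsub (hjoin hx hα))).1.1.1.2
  · intro x hx α hα
    have : (Matrix.of fun i j : Fin n => partialDeriv j (fun α' =>
        partialDeriv i (fun x' => radialPrimitive p x₀ (joinL n (x', α'))) x) α) =
        J (joinL n (x, α)) := by
      ext i j
      have he : (fun α' => partialDeriv i
          (fun x' => radialPrimitive p x₀ (joinL n (x', α'))) x) =ᶠ[𝓝 α]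
          fun α' => p (joinL n (x, α')) (Pi.single i 1) := by
        filter_upwards [Metric.isOpen_ball.mem_nhds hα] with α' hα' using hpartial hx hα' i
      have h1 : HasFDerivAt p (fderiv ℝ p (joinL n (x, α))) (joinL n (x, α)) :=
        ((hpW.contDiffAt (Metric.isOpen_ball.mem_nhds (hsub (hjoin hx hα)))).differentiableAt
          (by simp)).hasFDerivAt
      have h2 := (h1.comp α ((joinL n).hasFDerivAt.comp α
        (hasFDerivAt_prodMk_right x α))).clm_apply
          (hasFDerivAt_const (Pi.single i (1 : ℝ) : RSpace n) α)
      simp only [Matrix.of_apply, J]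
      rw [partialDeriv, he.fderiv_eq]
      erw [h2.fderiv]
      simp
    rw [this]
    exact (hball _ (hsub (hjoin hx hα))).1.1.2
  · have hset : {y : RSpace (n + n) | (fun i => y (Fin.castAdd n i)) ∈ Metric.ball x₀ ε ∧
        (fun i => y (Fin.natAdd n i)) ∈ Metric.ball α₀ ε} = Metric.ball y₀ ε := by
      ext y
      rw [mem_ball_iff_fstL_sndL hε, hy₀, fstL_joinL, sndL_joinL]
      rfl
    rw [hset]
    have := byQuadratures_radialPrimitive (D := D) (p := p) (x₀ := x₀) (α₀ := α₀) hε fun i =>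
      (hW i).2.restrict Metric.isOpen_ball (fun y hy => (hball y hy).1.2) fun _ _ => rfl
    refine this.restrict Metric.isOpen_ball subset_rfl fun y _ => ?_
    exact congrArg _ (joinL_fstL_sndL y).symm
  · refine hmA.restrict Metric.isOpen_ball (fun α hα => ?_) fun _ _ => rfl
    have := (hball _ (hsub (hjoin (Metric.mem_ball_self hε) hα))).2.2.2
    rwa [sndL_joinL] at this

end Integration

/-! ### The ansatz for the Killing momentum and the equation for its time parameter -/

section LocalTheory

open Filter Topology

variable {D : KnownFunctions} {n : ℕ}

/-- The projection of `ℝⁿ` onto a coordinate hyperplane along the `k`-th coordinate axis. -/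
def dropCoord (k : Fin n) : RSpace n →L[ℝ] RSpace n :=
  ContinuousLinearMap.id ℝ _ -
    (ContinuousLinearMap.proj (R := ℝ) (φ := fun _ : Fin n => ℝ) k).smulRight
      (Pi.single k (1 : ℝ) : RSpace n)

theorem dropCoord_apply (k : Fin n) (α : RSpace n) :
    dropCoord k α = α - α k • (Pi.single k (1 : ℝ) : RSpace n) := rfl

theorem dropCoord_apply_same (k : Fin n) (α : RSpace n) : dropCoord k α k = 0 := by
  simp [dropCoord_apply]

theorem dropCoord_apply_of_ne {k i : Fin n} (h : i ≠ k) (α : RSpace n) :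
    dropCoord k α i = α i := by
  simp [dropCoord_apply, h]

theorem dropCoord_eq_of_eqOn {k : Fin n} {α α' : RSpace n} (h : ∀ i, i ≠ k → α i = α' i) :
    dropCoord k α = dropCoord k α' := by
  ext i
  by_cases hi : i = k
  · subst hi; simp [dropCoord_apply_same]
  · rw [dropCoord_apply_of_ne hi, dropCoord_apply_of_ne hi, h i hi]

/-- The covector whose `k`-th component is `a` and whose other components are those of `α`. -/
def sliceCovector (k : Fin n) (a : ℝ) (α : RSpace n) : RSpace n →L[ℝ] ℝ :=
  covector n (dropCoord k α) + a • covector n (Pi.single k 1)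

theorem sliceCovector_self (k : Fin n) (l : RSpace n →L[ℝ] ℝ) {α : RSpace n}
    (hα : ∀ i, i ≠ k → α i = l (Pi.single i 1)) :
    sliceCovector k (l (Pi.single k 1)) α = l := by
  have h : dropCoord k α + l (Pi.single k 1) • (Pi.single k (1 : ℝ) : RSpace n) =
      fun i => l (Pi.single i 1) := by
    ext i
    by_cases hi : i = k
    · subst hi; simp [dropCoord_apply_same]
    · simp [dropCoord_apply_of_ne hi, hi, hα i hi]
  rw [sliceCovector, ← map_smul, ← map_add, h, covector_components]

theorem hasFDerivAt_sliceCovector (k : Fin n) (a : ℝ) (α : RSpace n) :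
    HasFDerivAt (sliceCovector k a) ((covector n).comp (dropCoord k)) α :=
  ((covector n).comp (dropCoord k)).hasFDerivAt.add_const _

theorem quadratureCovAt_sliceCovector {m : ℕ} {u : RSpace m → RSpace n} {y : RSpace m} (k : Fin n)
    (a : ℝ) (hu : ∀ i, QuadratureAt D (fun y => u y i) y) :
    QuadratureCovAt D (fun y => sliceCovector k a (u y)) y := by
  intro i
  simp only [sliceCovector, add_apply, smul_apply, covector_single, smul_eq_mul]
  refine QuadratureAt.add ?_ (QuadratureAt.const _)
  by_cases hi : i = k
  · subst hi; simpa only [dropCoord_apply_same] using QuadratureAt.const 0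
  · simpa only [dropCoord_apply_of_ne hi] using hu i

theorem quadratureAt_fstL (i : Fin n) (y : RSpace (n + n)) :
    QuadratureAt D (fun y => fstL n y i) y := QuadratureAt.coord _

theorem quadratureAt_sndL (i : Fin n) (y : RSpace (n + n)) :
    QuadratureAt D (fun y => sndL n y i) y := QuadratureAt.coord _

/-- The covector at `x₀ + t(y) b` with the momentum `sliceCovector k a α`, transported by `R`. -/
def momentum (R : RSpace n → RSpace n →L[ℝ] RSpace n) (x₀ b : RSpace n) (k : Fin n) (a : ℝ)
    (t : RSpace (n + n) → ℝ) (y : RSpace (n + n)) : RSpace n →L[ℝ] ℝ :=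
  (sliceCovector k a (sndL n y)).comp (R (x₀ + t y • b))

variable {R : RSpace n → RSpace n →L[ℝ] RSpace n} {x₀ b : RSpace n} {k : Fin n} {a : ℝ}
  {t : RSpace (n + n) → ℝ} {y : RSpace (n + n)}

theorem quadratureAt_line (ht : QuadratureAt D t y) (i : Fin n) :
    QuadratureAt D (fun y => (x₀ + t y • b) i) y := by
  simp only [Pi.add_apply, Pi.smul_apply, smul_eq_mul]
  exact (QuadratureAt.const _).add (ht.mul (QuadratureAt.const _))

theorem quadratureCovAt_momentum (hR : QuadratureMapAt D R (x₀ + t y • b))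
    (ht : QuadratureAt D t y) : QuadratureCovAt D (momentum R x₀ b k a t) y :=
  (quadratureCovAt_sliceCovector k a fun i => quadratureAt_sndL i y).comp
    (hR.substitution (u := fun y => x₀ + t y • b) (quadratureAt_line ht))

/-- The first term varies λ, the second varies the time. The hypothesis ∂_b R = R∘N turns a motion
in t into composition of the momentum with N, which is infinitesimal coadjoint motion when N is a
value of B. -/
theorem fderiv_momentum (ht : DifferentiableAt ℝ t y) (hR : DifferentiableAt ℝ R (x₀ + t y • b))
    {N : RSpace n →L[ℝ] RSpace n}
    (hRb : fderiv ℝ R (x₀ + t y • b) b = (R (x₀ + t y • b)).comp N) (h : RSpace (n + n)) :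
    fderiv ℝ (momentum R x₀ b k a t) y h =
      (covector n (dropCoord k (sndL n h))).comp (R (x₀ + t y • b)) +
        fderiv ℝ t y h • (momentum R x₀ b k a t y).comp N := by
  have h1 : HasFDerivAt (fun y => x₀ + t y • b) ((fderiv ℝ t y).smulRight b) y :=
    (ht.hasFDerivAt.smul_const b).const_add x₀
  have h2 := hR.hasFDerivAt.comp y h1
  have h3 := (hasFDerivAt_sliceCovector k a (sndL n y)).comp y (sndL n).hasFDerivAt
  have h4 := h3.clm_comp h2
  have h5 : HasFDerivAt (momentum R x₀ b k a t) _ y := h4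
  rw [h5.fderiv]
  ext v
  simp [momentum, hRb]
  ring

/-- Solving `P = α_k` for the parameter `t` of the line through `x₀`. -/
theorem exists_implicit_parameter (hR : QuadratureMapAt D R x₀) (hRi : (R x₀).IsInvertible)
    {P : (RSpace n →L[ℝ] ℝ) → ℝ} (hP : ContDiff ℝ ∞ P)
    (hPq : ∀ (m : ℕ) (l : RSpace m → RSpace n →L[ℝ] ℝ) (y : RSpace m), QuadratureCovAt D l y →
      QuadratureAt D (fun y => P (l y)) y)
    (l₀ : RSpace n →L[ℝ] ℝ)
    (hκ : fderiv ℝ P l₀ (l₀.comp ((fderiv ℝ R x₀ b).comp (R x₀).inverse)) ≠ 0) (k : Fin n) :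
    ∃ (α₀ : RSpace n) (t : RSpace (n + n) → ℝ), (∀ i, i ≠ k → α₀ i = l₀ (Pi.single i 1)) ∧
      α₀ k = P l₀ ∧ QuadratureAt D t (joinL n (x₀, α₀)) ∧ t (joinL n (x₀, α₀)) = 0 ∧
      ∀ᶠ y in 𝓝 (joinL n (x₀, α₀)),
        P ((momentum R x₀ b k (l₀ (Pi.single k 1)) t y).comp (R (fstL n y)).inverse) =
          sndL n y k := by
  set a := l₀ (Pi.single k 1) with ha
  set ν₀ : RSpace n := fun i => l₀ (Pi.single i 1) with hl
  -- `sliceCovector k a` ignores α_k, so this slot is free: before the inversion it holds the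
  -- unknown t, afterwards the prescribed value of P.
  let K : Fin (n + n) := Fin.natAdd n k
  let G : RSpace (n + n) → ℝ := fun y =>
    P ((momentum R x₀ b k a (fun y => y K) y).comp (R (fstL n y)).inverse)
  -- Ψ exchanges t for the value of P and fixes all other coordinates; t is the K-th component of
  -- its local inverse.
  let Ψ : RSpace (n + n) → RSpace (n + n) := fun y => Function.update y K (G y)
  set y₁ := joinL n (x₀, dropCoord k ν₀) with hy₁
  have hy₁K : y₁ K = 0 := by
    rw [hy₁, joinL_natAdd]; exact dropCoord_apply_same k ν₀
  have hfst₁ : fstL n y₁ = x₀ := fstL_joinL _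
  have hsnd₁ : sndL n y₁ = dropCoord k ν₀ := sndL_joinL _
  have hslice : ∀ s : ℝ, sliceCovector k a (sndL n (y₁ + s • Pi.single K 1)) = l₀ := by
    intro s
    refine sliceCovector_self k l₀ fun i hi => ?_
    have : sndL n (Pi.single K (1 : ℝ)) i = 0 := by
      rw [sndL_apply, Pi.single_eq_of_ne]
      exact fun h => hi (Fin.natAdd_injective n n h)
    rw [map_add, map_smul, Pi.add_apply, Pi.smul_apply, this, hsnd₁, dropCoord_apply_of_ne hi]
    simp [hl]
  have hG : QuadratureAt D G y₁ := by
    refine hPq _ _ _ ((quadratureCovAt_momentum ?_ (QuadratureAt.coord K)).comp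
      (QuadratureMapAt.inverse ?_ ?_))
    · simpa [hy₁K] using hR
    · exact QuadratureMapAt.substitution (u := fstL n) (by simpa [hfst₁] using hR)
        fun i => quadratureAt_fstL i _
    · simpa [hfst₁] using hRi
  have hΨ : ∀ i, QuadratureAt D (fun y => Ψ y i) y₁ := by
    intro i
    by_cases hi : i = K
    · subst hi; simpa [Ψ] using hG
    · simpa [Ψ, Function.update_of_ne hi] using QuadratureAt.coord i
  have hRR : (R x₀).comp (R x₀).inverse = ContinuousLinearMap.id ℝ _ := hRi.self_comp_inverse
  -- Only the time varies along this line, so the derivative of G in the free slot is the number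
  -- that `hκ` assumes nonzero.
  have hGline : HasDerivAt (fun s : ℝ => G (y₁ + s • Pi.single K 1))
      (fderiv ℝ P l₀ (l₀.comp ((fderiv ℝ R x₀ b).comp (R x₀).inverse))) 0 := by
    have hx : ∀ s : ℝ, fstL n (y₁ + s • Pi.single K 1) = x₀ := by
      intro s
      ext i
      have : (Pi.single K (1 : ℝ) : RSpace (n + n)) (Fin.castAdd n i) = 0 := by
        rw [Pi.single_eq_of_ne]
        intro h
        have := congrArg Fin.val h
        simp [K] at this
        omega
      rw [map_add, map_smul, hfst₁, Pi.add_apply, Pi.smul_apply, fstL_apply, this]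
      simp
    have hfun : (fun s : ℝ => G (y₁ + s • Pi.single K 1)) = fun s : ℝ =>
        P (l₀.comp ((R (x₀ + s • b)).comp (R x₀).inverse)) := by
      funext s
      simp only [G, momentum, hslice, hx]
      simp [hy₁K, ContinuousLinearMap.comp_assoc]
    rw [hfun]
    have hline : HasDerivAt (fun s : ℝ => x₀ + s • b) b 0 := by
      simpa using ((hasDerivAt_id (0 : ℝ)).smul_const b).const_add x₀
    have hRd : HasFDerivAt R (fderiv ℝ R x₀) (x₀ + (0 : ℝ) • b) := by
      simpa using (hR.contDiffAt.differentiableAt (by simp)).hasFDerivAt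
    have h1 := hRd.comp_hasDerivAt (0 : ℝ) hline
    have h2 := h1.clm_comp (hasDerivAt_const (0 : ℝ) (R x₀).inverse)
    have h3 := (hasDerivAt_const (0 : ℝ) l₀).clm_comp h2
    have hPd : HasFDerivAt P (fderiv ℝ P l₀)
        (l₀.comp ((R (x₀ + (0 : ℝ) • b)).comp (R x₀).inverse)) := by
      have : l₀.comp ((R (x₀ + (0 : ℝ) • b)).comp (R x₀).inverse) = l₀ := by
        simp [hRR]
      rw [this]
      exact (hP.differentiable (by simp) l₀).hasFDerivAt
    have h4 := hPd.comp_hasDerivAt (0 : ℝ) h3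
    convert! h4 using 1
    simp
  -- Ψ is the identity off the slot K, so a kernel vector is a multiple of the K-th basis vector,
  -- and `hGline` excludes nonzero multiples.
  have hinj : ∀ v, fderiv ℝ Ψ y₁ v = 0 → v = 0 := by
    intro v hv
    have hΨd : DifferentiableAt ℝ Ψ y₁ :=
      differentiableAt_pi.2 fun i => (hΨ i).differentiableAt
    have hcomp : ∀ i, fderiv ℝ (fun y => Ψ y i) y₁ v = 0 := by
      intro i
      have := congrFun hv i
      rwa [fderiv_pi (fun i => (hΨ i).differentiableAt)] at this
    have hne : ∀ i, i ≠ K → v i = 0 := by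
      intro i hi
      have h := hcomp i
      simp only [Ψ, Function.update_of_ne hi] at h
      rwa [(hasFDerivAt_apply i y₁).fderiv] at h
    have hveq : v = v K • Pi.single K (1 : ℝ) := by
      ext i
      by_cases hi : i = K
      · subst hi; simp
      · simp [hne i hi, hi]
    have h := hcomp K
    simp only [Ψ, Function.update_self] at h
    have hGd : HasDerivAt (fun s : ℝ => G (y₁ + s • Pi.single K 1))
        (fderiv ℝ G y₁ (Pi.single K 1)) 0 := by
      have hl : HasDerivAt (fun s : ℝ => y₁ + s • (Pi.single K (1 : ℝ) : RSpace (n + n)))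
          (Pi.single K 1) 0 := by
        simpa using ((hasDerivAt_id (0 : ℝ)).smul_const
          (Pi.single K (1 : ℝ) : RSpace (n + n))).const_add y₁
      have hd : HasFDerivAt G (fderiv ℝ G y₁)
          (y₁ + (0 : ℝ) • (Pi.single K (1 : ℝ) : RSpace (n + n))) := by
        simpa using hG.differentiableAt.hasFDerivAt
      exact hd.comp_hasDerivAt (0 : ℝ) hl
    have h' : fderiv ℝ G y₁ v = 0 := h
    rw [hveq, map_smul, hGd.unique hGline, smul_eq_mul, mul_eq_zero] at h'
    rw [hveq, h'.resolve_right hκ, zero_smul]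
  obtain ⟨X, hX, hX0, hXr⟩ := QuadratureAt.exists_localInverse hΨ hinj
  have hGy₁ : G y₁ = P l₀ := by
    have := hslice 0
    simp only [zero_smul, add_zero] at this
    simp only [G, momentum, this, hy₁K, zero_smul, add_zero, hfst₁,
      ContinuousLinearMap.comp_assoc, hRR, ContinuousLinearMap.comp_id]
  -- The image of the base point dictates α₀: the components of l₀ with the k-th replaced by P l₀.
  have hΨy₁ : Ψ y₁ = joinL n (x₀, dropCoord k ν₀ + P l₀ • Pi.single k 1) := by
    ext i
    induction i using Fin.addCases with
    | left i =>
      have : Fin.castAdd n i ≠ K := by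
        intro h
        have := congrArg Fin.val h
        simp [K] at this
        omega
      simp [Ψ, Function.update_of_ne this, hy₁]
    | right i =>
      rw [joinL_natAdd]
      by_cases hi : i = k
      · subst hi
        have : Ψ y₁ (Fin.natAdd n i) = G y₁ := Function.update_self ..
        rw [this, hGy₁]
        simp [dropCoord_apply_same]
      · have : Fin.natAdd n i ≠ K := fun h => hi (Fin.natAdd_injective n n h)
        have h2 : Ψ y₁ (Fin.natAdd n i) = y₁ (Fin.natAdd n i) := Function.update_of_ne this ..
        rw [h2, hy₁, joinL_natAdd]
        simp [hi]
  rw [hΨy₁] at hX hX0 hXr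
  refine ⟨dropCoord k ν₀ + P l₀ • Pi.single k 1, fun y => X y K, ?_, ?_, hX K, ?_, ?_⟩
  · intro i hi
    simp [dropCoord_apply_of_ne hi, hi, hl]
  · simp [dropCoord_apply_same]
  · simp only [hX0, hy₁K]
  · filter_upwards [hXr] with y hy
    have hne : ∀ i, i ≠ K → X y i = y i := by
      intro i hi
      have := congrFun hy i
      rwa [show Ψ (X y) i = X y i from Function.update_of_ne hi ..] at this
    have hK : G (X y) = y K := by
      have := congrFun hy K
      rwa [show Ψ (X y) K = G (X y) from Function.update_self ..] at this
    have h1 : fstL n (X y) = fstL n y := by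
      ext i
      refine hne _ fun h => ?_
      have := congrArg Fin.val h
      simp [K] at this
      omega
    have h2 : dropCoord k (sndL n (X y)) = dropCoord k (sndL n y) :=
      dropCoord_eq_of_eqOn fun i hi => hne _ fun h => hi (Fin.natAdd_injective n n h)
    simp only [G, momentum, sliceCovector, h1, h2] at hK
    simp only [momentum, sliceCovector]
    exact hK

end LocalTheory

/-! ### The two frames and the closedness criterion -/

section LocalTheory

open Filter Topology

variable {D : KnownFunctions} {n : ℕ}

/-- The matrix of the adjoint action: the field of linear maps that expresses the frame `η` in
terms of the frame `ξ`. -/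
def transition (ξ η : RSpace n → RSpace n →L[ℝ] RSpace n) (x : RSpace n) :
    RSpace n →L[ℝ] RSpace n :=
  (ξ x).inverse.comp (η x)

/-- Near `x₀`, `ξ` and `η` are two frames that are known by quadratures, `η` is related to `ξ` by
the exponentiated adjoint representation of the algebra with the bracket `-B`, its commutation
relations are those of that algebra, and the coadjoint orbits have dimension at most two (expressed
by the Plücker relation for the bilinear forms `l (B a b)`). -/
structure InvariantFrames (D : KnownFunctions) (x₀ : RSpace n)
    (ξ η : RSpace n → RSpace n →L[ℝ] RSpace n) (B : RSpace n →L[ℝ] RSpace n →L[ℝ] RSpace n) :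
    Prop where
  quadrature_ξ : QuadratureMapAt D ξ x₀
  quadrature_η : QuadratureMapAt D η x₀
  isInvertible_ξ : (ξ x₀).IsInvertible
  isInvertible_η : (η x₀).IsInvertible
  fderiv_transition : ∀ᶠ x in 𝓝 x₀, ∀ c,
    fderiv ℝ (transition ξ η) x (η x c) = (transition ξ η x).comp (B c)
  bracket : ∀ᶠ x in 𝓝 x₀, ∀ a b,
    fderiv ℝ η x (η x a) b - fderiv ℝ η x (η x b) a = η x (B a b)
  plucker : ∀ (l : RSpace n →L[ℝ] ℝ) (a b c d : RSpace n),
    l (B a b) * l (B c d) - l (B a c) * l (B b d) + l (B a d) * l (B b c) = 0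

variable {x₀ : RSpace n} {ξ η : RSpace n → RSpace n →L[ℝ] RSpace n}
  {B : RSpace n →L[ℝ] RSpace n →L[ℝ] RSpace n}

namespace InvariantFrames

theorem quadrature_transition (h : InvariantFrames D x₀ ξ η B) :
    QuadratureMapAt D (transition ξ η) x₀ :=
  (h.quadrature_ξ.inverse h.isInvertible_ξ).comp h.quadrature_η

theorem isInvertible_transition (h : InvariantFrames D x₀ ξ η B) :
    (transition ξ η x₀).IsInvertible :=
  h.isInvertible_ξ.inverse.comp h.isInvertible_η

/-- No Lie algebra axiom is assumed for B: the left side of the bracket relation is antisymmetric,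
and η is invertible. -/
theorem antisymm (h : InvariantFrames D x₀ ξ η B) (a b : RSpace n) : B a b = -B b a := by
  have hx := h.bracket.self_of_nhds
  have h1 : η x₀ (B a b + B b a) = 0 := by
    rw [map_add, ← hx a b, ← hx b a]; abel
  obtain ⟨e, he⟩ := h.isInvertible_η
  rw [← he] at h1
  have h2 : B a b + B b a = 0 := e.injective (h1.trans (map_zero e).symm)
  exact eq_neg_of_add_eq_zero_left h2

/-- The field of forms with the prescribed values `μ` on the frame `η`. -/
theorem closed_of_momentum {μ : RSpace (n + n) → RSpace n →L[ℝ] ℝ} {y : RSpace (n + n)}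
    (hμ : QuadratureCovAt D μ y) (hη : QuadratureMapAt D η (fstL n y))
    (hinv : (η (fstL n y)).IsInvertible)
    (hbr : ∀ a b, fderiv ℝ η (fstL n y) (η (fstL n y) a) b -
      fderiv ℝ η (fstL n y) (η (fstL n y) b) a = η (fstL n y) (B a b))
    (hsymm : ∀ a c, fderiv ℝ μ y (joinL n (η (fstL n y) a, 0)) c -
      fderiv ℝ μ y (joinL n (η (fstL n y) c, 0)) a = μ y (B a c)) :
    QuadratureCovAt D (fun y => (μ y).comp (η (fstL n y)).inverse) y ∧
    (∀ h c, fderiv ℝ (fun y => (μ y).comp (η (fstL n y)).inverse) y h (η (fstL n y) c) =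
      fderiv ℝ μ y h c - (μ y).comp (η (fstL n y)).inverse
        (fderiv ℝ η (fstL n y) (fstL n h) c)) ∧
    ∀ v w : RSpace n,
      fderiv ℝ (fun y => (μ y).comp (η (fstL n y)).inverse) y (joinL n (v, 0)) w =
      fderiv ℝ (fun y => (μ y).comp (η (fstL n y)).inverse) y (joinL n (w, 0)) v := by
  set p : RSpace (n + n) → RSpace n →L[ℝ] ℝ :=
    fun y => (μ y).comp (η (fstL n y)).inverse with hp
  have hη' : QuadratureMapAt D (fun y => η (fstL n y)) y :=
    hη.substitution (u := fstL n) fun i => quadratureAt_fstL i y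
  have hpq : QuadratureCovAt D p y := hμ.comp (hη'.inverse hinv)
  have hμp : μ =ᶠ[𝓝 y] fun y => (p y).comp (η (fstL n y)) := by
    filter_upwards [hinv.eventually (L := fun y => η (fstL n y)) hη'.contDiffAt.continuousAt]
      with z hz
    simp only [hp, ContinuousLinearMap.comp_assoc]
    rw [hz.inverse_comp_self, ContinuousLinearMap.comp_id]
  have hpd : HasFDerivAt p (fderiv ℝ p y) y :=
    (hpq.contDiffAt.differentiableAt (by simp)).hasFDerivAt
  have hηd : HasFDerivAt η (fderiv ℝ η (fstL n y)) (fstL n y) :=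
    (hη.contDiffAt.differentiableAt (by simp)).hasFDerivAt
  have hprod := hpd.clm_comp (hηd.comp y (fstL n).hasFDerivAt)
  have hder : ∀ h c, fderiv ℝ p y h (η (fstL n y) c) =
      fderiv ℝ μ y h c - p y (fderiv ℝ η (fstL n y) (fstL n h) c) := by
    intro h c
    rw [hμp.fderiv_eq]
    erw [hprod.fderiv]
    simp
  refine ⟨hpq, hder, fun v w => ?_⟩
  obtain ⟨a, rfl⟩ : ∃ a, η (fstL n y) a = v := ⟨_, hinv.apply_inverse v⟩
  obtain ⟨c, rfl⟩ : ∃ c, η (fstL n y) c = w := ⟨_, hinv.apply_inverse w⟩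
  rw [hder, hder, fstL_joinL, fstL_joinL]
  -- The derivative of the frame contributes p(η(B a c)) = μ(B a c), exactly what `hsymm`
  -- compensates.
  have h1 : p y (fderiv ℝ η (fstL n y) (η (fstL n y) a) c) -
      p y (fderiv ℝ η (fstL n y) (η (fstL n y) c) a) = μ y (B a c) := by
    rw [← map_sub, hbr a c, hp]
    simp [hinv.inverse_apply]
  linarith [hsymm a c]

end InvariantFrames

section Solve

variable {R : RSpace n → RSpace n →L[ℝ] RSpace n} {b : RSpace n} {k : Fin n} {a : ℝ}
  {t : RSpace (n + n) → ℝ} {y : RSpace (n + n)} {P : (RSpace n →L[ℝ] ℝ) → ℝ}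

/-- Differentiating the relation `P = α_k`. -/
theorem exists_fderiv_momentum_eq (hP : Differentiable ℝ P)
    (hμ : QuadratureCovAt D (momentum R x₀ b k a t) y) (hR : QuadratureMapAt D R (fstL n y))
    (hinv : (R (fstL n y)).IsInvertible)
    (heq : ∀ᶠ y in 𝓝 y, P ((momentum R x₀ b k a t y).comp (R (fstL n y)).inverse) = sndL n y k) :
    ∃ d : RSpace n, (∀ l : RSpace n →L[ℝ] ℝ,
      fderiv ℝ P ((momentum R x₀ b k a t y).comp (R (fstL n y)).inverse)
        (l.comp (R (fstL n y)).inverse) = l d) ∧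
      ∀ h, fderiv ℝ (momentum R x₀ b k a t) y h d -
        ((momentum R x₀ b k a t y).comp (R (fstL n y)).inverse)
          (fderiv ℝ R (fstL n y) (fstL n h) d) = sndL n h k := by
  set μ := momentum R x₀ b k a t with hμdef
  set l : RSpace (n + n) → RSpace n →L[ℝ] ℝ := fun y => (μ y).comp (R (fstL n y)).inverse with hl
  have hR' : QuadratureMapAt D (fun y => R (fstL n y)) y :=
    hR.substitution (u := fstL n) fun i => quadratureAt_fstL i y
  have hlq : QuadratureCovAt D l y := hμ.comp (hR'.inverse hinv)
  have hld : HasFDerivAt l (fderiv ℝ l y) y :=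
    (hlq.contDiffAt.differentiableAt (by simp)).hasFDerivAt
  have hRd : HasFDerivAt R (fderiv ℝ R (fstL n y)) (fstL n y) :=
    (hR.contDiffAt.differentiableAt (by simp)).hasFDerivAt
  have hμl : μ =ᶠ[𝓝 y] fun y => (l y).comp (R (fstL n y)) := by
    filter_upwards [hinv.eventually (L := fun y => R (fstL n y)) hR'.contDiffAt.continuousAt]
      with z hz
    simp only [hl, ContinuousLinearMap.comp_assoc]
    rw [hz.inverse_comp_self, ContinuousLinearMap.comp_id]
  have hprod := hld.clm_comp (hRd.comp y (fstL n).hasFDerivAt)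
  have hder : ∀ h, (fderiv ℝ l y h).comp (R (fstL n y)) =
      fderiv ℝ μ y h - (l y).comp (fderiv ℝ R (fstL n y) (fstL n h)) := by
    intro h
    rw [hμl.fderiv_eq]
    erw [hprod.fderiv]
    ext v
    simp
  -- The differential of P, transported to the Killing frame by R⁻¹, is a functional on covectors;
  -- by duality it is evaluation at a vector d.
  let Λ : (RSpace n →L[ℝ] ℝ) →L[ℝ] ℝ := (fderiv ℝ P (l y)).comp
    ((ContinuousLinearMap.compL ℝ (RSpace n) (RSpace n) ℝ).flip (R (fstL n y)).inverse)
  obtain ⟨d, hd⟩ := exists_eval_eq Λ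
  have hd' : ∀ l' : RSpace n →L[ℝ] ℝ,
      fderiv ℝ P (l y) (l'.comp (R (fstL n y)).inverse) = l' d := fun l' => by
    rw [← hd l']; rfl
  refine ⟨d, hd', fun h => ?_⟩
  have hPl : HasFDerivAt (fun y => P (l y)) ((fderiv ℝ P (l y)).comp (fderiv ℝ l y)) y :=
    (hP (l y)).hasFDerivAt.comp y hld
  have hk : HasFDerivAt (fun y => sndL n y k)
      ((ContinuousLinearMap.proj (R := ℝ) (φ := fun _ : Fin n => ℝ) k).comp (sndL n)) y :=
    ((ContinuousLinearMap.proj (R := ℝ) (φ := fun _ : Fin n => ℝ) k).comp (sndL n)).hasFDerivAt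
  have heq' : (fun y => P (l y)) =ᶠ[𝓝 y] fun y => sndL n y k := heq
  have h1 : fderiv ℝ P (l y) (fderiv ℝ l y h) = sndL n h k := by
    have := congrArg (fun L => L h) (hPl.unique (hk.congr_of_eventuallyEq heq'))
    simpa using this
  have h2 : fderiv ℝ l y h = ((fderiv ℝ l y h).comp (R (fstL n y))).comp
      (R (fstL n y)).inverse := by
    rw [ContinuousLinearMap.comp_assoc, hinv.self_comp_inverse, ContinuousLinearMap.comp_id]
  rw [h2, hd', hder] at h1
  rw [← h1]
  rfl

end Solve

end LocalTheory

/-! ### From Killing momenta to complete integrals -/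

section LocalTheory

open Filter Topology

variable {D : KnownFunctions} {n : ℕ}
  {M : Type*} [TopologicalSpace M] [ChartedSpace (RSpace n) M]
  [IsManifold 𝓘(ℝ, RSpace n) ∞ M]

/-- Near `x₀` a complete integral can be found by quadratures, in which the parameter of the
equation takes the value `m₀`. -/
def IntegrableByQuadratures (D : KnownFunctions) (g : PseudoRiemannianMetric n M)
    (c : OpenPartialHomeomorph M (RSpace n)) (x₀ : RSpace n) (T : Set (RSpace n)) (m₀ : ℝ) : Prop :=
  ∃ (U A : Set (RSpace n)) (S : RSpace n → RSpace n → ℝ) (m : RSpace n → ℝ),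
    IsOpen U ∧ IsOpen A ∧ U ⊆ T ∧ x₀ ∈ U ∧ (∃ α₀ ∈ A, m α₀ = m₀) ∧
    IsCompleteIntegral g c U A S m ∧
    ByQuadratures D (n + n)
      {y | (fun i => y (Fin.castAdd n i)) ∈ U ∧ (fun i => y (Fin.natAdd n i)) ∈ A}
      (fun y => S (fun i => y (Fin.castAdd n i)) (fun i => y (Fin.natAdd n i))) ∧
    ByQuadratures D n A m

variable {x₀ : RSpace n} {ξ η : RSpace n → RSpace n →L[ℝ] RSpace n}
  {B : RSpace n →L[ℝ] RSpace n →L[ℝ] RSpace n} {g : PseudoRiemannianMetric n M}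
  {c : OpenPartialHomeomorph M (RSpace n)} {q : (RSpace n →L[ℝ] ℝ) → ℝ} {T : Set (RSpace n)}
  {m₀ : ℝ}

/-- With p = μ∘η⁻¹ one has p∘ξ = μ∘R⁻¹, so the energy is H(α). The choice m = √H is smooth near α₀
because H(α₀) = m₀² > 0. -/
theorem integrableByQuadratures_of_momentum (h : InvariantFrames D x₀ ξ η B)
    (hq : ∀ᶠ x in 𝓝 x₀, ∀ p : RSpace n →L[ℝ] ℝ, ∑ i, ∑ j, (metricMatrix g c x)⁻¹ i j *
      p (Pi.single i 1) * p (Pi.single j 1) = q (p.comp (ξ x)))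
    (hT : T ∈ 𝓝 x₀) (hm₀ : 0 < m₀) {μ : RSpace (n + n) → RSpace n →L[ℝ] ℝ} {α₀ : RSpace n}
    (hμ : QuadratureCovAt D μ (joinL n (x₀, α₀)))
    (hsymm : ∀ᶠ y in 𝓝 (joinL n (x₀, α₀)), ∀ a b,
      fderiv ℝ μ y (joinL n (η (fstL n y) a, 0)) b -
      fderiv ℝ μ y (joinL n (η (fstL n y) b, 0)) a = μ y (B a b))
    (hinj : ∀ δ : RSpace n, fderiv ℝ μ (joinL n (x₀, α₀)) (joinL n (0, δ)) = 0 → δ = 0)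
    {H : RSpace n → ℝ} (hH : QuadratureAt D H α₀) (hH₀ : H α₀ = m₀ ^ 2)
    (hE : ∀ᶠ y in 𝓝 (joinL n (x₀, α₀)),
      q ((μ y).comp (transition ξ η (fstL n y)).inverse) = H (sndL n y)) :
    IntegrableByQuadratures D g c x₀ T m₀ := by
  set y₀ := joinL n (x₀, α₀) with hy₀
  have hfst₀ : fstL n y₀ = x₀ := fstL_joinL _
  have hfst : Tendsto (fstL n) (𝓝 y₀) (𝓝 x₀) := by
    have := (fstL n).continuous.tendsto y₀
    rwa [hfst₀] at this
  have hsnd : Tendsto (sndL n) (𝓝 y₀) (𝓝 α₀) := by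
    have := (sndL n).continuous.tendsto y₀
    rwa [hy₀, sndL_joinL] at this
  have hξi := h.isInvertible_ξ.eventually h.quadrature_ξ.contDiffAt.continuousAt
  have hηi := h.isInvertible_η.eventually h.quadrature_η.contDiffAt.continuousAt
  set p : RSpace (n + n) → RSpace n →L[ℝ] ℝ :=
    fun y => (μ y).comp (η (fstL n y)).inverse with hp
  have hclosed := fun {y} => InvariantFrames.closed_of_momentum (D := D) (η := η) (B := B)
    (μ := μ) (y := y)
  have hev := (((hμ.eventually.and hsymm).and (hfst.eventually
    (h.quadrature_η.eventually.and (hηi.and h.bracket)))))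
  have h₀ := hev.self_of_nhds
  have hc₀ := hclosed h₀.1.1 h₀.2.1 h₀.2.2.1 h₀.2.2.2 h₀.1.2
  have hHpos : 0 < H α₀ := by rw [hH₀]; positivity
  have hm : QuadratureAt D (fun α => √(H α)) α₀ := hH.sqrt hHpos
  have hfinal := exists_isCompleteIntegral (T := T) g c (p := p) (x₀ := x₀) (α₀ := α₀)
    (m := fun α => √(H α)) hc₀.1 hm (Eventually.of_forall fun α => Real.sqrt_nonneg _)
    (by
      filter_upwards [hev] with y hy
      exact (hclosed hy.1.1 hy.2.1 hy.2.2.1 hy.2.2.2 hy.1.2).2.2)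
    (by
      filter_upwards [hE, hfst.eventually (hq.and (hξi.and hηi)),
        hsnd.eventually (hH.continuousAt.eventually_const_lt hHpos)] with y hyE hy hpos
      rw [hy.1 (p y), Real.sq_sqrt hpos.le, ← hyE]
      congr 1
      have : (transition ξ η (fstL n y)).inverse = (η (fstL n y)).inverse.comp (ξ (fstL n y)) := by
        rw [transition, ContinuousLinearMap.IsInvertible.inverse_comp_of_left hy.2.1.inverse,
          hy.2.1.inverse_inverse]
      rw [this]
      rfl)
    (by
      intro δ hδ
      refine hinj δ ?_
      ext v
      have h1 := hc₀.2.1 (joinL n (0, δ)) v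
      rw [hδ] at h1
      simpa using h1.symm) hT
  obtain ⟨U, A, S, hU, hA, hUT, hxU, hαA, hS, hS', hmA⟩ := hfinal
  exact ⟨U, A, S, _, hU, hA, hUT, hxU, ⟨α₀, hαA, by rw [hH₀, Real.sqrt_sq hm₀.le]⟩, hS, hS', hmA⟩

/-- `hκ` says that P changes along a coadjoint direction at l₀, so P = α_k can be solved for t. The
form ω = μ(B · ·) then determines dt, and the Plücker relation makes the resulting form closed. `hH`
asks that the energy depend on the parameters alone once P = α_k holds. -/
theorem integrableByQuadratures_of_solvable (h : InvariantFrames D x₀ ξ η B)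
    (hq : ∀ᶠ x in 𝓝 x₀, ∀ p : RSpace n →L[ℝ] ℝ, ∑ i, ∑ j, (metricMatrix g c x)⁻¹ i j *
      p (Pi.single i 1) * p (Pi.single j 1) = q (p.comp (ξ x)))
    (hT : T ∈ 𝓝 x₀) (hm₀ : 0 < m₀) {P : (RSpace n →L[ℝ] ℝ) → ℝ} (hP : ContDiff ℝ ∞ P)
    (hPq : ∀ (m : ℕ) (l : RSpace m → RSpace n →L[ℝ] ℝ) (y : RSpace m), QuadratureCovAt D l y →
      QuadratureAt D (fun y => P (l y)) y)
    (l₀ : RSpace n →L[ℝ] ℝ) (β : RSpace n)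
    (hκ : fderiv ℝ P l₀ (l₀.comp (((transition ξ η x₀).comp (B β)).comp
      (transition ξ η x₀).inverse)) ≠ 0)
    (hH : ∀ (k : Fin n) (α₀ : RSpace n), (∀ i, i ≠ k → α₀ i = l₀ (Pi.single i 1)) →
      α₀ k = P l₀ → ∃ H : RSpace n → ℝ, QuadratureAt D H α₀ ∧ H α₀ = m₀ ^ 2 ∧
        ∀ᶠ z in 𝓝 (x₀, x₀), ∀ α : RSpace n,
          P (((sliceCovector k (l₀ (Pi.single k 1)) α).comp (transition ξ η z.2)).comp
            (transition ξ η z.1).inverse) = α k →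
          q (((sliceCovector k (l₀ (Pi.single k 1)) α).comp (transition ξ η z.2)).comp
            (transition ξ η z.1).inverse) = H α) :
    IntegrableByQuadratures D g c x₀ T m₀ := by
  set R := transition ξ η with hRdef
  have hRq : QuadratureMapAt D R x₀ := h.quadrature_transition
  have hRi : (R x₀).IsInvertible := h.isInvertible_transition
  set b := η x₀ β with hb
  have hRb : fderiv ℝ R x₀ b = (R x₀).comp (B β) := h.fderiv_transition.self_of_nhds β
  -- The component frozen in the family λ is one in which the coadjoint curve through l₀ moves: the
  -- slice is transverse to the curve.
  obtain ⟨k, hk⟩ : ∃ k : Fin n,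
      (l₀.comp (((R x₀).comp (B β)).comp (R x₀).inverse)) (Pi.single k 1) ≠ 0 := by
    by_contra! hcon
    apply hκ
    have : l₀.comp (((R x₀).comp (B β)).comp (R x₀).inverse) = 0 := by
      rw [← covector_components (l₀.comp _)]
      simp only [hcon]
      exact map_zero _
    rw [this, map_zero]
  obtain ⟨α₀, t, hα₀, hα₀k, ht, ht₀, heq⟩ := exists_implicit_parameter (b := b) hRq hRi hP hPq l₀
    (by rwa [hRb]) k
  set a := l₀ (Pi.single k 1) with ha
  obtain ⟨H, hHq, hH₀, hHE⟩ := hH k α₀ hα₀ hα₀k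
  set y₀ := joinL n (x₀, α₀) with hy₀
  have hfst₀ : fstL n y₀ = x₀ := fstL_joinL _
  have hfst : Tendsto (fstL n) (𝓝 y₀) (𝓝 x₀) := by
    have := (fstL n).continuous.tendsto y₀
    rwa [hfst₀] at this
  have hline₀ : x₀ + t y₀ • b = x₀ := by simp [ht₀]
  have hline : Tendsto (fun y => x₀ + t y • b) (𝓝 y₀) (𝓝 x₀) := by
    have : ContinuousAt (fun y => x₀ + t y • b) y₀ :=
      continuousAt_const.add (ht.continuousAt.smul continuousAt_const)
    have h1 := this.tendsto
    rwa [hline₀] at h1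
  have hRi' := hRi.eventually hRq.contDiffAt.continuousAt
  have hηi := h.isInvertible_η.eventually h.quadrature_η.contDiffAt.continuousAt
  -- Here d is the differential of P in the Killing frame, and β' is the velocity b of the line
  -- expressed in the frame η at the point x₀ + t b.
  have hmain : ∀ᶠ y in 𝓝 y₀, QuadratureCovAt D (momentum R x₀ b k a t) y ∧
      (∃ d β' : RSpace n, (∀ l : RSpace n →L[ℝ] ℝ,
        fderiv ℝ P ((momentum R x₀ b k a t y).comp (R (fstL n y)).inverse)
          (l.comp (R (fstL n y)).inverse) = l d) ∧ (∀ h, fderiv ℝ (momentum R x₀ b k a t) y h =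
        (covector n (dropCoord k (sndL n h))).comp (R (x₀ + t y • b)) +
          fderiv ℝ t y h • (momentum R x₀ b k a t y).comp (B β')) ∧
        η (x₀ + t y • b) β' = b ∧
        (∀ h a', fstL n h = η (fstL n y) a' → fderiv ℝ (momentum R x₀ b k a t) y h d -
          momentum R x₀ b k a t y (B a' d) = sndL n h k)) := by
    filter_upwards [ht.eventually, heq.eventually_nhds,
      hfst.eventually (hRq.eventually.and (hRi'.and h.fderiv_transition)),
      hline.eventually (hRq.eventually.and (hηi.and h.fderiv_transition))]
      with y hty heqy hx hz
    have hμ : QuadratureCovAt D (momentum R x₀ b k a t) y := quadratureCovAt_momentum hz.1 hty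
    refine ⟨hμ, ?_⟩
    obtain ⟨d, hd, hd'⟩ := exists_fderiv_momentum_eq (hP.differentiable (by simp)) hμ hx.1 hx.2.1
      heqy
    have hβ' := hz.2.1.apply_inverse b
    refine ⟨d, (η (x₀ + t y • b)).inverse b, hd, fun h' => ?_, hβ', fun h' a' ha' => ?_⟩
    · refine fderiv_momentum hty.differentiableAt
        (hz.1.contDiffAt.differentiableAt (by simp)) ?_ h'
      have := hz.2.2 ((η (x₀ + t y • b)).inverse b)
      rwa [hβ'] at this
    · have h1 := hd' h'
      rw [ha', hx.2.2 a'] at h1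
      rw [← h1]
      simp only [ContinuousLinearMap.comp_apply]
      rw [← hRdef, hx.2.1.inverse_apply]
  have hmain₀ := hmain.self_of_nhds
  refine integrableByQuadratures_of_momentum h hq hT hm₀ hmain₀.1 ?_ ?_ hHq hH₀ ?_
  · filter_upwards [hmain] with y hy
    obtain ⟨-, d, β', hd, hder, -, hrel⟩ := hy
    set μ := momentum R x₀ b k a t with hμdef
    -- Differentiating P = α_k along η a' with α fixed: dt(η a') ω(β', d) = ω(a', d).
    have h1 : ∀ a', fderiv ℝ t y (joinL n (η (fstL n y) a', 0)) * μ y (B β' d) =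
        μ y (B a' d) := by
      intro a'
      have := hrel (joinL n (η (fstL n y) a', 0)) a' (fstL_joinL _)
      rw [hder] at this
      simp only [sndL_joinL, map_zero, Pi.zero_apply] at this
      simp at this
      linarith
    -- Differentiating along α_k, on which λ does not depend, gives (∂t/∂α_k) ω(β', d) = 1.
    have h2 : μ y (B β' d) ≠ 0 := by
      intro h0
      have := hrel (joinL n (0, Pi.single k 1)) 0 (by simp)
      rw [hder] at this
      have hdrop : dropCoord k (Pi.single k (1 : ℝ)) = 0 := by simp [dropCoord_apply]
      simp [sndL_joinL, hdrop, h0] at this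
    intro a' c'
    rw [hder, hder]
    simp only [sndL_joinL, map_zero]
    simp only [ContinuousLinearMap.zero_comp, zero_add, smul_apply,
      ContinuousLinearMap.comp_apply, smul_eq_mul]
    -- Multiplied by ω(β', d), the closedness condition becomes the Plücker relation for these four
    -- vectors.
    have hpl := h.plucker (μ y) a' β' c' d
    rw [h.antisymm a' β'] at hpl
    simp only [map_neg] at hpl
    have e1 := h1 a'
    have e2 := h1 c'
    apply mul_right_cancel₀ h2
    calc _ = (fderiv ℝ t y (joinL n (η (fstL n y) a', 0)) * μ y (B β' d)) * μ y (B β' c') -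
          (fderiv ℝ t y (joinL n (η (fstL n y) c', 0)) * μ y (B β' d)) * μ y (B β' a') := by ring
      _ = _ := by rw [e1, e2]; linarith
  · obtain ⟨-, d, β', hd, hder, hβ', hrel⟩ := hmain₀
    intro δ hδ
    -- The relation P = α_k forces δ_k = 0. What remains is δ + τ l₀∘(R B_β R⁻¹) = 0 at x₀, whose
    -- k-th component gives τ = 0 by the choice of k.
    have hk0 : δ k = 0 := by
      have := hrel (joinL n (0, δ)) 0 (by simp)
      rw [hδ] at this
      simpa using this.symm
    have hdrop : dropCoord k δ = δ := by simp [dropCoord_apply, hk0]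
    rw [hline₀] at hβ'
    have hββ : β' = β := by
      obtain ⟨e, he⟩ := h.isInvertible_η
      rw [hb, ← he] at hβ'
      exact e.injective hβ'
    have hμ₀ : momentum R x₀ b k a t y₀ = l₀.comp (R x₀) := by
      rw [momentum, hline₀, hy₀, sndL_joinL, sliceCovector_self k l₀ hα₀]
    have h1 := hder (joinL n (0, δ))
    rw [hδ, sndL_joinL, hdrop, hline₀, hμ₀, hββ] at h1
    set τ := fderiv ℝ t y₀ (joinL n (0, δ)) with hτ
    have h2 : covector n δ + τ • l₀.comp (((R x₀).comp (B β)).comp (R x₀).inverse) = 0 := by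
      have := congrArg (fun L : RSpace n →L[ℝ] ℝ => L.comp (R x₀).inverse) h1
      simp only [ContinuousLinearMap.add_comp, ContinuousLinearMap.smul_comp,
        ContinuousLinearMap.zero_comp, ContinuousLinearMap.comp_assoc,
        hRi.self_comp_inverse, ContinuousLinearMap.comp_id] at this
      simpa [ContinuousLinearMap.comp_assoc] using this.symm
    have h3 : τ = 0 := by
      have := congrArg (fun L : RSpace n →L[ℝ] ℝ => L (Pi.single k 1)) h2
      simp only [add_apply, smul_apply, covector_single, hk0, zero_add, smul_eq_mul,
        zero_apply, mul_eq_zero] at this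
      exact this.resolve_right hk
    rw [h3, zero_smul, add_zero] at h2
    exact covector_injective (h2.trans (map_zero _).symm)
  · filter_upwards [heq, (hfst.prodMk_nhds hline).eventually hHE] with y hy hy'
    exact hy' (sndL n y) hy

end LocalTheory

/-! ### Quadratic Hamiltonians and the three cases -/

section LocalTheory

open Filter Topology

variable {D : KnownFunctions} {n : ℕ}

/-- The quadratic form on covectors with the matrix `q`. -/
def covectorForm (q : Matrix (Fin n) (Fin n) ℝ) (l : RSpace n →L[ℝ] ℝ) : ℝ :=
  ∑ i, ∑ j, q i j * l (Pi.single i 1) * l (Pi.single j 1)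

variable {q : Matrix (Fin n) (Fin n) ℝ}

theorem contDiff_covectorForm : ContDiff ℝ ∞ (covectorForm q) := by
  unfold covectorForm
  fun_prop

theorem quadratureAt_covectorForm {k : ℕ} {l : RSpace k → RSpace n →L[ℝ] ℝ} {y : RSpace k}
    (hl : QuadratureCovAt D l y) : QuadratureAt D (fun y => covectorForm q (l y)) y :=
  QuadratureAt.sum _ fun i _ => QuadratureAt.sum _ fun j _ =>
    ((QuadratureAt.const _).mul (hl i)).mul (hl j)

theorem fderiv_covectorForm (l l' : RSpace n →L[ℝ] ℝ) :
    fderiv ℝ (covectorForm q) l l' = ∑ i, ∑ j, q i j *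
      (l' (Pi.single i 1) * l (Pi.single j 1) + l (Pi.single i 1) * l' (Pi.single j 1)) := by
  have hline : HasDerivAt (fun s : ℝ => l + s • l') l' 0 := by
    simpa using ((hasDerivAt_id (0 : ℝ)).smul_const l').const_add l
  have hd : HasFDerivAt (covectorForm q) (fderiv ℝ (covectorForm q) l) (l + (0 : ℝ) • l') := by
    simpa using (contDiff_covectorForm.differentiable (by simp) l).hasFDerivAt
  have h1 := hd.comp_hasDerivAt (0 : ℝ) hline
  refine h1.unique ?_
  have hi : ∀ i, HasDerivAt (fun s : ℝ => (l + s • l') (Pi.single i 1))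
      (l' (Pi.single i 1)) 0 := fun i => by
    simpa using ((hasDerivAt_id (0 : ℝ)).mul_const (l' (Pi.single i 1))).const_add
      (l (Pi.single i 1))
  change HasDerivAt (fun s : ℝ => ∑ i, ∑ j, q i j * (l + s • l') (Pi.single i 1) *
    (l + s • l') (Pi.single j 1)) _ 0
  refine HasDerivAt.fun_sum fun i _ => HasDerivAt.fun_sum fun j _ => ?_
  have := ((hi i).const_mul (q i j)).mul (hi j)
  refine this.congr_deriv ?_
  simp
  ring

theorem covectorForm_smul (s : ℝ) (l : RSpace n →L[ℝ] ℝ) :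
    covectorForm q (s • l) = s ^ 2 * covectorForm q l := by
  simp only [covectorForm, smul_apply, smul_eq_mul, Finset.mul_sum]
  exact Finset.sum_congr rfl fun i _ => Finset.sum_congr rfl fun j _ => by ring

theorem fderiv_covectorForm_smul (s : ℝ) (C : RSpace n →L[ℝ] RSpace n) (l : RSpace n →L[ℝ] ℝ) :
    fderiv ℝ (covectorForm q) (s • l) ((s • l).comp C) =
      s ^ 2 * fderiv ℝ (covectorForm q) l (l.comp C) := by
  simp only [fderiv_covectorForm, smul_apply, smul_eq_mul, Finset.mul_sum,
    ContinuousLinearMap.comp_apply]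
  exact Finset.sum_congr rfl fun i _ => Finset.sum_congr rfl fun j _ => by ring

/-- For fixed C, the map l ↦ dq_l(l∘C) is a quadratic form. The parallelogram law lets its vanishing
on the open cone q > 0 propagate to all covectors. -/
theorem fderiv_covectorForm_parallelogram (s : ℝ) (C : RSpace n →L[ℝ] RSpace n)
    (l l' : RSpace n →L[ℝ] ℝ) :
    fderiv ℝ (covectorForm q) (l + s • l') ((l + s • l').comp C) +
      fderiv ℝ (covectorForm q) (l + (-s) • l') ((l + (-s) • l').comp C) =
      2 * fderiv ℝ (covectorForm q) l (l.comp C) +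
        2 * s ^ 2 * fderiv ℝ (covectorForm q) l' (l'.comp C) := by
  simp only [fderiv_covectorForm, add_apply, smul_apply, smul_eq_mul,
    Finset.mul_sum, ContinuousLinearMap.comp_apply, ← Finset.sum_add_distrib]
  exact Finset.sum_congr rfl fun i _ => Finset.sum_congr rfl fun j _ => by ring

/-- A perturbation of a covector on which the form is positive. -/
theorem exists_perturbation_pos {l : RSpace n →L[ℝ] ℝ} (hl : 0 < covectorForm q l)
    (l' : RSpace n →L[ℝ] ℝ) :
    ∃ s : ℝ, s ≠ 0 ∧ 0 < covectorForm q (l + s • l') ∧ 0 < covectorForm q (l + (-s) • l') := by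
  have hcont : ∀ σ : ℝ, ∀ᶠ s in 𝓝 (0 : ℝ), 0 < covectorForm q (l + (σ * s) • l') := by
    intro σ
    have : ContinuousAt (fun s : ℝ => covectorForm q (l + (σ * s) • l')) 0 :=
      (contDiff_covectorForm.continuous.comp (by fun_prop)).continuousAt
    exact this.eventually_const_lt (by simpa using hl)
  have h1 := ((hcont 1).and (hcont (-1))).filter_mono (nhdsWithin_le_nhds (s := {(0 : ℝ)}ᶜ))
  obtain ⟨s, hs, hs0⟩ := (h1.and eventually_mem_nhdsWithin).exists
  exact ⟨s, hs0, by simpa using hs.1, by simpa using hs.2⟩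

theorem exists_smul_covectorForm_eq {l : RSpace n →L[ℝ] ℝ} (hl : 0 < covectorForm q l) {m₀ : ℝ}
    (hm₀ : 0 < m₀) : ∃ s : ℝ, s ≠ 0 ∧ covectorForm q (s • l) = m₀ ^ 2 := by
  refine ⟨m₀ / √(covectorForm q l), by positivity, ?_⟩
  rw [covectorForm_smul, div_pow, Real.sq_sqrt hl.le]
  field_simp

variable {M : Type*} [TopologicalSpace M] [ChartedSpace (RSpace n) M]
  [IsManifold 𝓘(ℝ, RSpace n) ∞ M]
  {x₀ : RSpace n} {ξ η : RSpace n → RSpace n →L[ℝ] RSpace n}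
  {B : RSpace n →L[ℝ] RSpace n →L[ℝ] RSpace n} {g : PseudoRiemannianMetric n M}
  {c : OpenPartialHomeomorph M (RSpace n)} {T : Set (RSpace n)} {m₀ : ℝ}

namespace InvariantFrames

/-- A function that depends on `x` through the transition matrix only and is annihilated by all
fields of the frame `η` is constant near `x₀`. -/
theorem eventually_eq_of_fderiv_eq_zero {F : Type*} [NormedAddCommGroup F] [NormedSpace ℝ F]
    (h : InvariantFrames D x₀ ξ η B) {ι : Type*}
    {f : ι → (RSpace n →L[ℝ] RSpace n) → F} (hf : ∀ i, Differentiable ℝ (f i))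
    (hd : ∀ i L b, fderiv ℝ (f i) L (L.comp (B b)) = 0) :
    ∀ᶠ x in 𝓝 x₀, ∀ i, f i (transition ξ η x) = f i (transition ξ η x₀) := by
  have hηi := h.isInvertible_η.eventually h.quadrature_η.contDiffAt.continuousAt
  obtain ⟨r, hr, hball⟩ := Metric.eventually_nhds_iff_ball.1
    ((h.quadrature_transition.eventually.and hηi).and h.fderiv_transition)
  filter_upwards [Metric.ball_mem_nhds x₀ hr] with x hx i
  have hder : ∀ z ∈ Metric.ball x₀ r,
      HasFDerivAt (fun z => f i (transition ξ η z)) (0 : RSpace n →L[ℝ] F) z := by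
    intro z hz
    have h1 := (hf i (transition ξ η z)).hasFDerivAt.comp z
      ((hball z hz).1.1.contDiffAt.differentiableAt (by simp)).hasFDerivAt
    refine h1.congr_fderiv ?_
    ext v
    -- Each direction v is a value η(z)b of the frame, and along it R changes by R∘B b, which f does
    -- not see to first order.
    rw [← (hball z hz).1.2.apply_inverse v, ContinuousLinearMap.comp_apply, (hball z hz).2, hd]
    rfl
  exact Metric.isOpen_ball.is_const_of_fderiv_eq_zero (𝕜 := ℝ) (convex_ball x₀ r).isPreconnected
    (fun z hz => (hder z hz).differentiableAt.differentiableWithinAt)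
    (fun z hz => (hder z hz).fderiv) hx (Metric.mem_ball_self hr)

/-- If the Hamiltonian is a Casimir function, it is invariant under the transition matrices. -/
theorem eventually_covectorForm_eq (h : InvariantFrames D x₀ ξ η B)
    (hinv : ∀ (l : RSpace n →L[ℝ] ℝ) (β : RSpace n), fderiv ℝ (covectorForm q) l
      (l.comp (((transition ξ η x₀).comp (B β)).comp (transition ξ η x₀).inverse)) = 0) :
    ∀ᶠ x in 𝓝 x₀, ∀ l : RSpace n →L[ℝ] ℝ,
      covectorForm q ((l.comp (transition ξ η x)).comp (transition ξ η x₀).inverse) =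
        covectorForm q l := by
  set R₀ := transition ξ η x₀ with hR₀
  have hRi : R₀.IsInvertible := h.isInvertible_transition
  obtain ⟨Λ, hΛ⟩ : ∃ Λ : (RSpace n →L[ℝ] ℝ) →
      (RSpace n →L[ℝ] RSpace n) →L[ℝ] (RSpace n →L[ℝ] ℝ),
      ∀ l L, Λ l L = (l.comp L).comp R₀.inverse :=
    ⟨fun l => ((ContinuousLinearMap.compL ℝ (RSpace n) (RSpace n) ℝ).flip R₀.inverse).comp
      (ContinuousLinearMap.compL ℝ (RSpace n) (RSpace n) ℝ l), fun _ _ => rfl⟩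
  have hfd : ∀ l L, HasFDerivAt (fun L => covectorForm q (Λ l L))
      ((fderiv ℝ (covectorForm q) (Λ l L)).comp (Λ l)) L := fun l L =>
    ((contDiff_covectorForm.differentiable (by simp) (Λ l L)).hasFDerivAt).comp L
      (Λ l).hasFDerivAt
  have key := h.eventually_eq_of_fderiv_eq_zero (f := fun l L => covectorForm q (Λ l L))
    (fun l L => (hfd l L).differentiableAt) (by
      intro l L b
      rw [(hfd l L).fderiv, ContinuousLinearMap.comp_apply, ← hinv (Λ l L) b]
      have : Λ l (L.comp (B b)) = (Λ l L).comp ((R₀.comp (B b)).comp R₀.inverse) := by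
        ext v
        simp only [hΛ, ContinuousLinearMap.comp_apply, hRi.inverse_apply]
      rw [this])
  filter_upwards [key] with x hx l
  have := hx l
  rw [← hR₀] at this
  simp only [hΛ] at this
  rw [this, ContinuousLinearMap.comp_assoc, hRi.self_comp_inverse, ContinuousLinearMap.comp_id]

/-- For B = 0 the transition matrix is locally constant, so a momentum independent of x is closed
and has constant energy; all n components of λ serve as parameters. -/
theorem integrableByQuadratures_of_abelian (h : InvariantFrames D x₀ ξ η B) (hB : B = 0)
    (hq : ∀ᶠ x in 𝓝 x₀, ∀ p : RSpace n →L[ℝ] ℝ, ∑ i, ∑ j, (metricMatrix g c x)⁻¹ i j *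
      p (Pi.single i 1) * p (Pi.single j 1) = covectorForm q (p.comp (ξ x)))
    {l₀ : RSpace n →L[ℝ] ℝ} (hl₀ : covectorForm q l₀ = m₀ ^ 2) (hT : T ∈ 𝓝 x₀) (hm₀ : 0 < m₀) :
    IntegrableByQuadratures D g c x₀ T m₀ := by
  set R₀ := transition ξ η x₀ with hR₀
  have hRi : R₀.IsInvertible := h.isInvertible_transition
  let Λ : RSpace (n + n) →L[ℝ] (RSpace n →L[ℝ] ℝ) :=
    ((ContinuousLinearMap.compL ℝ (RSpace n) (RSpace n) ℝ).flip R₀).comp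
      ((covector n).comp (sndL n))
  have hΛ : ∀ y, Λ y = (covector n (sndL n y)).comp R₀ := fun _ => rfl
  have hconst : ∀ᶠ x in 𝓝 x₀, ∀ i : Unit, transition ξ η x = R₀ :=
    h.eventually_eq_of_fderiv_eq_zero (f := fun (_ : Unit) L => L) (fun _ => differentiable_id)
      (by intro i L b; simp [hB])
  have hcov : ∀ (m : ℕ) (y : RSpace m) (u : RSpace m → RSpace n),
      (∀ i, QuadratureAt D (fun y => u y i) y) →
      QuadratureCovAt D (fun y => covector n (u y)) y := fun m y u hu i => by
    simpa only [covector_single] using hu i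
  have hfst : Tendsto (fstL n) (𝓝 (joinL n (x₀, fun i => l₀ (Pi.single i 1)))) (𝓝 x₀) := by
    have := (fstL n).continuous.tendsto (joinL n (x₀, fun i => l₀ (Pi.single i 1)))
    rwa [fstL_joinL] at this
  refine integrableByQuadratures_of_momentum h hq hT hm₀ (μ := Λ)
    (α₀ := fun i => l₀ (Pi.single i 1)) (H := fun α => covectorForm q (covector n α)) ?_ ?_ ?_
    (quadratureAt_covectorForm (hcov n _ _ fun i => .coord i)) ?_ ?_
  · exact (hcov _ _ _ fun i => quadratureAt_sndL i _).comp fun i j => QuadratureAt.const _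
  · refine Eventually.of_forall fun y a b => ?_
    simp [Λ.hasFDerivAt.fderiv, hΛ, hB]
  · intro δ hδ
    rw [Λ.hasFDerivAt.fderiv, hΛ, sndL_joinL] at hδ
    refine covector_injective ?_
    ext v
    rw [← hRi.apply_inverse v]
    simpa using congrArg (fun L : RSpace n →L[ℝ] ℝ => L (R₀.inverse v)) hδ
  · rw [covector_components, hl₀]
  · filter_upwards [hfst.eventually hconst] with y hy
    rw [hy (), hΛ, ContinuousLinearMap.comp_assoc, hRi.self_comp_inverse,
      ContinuousLinearMap.comp_id]

/-- The cases differ in what moves along coadjoint orbits at the level q = m₀²: the Hamiltonian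
itself, only some linear function, or nothing. -/
theorem integrableByQuadratures (h : InvariantFrames D x₀ ξ η B)
    (hq : ∀ᶠ x in 𝓝 x₀, ∀ p : RSpace n →L[ℝ] ℝ, ∑ i, ∑ j, (metricMatrix g c x)⁻¹ i j *
      p (Pi.single i 1) * p (Pi.single j 1) = covectorForm q (p.comp (ξ x)))
    (hpos : ∃ l, 0 < covectorForm q l) (hT : T ∈ 𝓝 x₀) (hm₀ : 0 < m₀) :
    IntegrableByQuadratures D g c x₀ T m₀ := by
  set R := transition ξ η with hR
  have hRi : (R x₀).IsInvertible := h.isInvertible_transition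
  obtain ⟨l₁, hl₁⟩ := hpos
  let C : RSpace n → RSpace n →L[ℝ] RSpace n := fun β =>
    ((R x₀).comp (B β)).comp (R x₀).inverse
  by_cases h1 : ∃ l₀ β, covectorForm q l₀ = m₀ ^ 2 ∧
      fderiv ℝ (covectorForm q) l₀ (l₀.comp (C β)) ≠ 0
  · obtain ⟨l₀, β, hl₀, hκ⟩ := h1
    -- With P = q the energy is the parameter α_k itself.
    refine integrableByQuadratures_of_solvable h hq hT hm₀ contDiff_covectorForm
      (fun m l y hl => quadratureAt_covectorForm hl) l₀ β hκ fun k α₀ _ hα₀ => ?_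
    exact ⟨fun α => α k, QuadratureAt.coord k, hα₀.trans hl₀,
      Eventually.of_forall fun z α hα => hα⟩
  -- Now q is infinitesimally invariant on the level q = m₀². Scaling extends this to the cone q >
  -- 0, and the parallelogram law to all covectors, so q is a Casimir function.
  push Not at h1
  have hcone : ∀ l, 0 < covectorForm q l → ∀ β,
      fderiv ℝ (covectorForm q) l (l.comp (C β)) = 0 := by
    intro l hl β
    obtain ⟨s, hs, hsl⟩ := exists_smul_covectorForm_eq hl hm₀
    have := h1 (s • l) β hsl
    rw [fderiv_covectorForm_smul] at this
    exact (mul_eq_zero.1 this).resolve_left (pow_ne_zero 2 hs)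
  have hinv : ∀ l β, fderiv ℝ (covectorForm q) l (l.comp (C β)) = 0 := by
    intro l β
    obtain ⟨s, hs, hp, hn⟩ := exists_perturbation_pos hl₁ l
    have := fderiv_covectorForm_parallelogram (q := q) s (C β) l₁ l
    rw [hcone _ hp, hcone _ hn, hcone _ hl₁] at this
    have h2 : s ^ 2 ≠ 0 := pow_ne_zero 2 hs
    have h3 : s ^ 2 * fderiv ℝ (covectorForm q) l (l.comp (C β)) = 0 := by linarith
    exact (mul_eq_zero.1 h3).resolve_left h2
  by_cases h2 : ∃ l₀ : RSpace n →L[ℝ] ℝ, ∃ β, covectorForm q l₀ = m₀ ^ 2 ∧ l₀.comp (C β) ≠ 0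
  · obtain ⟨l₀, β, hl₀, hne⟩ := h2
    obtain ⟨w, hw⟩ : ∃ w, (l₀.comp (C β)) w ≠ 0 := by
      by_contra! hcon
      exact hne (ContinuousLinearMap.ext hcon)
    -- Evaluation at w varies along the orbit of l₀, which is all that solving for t requires;
    -- invariance of q makes the energy q(λ).
    let P : (RSpace n →L[ℝ] ℝ) →L[ℝ] ℝ := ContinuousLinearMap.apply ℝ ℝ w
    refine integrableByQuadratures_of_solvable h hq hT hm₀ (P := P) P.contDiff
      (fun m l y hl => hl.apply (v := fun _ => w) fun i => QuadratureAt.const _) l₀ β ?_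
      fun k α₀ hα₀ _ => ?_
    · rw [P.hasFDerivAt.fderiv]
      exact hw
    refine ⟨fun α => covectorForm q (sliceCovector k (l₀ (Pi.single k 1)) α),
      quadratureAt_covectorForm (quadratureCovAt_sliceCovector (u := fun α => α) k _
        fun i => QuadratureAt.coord i), ?_, ?_⟩
    · simp only [sliceCovector_self k l₀ hα₀, hl₀]
    · have hev := h.eventually_covectorForm_eq hinv
      have hRi' := hRi.eventually h.quadrature_transition.contDiffAt.continuousAt
      filter_upwards [(hev.and hRi').prod_nhds hev] with z hz α _
      rw [← hz.1.1, ContinuousLinearMap.comp_assoc _ _ (transition ξ η z.1),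
        hz.1.2.inverse_comp_self, ContinuousLinearMap.comp_id, hz.2]
  -- No covector on the level moves under the coadjoint action. Scaling and a small perturbation of
  -- l₁ extend this to all covectors, whence B = 0.
  · push Not at h2
    obtain ⟨s, hs, hsl⟩ := exists_smul_covectorForm_eq hl₁ hm₀
    refine h.integrableByQuadratures_of_abelian ?_ hq hsl hT hm₀
    have hcone' : ∀ l, 0 < covectorForm q l → ∀ β, l.comp (C β) = 0 := by
      intro l hl β
      obtain ⟨s, hs, hsl⟩ := exists_smul_covectorForm_eq hl hm₀
      have := h2 (s • l) β hsl
      rw [ContinuousLinearMap.smul_comp] at this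
      exact (smul_eq_zero.1 this).resolve_left hs
    have hall : ∀ (l : RSpace n →L[ℝ] ℝ) β, l.comp (C β) = 0 := by
      intro l β
      obtain ⟨s, hs, hp, -⟩ := exists_perturbation_pos hl₁ l
      have := hcone' _ hp β
      rw [ContinuousLinearMap.add_comp, hcone' _ hl₁, zero_add,
        ContinuousLinearMap.smul_comp] at this
      exact (smul_eq_zero.1 this).resolve_left hs
    have hC : ∀ β, C β = 0 := by
      intro β
      ext v i
      exact congrArg (fun L : RSpace n →L[ℝ] ℝ => L v) (hall (ContinuousLinearMap.proj i) β)
    ext β v i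
    have h3 : R x₀ (B β v) = 0 := by
      have := congrArg (fun L : RSpace n →L[ℝ] RSpace n => L (R x₀ v)) (hC β)
      simpa [C, hRi.inverse_apply] using this
    have h4 : B β v = 0 := by
      rw [← hRi.inverse_apply (B β v), h3, map_zero]
    simp [h4]

end InvariantFrames

end LocalTheory

/-! ### The orbit map of a simply transitive action is a diffeomorphism -/

section Transitive

open Filter Topology

section Differential

variable (n : ℕ) {X Y Z : Type*} [TopologicalSpace X] [ChartedSpace (RSpace n) X]
  [TopologicalSpace Y] [ChartedSpace (RSpace n) Y] [TopologicalSpace Z] [ChartedSpace (RSpace n) Z]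

/-- The differential of a map between `n`-dimensional manifolds, as a linear map of the model
space. -/
def dmap (f : X → Y) (x : X) : RSpace n →L[ℝ] RSpace n :=
  mfderiv 𝓘(ℝ, RSpace n) 𝓘(ℝ, RSpace n) f x

variable {n}

theorem dmap_comp {g : Y → Z} {f : X → Y} {x : X} {y : Y}
    (hg : MDifferentiableAt 𝓘(ℝ, RSpace n) 𝓘(ℝ, RSpace n) g y)
    (hf : MDifferentiableAt 𝓘(ℝ, RSpace n) 𝓘(ℝ, RSpace n) f x) (hy : f x = y) :
    dmap n (fun x => g (f x)) x = (dmap n g y).comp (dmap n f x) := by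
  subst hy
  exact mfderiv_comp x hg hf

theorem dmap_congr {f f' : X → Y} {x : X} (h : f =ᶠ[𝓝 x] f') : dmap n f x = dmap n f' x :=
  h.mfderiv_eq

theorem dmap_id (x : X) : dmap n (fun x : X => x) x = ContinuousLinearMap.id ℝ (RSpace n) :=
  mfderiv_id

theorem dmap_eq_fderiv_chart {f : X → Y} {x : X}
    (hf : MDifferentiableAt 𝓘(ℝ, RSpace n) 𝓘(ℝ, RSpace n) f x) :
    dmap n f x = fderiv ℝ (fun u => chartAt (RSpace n) (f x) (f ((chartAt (RSpace n) x).symm u)))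
      (chartAt (RSpace n) x x) := by
  refine hf.mfderiv.trans ?_
  simp [writtenInExtChartAt, Function.comp_def, fderivWithin_univ]
  rfl

end Differential

section PsiInv

variable {n : ℕ} {G M : Type*} [Group G] [MulAction G M]

theorem psiInv_smul (hsimple : SimplyTransitive G M) (o : M) (z : G) : psiInv G o (z • o) = z := by
  have hinj : Function.Injective fun z : G => z • o := fun z w h =>
    (hsimple o (w • o)).unique h rfl
  exact Function.leftInverse_invFun hinj z

theorem smul_psiInv (hsimple : SimplyTransitive G M) (o x : M) : psiInv G o x • o = x := by
  obtain ⟨z, rfl, -⟩ := hsimple o x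
  simp only [psiInv_smul hsimple]

end PsiInv

section Smooth

variable {n : ℕ} {G M : Type*} [TopologicalSpace G] [ChartedSpace (RSpace n) G] [Group G]
  [TopologicalSpace M] [ChartedSpace (RSpace n) M] [MulAction G M]
  [ContMDiffSMul 𝓘(ℝ, RSpace n) 𝓘(ℝ, RSpace n) ∞ G M]

variable (n G) in
theorem contMDiff_orbit (o : M) :
    ContMDiff 𝓘(ℝ, RSpace n) 𝓘(ℝ, RSpace n) ∞ fun z : G => z • o :=
  contMDiff_id.smul contMDiff_const

variable (n M) in
theorem contMDiff_translation (z : G) :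
    ContMDiff 𝓘(ℝ, RSpace n) 𝓘(ℝ, RSpace n) ∞ fun x : M => z • x :=
  ContMDiffSMul.contMDiff_const_smul (I := 𝓘(ℝ, RSpace n)) z

theorem mdifferentiable_orbit (o : M) :
    MDifferentiable 𝓘(ℝ, RSpace n) 𝓘(ℝ, RSpace n) fun z : G => z • o :=
  (contMDiff_orbit n G o).mdifferentiable (by simp)

theorem mdifferentiable_translation (z : G) :
    MDifferentiable 𝓘(ℝ, RSpace n) 𝓘(ℝ, RSpace n) fun x : M => z • x :=
  (contMDiff_translation n M z).mdifferentiable (by simp)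

end Smooth

variable {n : ℕ} {G : Type*} [TopologicalSpace G] [ChartedSpace (RSpace n) G] [Group G]
  [LieGroup 𝓘(ℝ, RSpace n) ∞ G]

theorem mdifferentiable_leftMul (z : G) :
    MDifferentiable 𝓘(ℝ, RSpace n) 𝓘(ℝ, RSpace n) fun w : G => z * w :=
  (contMDiff_mul_left (I := 𝓘(ℝ, RSpace n)) (n := ∞) (a := z)).mdifferentiable (by simp)

variable {M : Type*} [TopologicalSpace M] [ChartedSpace (RSpace n) M]
  [MulAction G M] [ContMDiffSMul 𝓘(ℝ, RSpace n) 𝓘(ℝ, RSpace n) ∞ G M]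

/-- The differential of the orbit map is equivariant. -/
theorem dmap_orbit_leftMul (o : M) (z : G) :
    (dmap n (fun w : G => w • o) z).comp (dmap n (fun w : G => z * w) 1) =
      (dmap n (fun x : M => z • x) o).comp (dmap n (fun w : G => w • o) 1) := by
  rw [← dmap_comp (mdifferentiable_orbit o z) (mdifferentiable_leftMul z 1) (mul_one z),
    ← dmap_comp (mdifferentiable_translation z o) (mdifferentiable_orbit o 1) (one_smul G o)]
  congr 1
  funext w
  exact mul_smul z w o

variable [IsManifold 𝓘(ℝ, RSpace n) ∞ M]

/-- The orbit map of a simply transitive action is an immersion at the identity: otherwise it would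
collapse the integral curve of a left-invariant field. -/
theorem dmap_orbit_one_injective (hsimple : SimplyTransitive G M) (o : M) (v : RSpace n)
    (hv : dmap n (fun w : G => w • o) 1 v = 0) : v = 0 := by
  have hLie : LieGroup 𝓘(ℝ, RSpace n) (minSmoothness ℝ 3) G :=
    LieGroup.of_le (n := ∞) (by simpa using ENat.LEInfty.out)
  have hIG : IsManifold 𝓘(ℝ, RSpace n) 1 G := IsManifold.of_le (n := ∞) (by simp)
  have hIM : IsManifold 𝓘(ℝ, RSpace n) 1 M := IsManifold.of_le (n := ∞) (by simp)
  have hV := (contMDiff_mulInvariantVectorField (I := 𝓘(ℝ, RSpace n)) (G := G) (𝕜 := ℝ) v)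
  -- The integral curve of the left-invariant field of v through 1. If v is in the kernel,
  -- equivariance makes t ↦ γ(t)·o stationary, and simple transitivity then makes γ itself constant.
  obtain ⟨γ, hγ0, hγ⟩ := exists_isMIntegralCurveAt_of_contMDiffAt_boundaryless (t₀ := 0)
    ((hV.of_le (n := minSmoothness ℝ 2) (m := 1) (by simp)).contMDiffAt (x := (1 : G)))
  have hzero : ∀ z : G, dmap n (fun w : G => w • o) z
      (mulInvariantVectorField (I := 𝓘(ℝ, RSpace n)) v z : RSpace n) = 0 := by
    intro z
    have h1 := congrArg (fun L : RSpace n →L[ℝ] RSpace n => L v) (dmap_orbit_leftMul o z)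
    simp only [ContinuousLinearMap.comp_apply, hv, map_zero] at h1
    exact h1
  have hsmul : ∀ V : RSpace n, ((1 : ℝ →L[ℝ] ℝ).smulRight V) 1 = V := fun V => by simp
  set e := extChartAt 𝓘(ℝ, RSpace n) o with he
  have hcont : ContinuousAt (fun t => γ t • o) 0 := by
    have h1 : ContinuousAt γ 0 := hγ.self_of_nhds.continuousAt
    exact ((contMDiff_orbit n G o).continuous.continuousAt (x := γ 0)).comp h1
  have hsrc : ∀ᶠ t in 𝓝 (0 : ℝ), γ t • o ∈ (chartAt (RSpace n) o).source := by
    refine hcont.eventually_mem ((chartAt (RSpace n) o).open_source.mem_nhds ?_)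
    simp [hγ0]
  have hder : ∀ᶠ t in 𝓝 (0 : ℝ), HasDerivAt (fun t => e (γ t • o)) 0 t := by
    filter_upwards [hγ, hsrc] with t ht hts
    have h1 := ((contMDiff_orbit n G o).mdifferentiable (by simp) (γ t)).hasMFDerivAt.comp t ht
    have h2 := (mdifferentiableAt_extChartAt (I := 𝓘(ℝ, RSpace n)) hts).hasMFDerivAt.comp t h1
    have h3 : HasFDerivAt (fun t => e (γ t • o)) ((dmap n e (γ t • o)).comp
        ((dmap n (fun w : G => w • o) (γ t)).comp ((1 : ℝ →L[ℝ] ℝ).smulRight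
          (mulInvariantVectorField (I := 𝓘(ℝ, RSpace n)) v (γ t) : RSpace n)))) t :=
      hasMFDerivAt_iff_hasFDerivAt.1 h2
    refine h3.hasDerivAt.congr_deriv ?_
    rw [ContinuousLinearMap.comp_apply, ContinuousLinearMap.comp_apply]
    erw [hsmul]
    rw [hzero, map_zero]
  obtain ⟨r, hr, hball⟩ := Metric.eventually_nhds_iff_ball.1 (hder.and hsrc)
  have hconst : ∀ t ∈ Metric.ball (0 : ℝ) r, γ t = 1 := by
    intro t ht
    have h1 : e (γ t • o) = e (γ 0 • o) :=
      Metric.isOpen_ball.is_const_of_deriv_eq_zero (convex_ball 0 r).isPreconnected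
        (fun s hs => (hball s hs).1.differentiableAt.differentiableWithinAt)
        (fun s hs => (hball s hs).1.deriv) ht (Metric.mem_ball_self hr)
    rw [hγ0, one_smul] at h1
    have h2 : γ t • o = (1 : G) • o := by
      rw [one_smul]
      refine e.injOn ?_ (mem_extChartAt_source o) h1
      rw [he, extChartAt_source]
      exact (hball t ht).2
    exact (hsimple o ((1 : G) • o)).unique h2 rfl
  have h1 : γ =ᶠ[𝓝 0] fun _ => (1 : G) := by
    filter_upwards [Metric.ball_mem_nhds (0 : ℝ) hr] with t ht using hconst t ht
  have h2 : HasMFDerivAt 𝓘(ℝ, ℝ) 𝓘(ℝ, RSpace n) γ 0 _ :=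
    (hasMFDerivAt_const (1 : G) (0 : ℝ)).congr_of_eventuallyEq h1
  -- The constant curve has zero velocity, so the field vanishes at γ(0) = 1, where its value is v.
  have h3 := hasMFDerivAt_unique hγ.self_of_nhds h2
  have h4 : (mulInvariantVectorField (I := 𝓘(ℝ, RSpace n)) v (γ 0) : RSpace n) = 0 := by
    have h5 : (1 : ℝ →L[ℝ] ℝ).smulRight
        (mulInvariantVectorField (I := 𝓘(ℝ, RSpace n)) v (γ 0) : RSpace n) = 0 := h3
    exact (hsmul _).symm.trans (congrArg (fun L : ℝ →L[ℝ] RSpace n => L 1) h5)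
  rw [hγ0] at h4
  have h6 : dmap n (fun w : G => 1 * w) 1 v = 0 := h4
  simpa only [one_mul, dmap_id, ContinuousLinearMap.id_apply] using h6

/-- The differentials of the orbit map are injective. -/
theorem dmap_orbit_injective (hsimple : SimplyTransitive G M) (o : M) (z : G) (v : RSpace n)
    (hv : dmap n (fun w : G => w • o) z v = 0) : v = 0 := by
  -- Left translations and motions have invertible differentials, which carry the kernel at z to the
  -- kernel at 1.
  have h1 : (dmap n (fun w : G => z * w) 1).comp (dmap n (fun w : G => z⁻¹ * w) z) =
      ContinuousLinearMap.id ℝ (RSpace n) := by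
    rw [← dmap_comp (mdifferentiable_leftMul z 1) (mdifferentiable_leftMul z⁻¹ z)
      (inv_mul_cancel z)]
    simp only [mul_inv_cancel_left, dmap_id]
  have h2 : (dmap n (fun x : M => z⁻¹ • x) (z • o)).comp (dmap n (fun x : M => z • x) o) =
      ContinuousLinearMap.id ℝ (RSpace n) := by
    rw [← dmap_comp (mdifferentiable_translation z⁻¹ (z • o)) (mdifferentiable_translation z o) rfl]
    simp only [inv_smul_smul, dmap_id]
  set u := dmap n (fun w : G => z⁻¹ * w) z v with hu
  have hvu : v = dmap n (fun w : G => z * w) 1 u :=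
    (congrArg (fun L : RSpace n →L[ℝ] RSpace n => L v) h1).symm
  have h3 := congrArg (fun L : RSpace n →L[ℝ] RSpace n => L u) (dmap_orbit_leftMul o z)
  simp only [ContinuousLinearMap.comp_apply, ← hvu, hv] at h3
  have h4 : dmap n (fun w : G => w • o) 1 u = 0 := by
    have := congrArg (fun L : RSpace n →L[ℝ] RSpace n => L (dmap n (fun w : G => w • o) 1 u)) h2
    simp only [ContinuousLinearMap.comp_apply, ← h3, map_zero] at this
    exact this.symm
  rw [hvu, dmap_orbit_one_injective hsimple o u h4, map_zero]

/-- The inverse of the orbit map is smooth. -/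
theorem contMDiff_psiInv (hsimple : SimplyTransitive G M) (o : M) :
    ContMDiff 𝓘(ℝ, RSpace n) 𝓘(ℝ, RSpace n) ∞ (psiInv G o : M → G) := by
  intro x
  obtain ⟨z, rfl, -⟩ := hsimple o x
  set c := chartAt (RSpace n) (z • o) with hc
  set e := chartAt (RSpace n) z with he
  set φ : RSpace n → RSpace n := fun u => c (e.symm u • o) with hφ
  have hsmooth : ContDiffAt ℝ ∞ φ (e z) := by
    have := (contMDiffAt_iff.1 (contMDiff_orbit n G o z)).2
    simpa [contDiffWithinAt_univ, φ, Function.comp_def] using this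
  have hfd : fderiv ℝ φ (e z) = dmap n (fun w : G => w • o) z :=
    (dmap_eq_fderiv_chart (mdifferentiable_orbit o z)).symm
  obtain ⟨L, hL⟩ := isInvertible_of_forall_eq_zero (dmap_orbit_injective (n := n) hsimple o z)
  have hder : HasFDerivAt φ (L : RSpace n →L[ℝ] RSpace n) (e z) := by
    rw [hL, ← hfd]
    exact (hsmooth.differentiableAt (by simp)).hasFDerivAt
  have hφz : φ (e z) = c (z • o) := by simp [φ, he]
  -- The inverse function theorem in charts yields a smooth local section of the orbit map; since z
  -- with z·o = x is unique, it coincides with the global inverse.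
  set Θ := hsmooth.localInverse hder (by simp) with hΘ
  have hΘs : ContDiffAt ℝ ∞ Θ (c (z • o)) := hφz ▸ hsmooth.to_localInverse hder (by simp)
  have hΘz : Θ (c (z • o)) = e z := hφz ▸ hsmooth.localInverse_apply_image hder (by simp)
  have hΘr : ∀ᶠ y in 𝓝 (c (z • o)), φ (Θ y) = y :=
    hφz ▸ (hsmooth.hasStrictFDerivAt' hder (by simp)).eventually_right_inverse
  have hcm : ContMDiffAt 𝓘(ℝ, RSpace n) 𝓘(ℝ, RSpace n) ∞ c (z • o) :=
    contMDiffAt_of_mem_maximalAtlas (IsManifold.chart_mem_maximalAtlas _) (mem_chart_source _ _)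
  have hem : ContMDiffAt 𝓘(ℝ, RSpace n) 𝓘(ℝ, RSpace n) ∞ e.symm (Θ (c (z • o))) := by
    rw [hΘz]
    exact contMDiffAt_symm_of_mem_maximalAtlas
      (IsManifold.chart_mem_maximalAtlas _) (mem_chart_target _ _)
  have hcomp : ContMDiffAt 𝓘(ℝ, RSpace n) 𝓘(ℝ, RSpace n) ∞ (fun x => e.symm (Θ (c x))) (z • o) :=
    hem.comp (z • o) (hΘs.contMDiffAt.comp (z • o) hcm)
  refine hcomp.congr_of_eventuallyEq ?_
  have hval : e.symm (Θ (c (z • o))) = z := by rw [hΘz, e.left_inv (mem_chart_source _ _)]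
  have hnear : ∀ᶠ x in 𝓝 (z • o), e.symm (Θ (c x)) • o ∈ c.source := by
    have h1 : ContinuousAt (fun x => e.symm (Θ (c x)) • o) (z • o) :=
      (contMDiff_orbit n G o).continuous.continuousAt.comp hcomp.continuousAt
    refine h1.eventually_mem (c.open_source.mem_nhds ?_)
    rw [hval]
    exact mem_chart_source _ _
  filter_upwards [hnear, c.open_source.mem_nhds (mem_chart_source _ _),
    hcm.continuousAt.eventually hΘr] with x hx1 hx2 hx3
  have h1 : e.symm (Θ (c x)) • o = x := c.injOn hx1 hx2 hx3
  conv_lhs => rw [← h1]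
  exact psiInv_smul hsimple o _

end Transitive

/-! ### The two frames in coordinates and the adjoint representation -/

section Operators

set_option linter.unusedSectionVars false

open Filter Topology

variable {n : ℕ}

/-- Symmetry of mixed second derivatives, the two variables being treated separately. -/
theorem fderiv_fderiv_swap {Φ : RSpace n × RSpace n → RSpace n} {p q : RSpace n}
    (hΦ : ContDiffAt ℝ ∞ Φ (p, q)) (a b : RSpace n) :
    fderiv ℝ (fun u => fderiv ℝ (fun u' => Φ (u, u')) q) p a b =
      fderiv ℝ (fun u' => fderiv ℝ (fun u => Φ (u, u')) p) q b a := by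
  have hdiff : ∀ᶠ y in 𝓝 (p, q), DifferentiableAt ℝ Φ y := by
    filter_upwards [(hΦ.of_le (m := 1) (by simp)).eventually (by norm_num)] with y hy
    exact hy.differentiableAt (by simp)
  have h2 : DifferentiableAt ℝ (fderiv ℝ Φ) (p, q) :=
    (hΦ.fderiv_right (m := ∞) (by simp)).differentiableAt (by simp)
  have hleft : HasFDerivAt (fun u : RSpace n => (u, q))
      (ContinuousLinearMap.inl ℝ (RSpace n) (RSpace n)) p := hasFDerivAt_prodMk_left p q
  have hright : HasFDerivAt (fun u : RSpace n => (p, u))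
      (ContinuousLinearMap.inr ℝ (RSpace n) (RSpace n)) q := hasFDerivAt_prodMk_right p q
  have h3 : (fun u => fderiv ℝ (fun u' => Φ (u, u')) q) =ᶠ[𝓝 p]
      fun u => (fderiv ℝ Φ (u, q)).comp (ContinuousLinearMap.inr ℝ (RSpace n) (RSpace n)) := by
    filter_upwards [hleft.continuousAt.eventually hdiff] with u hu
    exact (hu.hasFDerivAt.comp q (hasFDerivAt_prodMk_right u q)).fderiv
  have h4 : (fun u' => fderiv ℝ (fun u => Φ (u, u')) p) =ᶠ[𝓝 q]
      fun u' => (fderiv ℝ Φ (p, u')).comp (ContinuousLinearMap.inl ℝ (RSpace n) (RSpace n)) := by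
    filter_upwards [hright.continuousAt.eventually hdiff] with u hu
    exact (hu.hasFDerivAt.comp p (hasFDerivAt_prodMk_left p u)).fderiv
  have h5 := ((h2.hasFDerivAt.comp p hleft).clm_comp (hasFDerivAt_const
    (ContinuousLinearMap.inr ℝ (RSpace n) (RSpace n)) p)).fderiv
  have h6 := ((h2.hasFDerivAt.comp q hright).clm_comp (hasFDerivAt_const
    (ContinuousLinearMap.inl ℝ (RSpace n) (RSpace n)) q)).fderiv
  have hsymm := (hΦ.isSymmSndFDerivAt (by simpa using ENat.LEInfty.out)).eq (a, 0) (0, b)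
  rw [h3.fderiv_eq, h4.fderiv_eq]
  simp only [Function.comp_def] at h5 h6
  rw [h5, h6]
  simpa using hsymm

variable {G M : Type*} [TopologicalSpace G] [ChartedSpace (RSpace n) G] [Group G]
  [TopologicalSpace M] [ChartedSpace (RSpace n) M] [MulAction G M]

variable (G) in
/-- The matrix of components of the Killing fields, in the local coordinates `c`. -/
def killingOp (c : OpenPartialHomeomorph M (RSpace n)) (x : RSpace n) : RSpace n →L[ℝ] RSpace n :=
  dmap n (fun w : G => c (w • c.symm x)) 1

variable (G) in
/-- The matrix of components of the invariant fields, in the local coordinates `c`. -/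
def invariantOp (c : OpenPartialHomeomorph M (RSpace n)) (o : M) (x : RSpace n) :
    RSpace n →L[ℝ] RSpace n :=
  dmap n (fun w : G => c ((psiInv G o (c.symm x) * w) • o)) 1

variable (n G) in
/-- The parametrization of a neighbourhood of the identity by the preferred chart. -/
def expChart : RSpace n → G := (chartAt (RSpace n) (1 : G)).symm

variable (n G) in
/-- The coordinates of the identity in the preferred chart. -/
def oneCoord : RSpace n := chartAt (RSpace n) (1 : G) 1

theorem expChart_oneCoord : expChart n G (oneCoord n G) = 1 :=
  (chartAt (RSpace n) (1 : G)).left_inv (mem_chart_source _ _)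

theorem AdRep_eq_dmap (z : G) : AdRep z = dmap n (fun w : G => z * w * z⁻¹) 1 := rfl

theorem dmap_one_eq_fderiv {f : G → RSpace n}
    (hf : MDifferentiableAt 𝓘(ℝ, RSpace n) 𝓘(ℝ, RSpace n) f 1) :
    dmap n f 1 = fderiv ℝ (fun u => f (expChart n G u)) (oneCoord n G) := by
  rw [dmap_eq_fderiv_chart hf]
  rfl

section Lie

variable [LieGroup 𝓘(ℝ, RSpace n) ∞ G]

theorem contMDiffAt_expChart :
    ContMDiffAt 𝓘(ℝ, RSpace n) 𝓘(ℝ, RSpace n) ∞ (expChart n G) (oneCoord n G) :=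
  contMDiffAt_symm_of_mem_maximalAtlas (IsManifold.chart_mem_maximalAtlas _)
    (mem_chart_target _ _)

theorem mdifferentiable_conj (z : G) :
    MDifferentiable 𝓘(ℝ, RSpace n) 𝓘(ℝ, RSpace n) fun w : G => z * w * z⁻¹ := by
  have h : ContMDiff 𝓘(ℝ, RSpace n) 𝓘(ℝ, RSpace n) ∞ fun w : G => z * w * z⁻¹ :=
    (contMDiff_const.mul contMDiff_id).mul contMDiff_const
  exact h.mdifferentiable (by simp)

theorem AdRep_mul (z w : G) : (AdRep (n := n) (z * w)) = (AdRep z).comp (AdRep w) := by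
  rw [AdRep_eq_dmap, AdRep_eq_dmap, AdRep_eq_dmap, ← dmap_comp (mdifferentiable_conj z 1)
    (mdifferentiable_conj w 1) (by simp)]
  simp only [mul_inv_rev, mul_assoc]

theorem AdRep_one : AdRep (n := n) (1 : G) = ContinuousLinearMap.id ℝ (RSpace n) := by
  rw [AdRep_eq_dmap]
  simp only [one_mul, inv_one, mul_one, dmap_id]

theorem AdRep_comp_inv (z : G) :
    (AdRep (n := n) z).comp (AdRep z⁻¹) = ContinuousLinearMap.id ℝ (RSpace n) := by
  rw [← AdRep_mul, mul_inv_cancel, AdRep_one]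

theorem AdRep_inv_comp (z : G) :
    (AdRep (n := n) z⁻¹).comp (AdRep z) = ContinuousLinearMap.id ℝ (RSpace n) := by
  rw [← AdRep_mul, inv_mul_cancel, AdRep_one]

end Lie

variable [LieGroup 𝓘(ℝ, RSpace n) ∞ G] [IsManifold 𝓘(ℝ, RSpace n) ∞ M]
  [ContMDiffSMul 𝓘(ℝ, RSpace n) 𝓘(ℝ, RSpace n) ∞ G M]
  {c : OpenPartialHomeomorph M (RSpace n)}

/-- The action near the identity, in coordinates. -/
theorem contDiffAt_coord_smul (hc : c ∈ IsManifold.maximalAtlas 𝓘(ℝ, RSpace n) ∞ M)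
    {x : RSpace n} (hx : x ∈ c.target) :
    ContDiffAt ℝ ∞ (fun y : RSpace n × RSpace n => c (expChart n G y.2 • c.symm y.1))
      (x, oneCoord n G) := by
  rw [← contMDiffAt_iff_contDiffAt]
  have h1 : ContMDiffAt 𝓘(ℝ, RSpace n × RSpace n) 𝓘(ℝ, RSpace n) ∞
      (fun y : RSpace n × RSpace n => c.symm y.1) (x, oneCoord n G) :=
    (contMDiffAt_symm_of_mem_maximalAtlas hc hx).comp (x, oneCoord n G)
      contDiffAt_fst.contMDiffAt
  have h2 : ContMDiffAt 𝓘(ℝ, RSpace n × RSpace n) 𝓘(ℝ, RSpace n) ∞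
      (fun y : RSpace n × RSpace n => expChart n G y.2) (x, oneCoord n G) :=
    contMDiffAt_expChart.comp (x, oneCoord n G) contDiffAt_snd.contMDiffAt
  have h3 : ContMDiffAt 𝓘(ℝ, RSpace n) 𝓘(ℝ, RSpace n) ∞ c
      (expChart n G (oneCoord n G) • c.symm x) := by
    rw [expChart_oneCoord, one_smul]
    exact contMDiffAt_of_mem_maximalAtlas hc (c.map_target hx)
  exact h3.comp (x, oneCoord n G) (h2.smul h1)

theorem contDiffAt_coord_mul_smul (hsimple : SimplyTransitive G M)
    (hc : c ∈ IsManifold.maximalAtlas 𝓘(ℝ, RSpace n) ∞ M) (o : M)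
    {x : RSpace n} (hx : x ∈ c.target) :
    ContDiffAt ℝ ∞ (fun y : RSpace n × RSpace n =>
      c ((psiInv G o (c.symm y.1) * expChart n G y.2) • o)) (x, oneCoord n G) := by
  rw [← contMDiffAt_iff_contDiffAt]
  have h1 : ContMDiffAt 𝓘(ℝ, RSpace n × RSpace n) 𝓘(ℝ, RSpace n) ∞
      (fun y : RSpace n × RSpace n => psiInv G o (c.symm y.1)) (x, oneCoord n G) :=
    (contMDiff_psiInv hsimple o).contMDiffAt.comp (x, oneCoord n G)
      ((contMDiffAt_symm_of_mem_maximalAtlas hc hx).comp (x, oneCoord n G)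
      contDiffAt_fst.contMDiffAt)
  have h2 : ContMDiffAt 𝓘(ℝ, RSpace n × RSpace n) 𝓘(ℝ, RSpace n) ∞
      (fun y : RSpace n × RSpace n => expChart n G y.2) (x, oneCoord n G) :=
    contMDiffAt_expChart.comp (x, oneCoord n G) contDiffAt_snd.contMDiffAt
  have h3 : ContMDiffAt 𝓘(ℝ, RSpace n) 𝓘(ℝ, RSpace n) ∞ c
      ((psiInv G o (c.symm x) * expChart n G (oneCoord n G)) • o) := by
    rw [expChart_oneCoord, mul_one, smul_psiInv hsimple]
    exact contMDiffAt_of_mem_maximalAtlas hc (c.map_target hx)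
  exact h3.comp (x, oneCoord n G) ((h1.mul h2).smul contMDiffAt_const)

/-- The two commuting motions of a point, by the left and by the right translations. -/
theorem contDiffAt_coord_mul_mul_smul (hsimple : SimplyTransitive G M)
    (hc : c ∈ IsManifold.maximalAtlas 𝓘(ℝ, RSpace n) ∞ M) (o : M)
    {x : RSpace n} (hx : x ∈ c.target) :
    ContDiffAt ℝ ∞ (fun y : RSpace n × RSpace n =>
      c ((expChart n G y.1 * psiInv G o (c.symm x) * expChart n G y.2) • o))
      (oneCoord n G, oneCoord n G) := by
  rw [← contMDiffAt_iff_contDiffAt]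
  have h1 : ContMDiffAt 𝓘(ℝ, RSpace n × RSpace n) 𝓘(ℝ, RSpace n) ∞
      (fun y : RSpace n × RSpace n => expChart n G y.1) (oneCoord n G, oneCoord n G) :=
    contMDiffAt_expChart.comp (oneCoord n G, oneCoord n G) contDiffAt_fst.contMDiffAt
  have h2 : ContMDiffAt 𝓘(ℝ, RSpace n × RSpace n) 𝓘(ℝ, RSpace n) ∞
      (fun y : RSpace n × RSpace n => expChart n G y.2) (oneCoord n G, oneCoord n G) :=
    contMDiffAt_expChart.comp (oneCoord n G, oneCoord n G) contDiffAt_snd.contMDiffAt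
  have h3 : ContMDiffAt 𝓘(ℝ, RSpace n) 𝓘(ℝ, RSpace n) ∞ c
      ((expChart n G (oneCoord n G) * psiInv G o (c.symm x) *
        expChart n G (oneCoord n G)) • o) := by
    rw [expChart_oneCoord, mul_one, one_mul, smul_psiInv hsimple]
    exact contMDiffAt_of_mem_maximalAtlas hc (c.map_target hx)
  exact h3.comp (oneCoord n G, oneCoord n G)
    (((h1.mul contMDiffAt_const).mul h2).smul contMDiffAt_const)

theorem mdifferentiableAt_coord (hc : c ∈ IsManifold.maximalAtlas 𝓘(ℝ, RSpace n) ∞ M)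
    {x : M} (hx : x ∈ c.source) : MDifferentiableAt 𝓘(ℝ, RSpace n) 𝓘(ℝ, RSpace n) c x :=
  (contMDiffAt_of_mem_maximalAtlas hc hx).mdifferentiableAt (by simp)

theorem mdifferentiableAt_coord_symm (hc : c ∈ IsManifold.maximalAtlas 𝓘(ℝ, RSpace n) ∞ M)
    {x : RSpace n} (hx : x ∈ c.target) :
    MDifferentiableAt 𝓘(ℝ, RSpace n) 𝓘(ℝ, RSpace n) c.symm x :=
  (contMDiffAt_symm_of_mem_maximalAtlas hc hx).mdifferentiableAt (by simp)

theorem dmap_coord_symm_comp (hc : c ∈ IsManifold.maximalAtlas 𝓘(ℝ, RSpace n) ∞ M)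
    {x : RSpace n} (hx : x ∈ c.target) :
    (dmap n c.symm x).comp (dmap n c (c.symm x)) = ContinuousLinearMap.id ℝ (RSpace n) := by
  rw [← dmap_comp (mdifferentiableAt_coord_symm hc hx)
    (mdifferentiableAt_coord hc (c.map_target hx)) (c.right_inv hx), ← dmap_id (c.symm x)]
  exact dmap_congr (c.eventually_left_inverse (c.map_target hx))

theorem mdifferentiableAt_coord_smul (hc : c ∈ IsManifold.maximalAtlas 𝓘(ℝ, RSpace n) ∞ M)
    {x : RSpace n} (hx : x ∈ c.target) :
    MDifferentiableAt 𝓘(ℝ, RSpace n) 𝓘(ℝ, RSpace n) (fun w : G => c (w • c.symm x)) 1 := by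
  have h1 : MDifferentiableAt 𝓘(ℝ, RSpace n) 𝓘(ℝ, RSpace n) c ((1 : G) • c.symm x) := by
    rw [one_smul]
    exact mdifferentiableAt_coord hc (c.map_target hx)
  exact h1.comp (1 : G) (mdifferentiable_orbit (c.symm x) 1)

theorem mdifferentiableAt_coord_mul_smul (hsimple : SimplyTransitive G M)
    (hc : c ∈ IsManifold.maximalAtlas 𝓘(ℝ, RSpace n) ∞ M) (o : M)
    {x : RSpace n} (hx : x ∈ c.target) :
    MDifferentiableAt 𝓘(ℝ, RSpace n) 𝓘(ℝ, RSpace n)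
      (fun w : G => c ((psiInv G o (c.symm x) * w) • o)) 1 := by
  have h1 : MDifferentiableAt 𝓘(ℝ, RSpace n) 𝓘(ℝ, RSpace n) c
      ((psiInv G o (c.symm x) * 1) • o) := by
    rw [mul_one, smul_psiInv hsimple]
    exact mdifferentiableAt_coord hc (c.map_target hx)
  exact h1.comp (1 : G) ((mdifferentiable_orbit o _).comp (1 : G)
    (mdifferentiable_leftMul (psiInv G o (c.symm x)) 1))

theorem killingOp_eq_fderiv (hc : c ∈ IsManifold.maximalAtlas 𝓘(ℝ, RSpace n) ∞ M)
    {x : RSpace n} (hx : x ∈ c.target) :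
    killingOp G c x = fderiv ℝ (fun u => c (expChart n G u • c.symm x)) (oneCoord n G) :=
  dmap_one_eq_fderiv (mdifferentiableAt_coord_smul hc hx)

theorem invariantOp_eq_fderiv (hsimple : SimplyTransitive G M)
    (hc : c ∈ IsManifold.maximalAtlas 𝓘(ℝ, RSpace n) ∞ M) (o : M)
    {x : RSpace n} (hx : x ∈ c.target) :
    invariantOp G c o x =
      fderiv ℝ (fun u => c ((psiInv G o (c.symm x) * expChart n G u) • o)) (oneCoord n G) :=
  dmap_one_eq_fderiv (mdifferentiableAt_coord_mul_smul hsimple hc o hx)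

theorem contDiffAt_killingOp (hc : c ∈ IsManifold.maximalAtlas 𝓘(ℝ, RSpace n) ∞ M)
    {x : RSpace n} (hx : x ∈ c.target) : ContDiffAt ℝ ∞ (killingOp G c) x := by
  have h1 : ContDiffAt ℝ ∞ (fun x => fderiv ℝ (fun u => c (expChart n G u • c.symm x))
      (oneCoord n G)) x :=
    ContDiffAt.fderiv (f := fun x u => c (expChart n G u • c.symm x)) (n := ∞)
      (contDiffAt_coord_smul hc hx) contDiffAt_const (by simp)
  refine h1.congr_of_eventuallyEq ?_
  filter_upwards [c.open_target.mem_nhds hx] with y hy using killingOp_eq_fderiv hc hy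

theorem contDiffAt_invariantOp (hsimple : SimplyTransitive G M)
    (hc : c ∈ IsManifold.maximalAtlas 𝓘(ℝ, RSpace n) ∞ M) (o : M)
    {x : RSpace n} (hx : x ∈ c.target) : ContDiffAt ℝ ∞ (invariantOp G c o) x := by
  have h1 : ContDiffAt ℝ ∞ (fun x => fderiv ℝ (fun u =>
      c ((psiInv G o (c.symm x) * expChart n G u) • o)) (oneCoord n G)) x :=
    ContDiffAt.fderiv (f := fun x u => c ((psiInv G o (c.symm x) * expChart n G u) • o)) (n := ∞)
      (contDiffAt_coord_mul_smul hsimple hc o hx) contDiffAt_const (by simp)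
  refine h1.congr_of_eventuallyEq ?_
  filter_upwards [c.open_target.mem_nhds hx] with y hy using invariantOp_eq_fderiv hsimple hc o hy

/-- The two frames are related by the adjoint representation. -/
theorem invariantOp_comp_AdRep (hsimple : SimplyTransitive G M)
    (hc : c ∈ IsManifold.maximalAtlas 𝓘(ℝ, RSpace n) ∞ M) (o : M)
    {x : RSpace n} (hx : x ∈ c.target) :
    (invariantOp G c o x).comp (AdRep (psiInv G o (c.symm x))⁻¹) = killingOp G c x := by
  rw [invariantOp, killingOp, AdRep_eq_dmap,
    ← dmap_comp (mdifferentiableAt_coord_mul_smul hsimple hc o hx) (mdifferentiable_conj _ 1)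
      (by simp)]
  congr 1
  -- With z·o = c⁻¹(x): z(z⁻¹wz)·o = w·(z·o).
  funext w
  rw [inv_inv, mul_assoc, mul_inv_cancel_left, mul_smul, smul_psiInv hsimple]

theorem isInvertible_killingOp (hsimple : SimplyTransitive G M)
    (hc : c ∈ IsManifold.maximalAtlas 𝓘(ℝ, RSpace n) ∞ M)
    {x : RSpace n} (hx : x ∈ c.target) : (killingOp G c x).IsInvertible := by
  refine isInvertible_of_forall_eq_zero fun v hv => ?_
  refine dmap_orbit_injective (n := n) hsimple (c.symm x) (1 : G) v ?_
  rw [killingOp, dmap_comp (mdifferentiableAt_coord hc (c.map_target hx))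
    (mdifferentiable_orbit (c.symm x) 1) (one_smul G _)] at hv
  have h := congrArg (fun L : RSpace n →L[ℝ] RSpace n =>
    L (dmap n (fun w : G => w • c.symm x) 1 v)) (dmap_coord_symm_comp hc hx)
  rw [ContinuousLinearMap.comp_apply] at hv
  simpa only [ContinuousLinearMap.comp_apply, hv, map_zero, ContinuousLinearMap.id_apply]
    using h.symm

theorem invariantOp_eq (hsimple : SimplyTransitive G M)
    (hc : c ∈ IsManifold.maximalAtlas 𝓘(ℝ, RSpace n) ∞ M) (o : M)
    {x : RSpace n} (hx : x ∈ c.target) :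
    invariantOp G c o x = (killingOp G c x).comp (AdRep (psiInv G o (c.symm x))) := by
  rw [← invariantOp_comp_AdRep hsimple hc o hx, ContinuousLinearMap.comp_assoc, AdRep_inv_comp,
    ContinuousLinearMap.comp_id]

theorem isInvertible_invariantOp (hsimple : SimplyTransitive G M)
    (hc : c ∈ IsManifold.maximalAtlas 𝓘(ℝ, RSpace n) ∞ M) (o : M)
    {x : RSpace n} (hx : x ∈ c.target) : (invariantOp G c o x).IsInvertible := by
  refine isInvertible_of_forall_eq_zero fun v hv => ?_
  obtain ⟨e, he⟩ := isInvertible_killingOp (G := G) hsimple hc hx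
  rw [invariantOp_eq hsimple hc o hx, ContinuousLinearMap.comp_apply, ← he] at hv
  have hv' : AdRep (psiInv G o (c.symm x)) v = 0 := e.injective (by simpa using hv)
  have h := congrArg (fun L : RSpace n →L[ℝ] RSpace n => L v)
    (AdRep_inv_comp (n := n) (psiInv G o (c.symm x)))
  simpa only [ContinuousLinearMap.comp_apply, hv', map_zero, ContinuousLinearMap.id_apply]
    using h.symm

/-- This identifies composition of a covector with the transition matrix as the coadjoint action, so
the curves of the ansatz stay in coadjoint orbits. -/
theorem transition_eq_AdRep (hsimple : SimplyTransitive G M)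
    (hc : c ∈ IsManifold.maximalAtlas 𝓘(ℝ, RSpace n) ∞ M) (o : M)
    {x : RSpace n} (hx : x ∈ c.target) :
    transition (invariantOp G c o) (killingOp G c) x = AdRep (psiInv G o (c.symm x))⁻¹ := by
  rw [transition, ← invariantOp_comp_AdRep hsimple hc o hx, ← ContinuousLinearMap.comp_assoc]
  obtain ⟨e, he⟩ := isInvertible_invariantOp (G := G) hsimple hc o hx
  rw [← he]
  ext v
  simp

end Operators

/-! ### Bracket relations, the rank of the coadjoint form, and the Plücker relation -/

section Algebra

set_option linter.unusedSectionVars false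

open Filter Topology

variable {n : ℕ}

/-- A relation between three of the rows of an alternating form gives the Plücker relation. -/
theorem plucker_of_relation {X : Type*} {W : X → X → ℝ} (hanti : ∀ a b, W a b = -W b a)
    {a b c : X} (d : X) {s : Fin 3 → ℝ} {i : Fin 3} (hi : s i ≠ 0)
    (heval : ∀ e, s 0 * W a e + s 1 * W b e + s 2 * W c e = 0) :
    W a b * W c d - W a c * W b d + W a d * W b c = 0 := by
  have haa : ∀ e, W e e = 0 := fun e => by linarith [hanti e e]
  have ha := heval a
  have hb := heval b
  have hc := heval c
  have hd := heval d
  rw [haa, hanti b a, hanti c a] at ha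
  rw [haa, hanti c b] at hb
  rw [haa] at hc
  -- The left side of the Plücker relation is a Pfaffian; for each i, its product with s i is a
  -- combination of the relation evaluated at the four vectors.
  have key : s i * (W a b * W c d - W a c * W b d + W a d * W b c) = 0 := by
    fin_cases i
    · change s 0 * _ = 0
      linear_combination W c d * hb - W b d * hc + W b c * hd
    · change s 1 * _ = 0
      linear_combination -W c d * ha + W a d * hc - W a c * hd
    · change s 2 * _ = 0
      linear_combination W b d * ha - W a d * hb + W a b * hd
  exact (mul_eq_zero.1 key).resolve_left hi

/-- An alternating form of rank at most two satisfies the Plücker relation. -/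
theorem plucker_of_finrank_range_le_two (L : RSpace n →L[ℝ] (RSpace n →L[ℝ] ℝ))
    (hanti : ∀ a b, L a b = -L b a) (hL : Module.finrank ℝ L.range ≤ 2) (a b c d : RSpace n) :
    L a b * L c d - L a c * L b d + L a d * L b c = 0 := by
  -- Three rows lie in a space of dimension at most two.
  have hdep : ¬ LinearIndependent ℝ ![L a, L b, L c] := fun h => by
    have h1 := finrank_span_eq_card h
    have h2 : Submodule.span ℝ (Set.range ![L a, L b, L c]) ≤ L.range := by
      rw [Submodule.span_le]
      rintro _ ⟨i, rfl⟩
      fin_cases i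
      exacts [⟨a, rfl⟩, ⟨b, rfl⟩, ⟨c, rfl⟩]
    have h3 := Submodule.finrank_mono h2
    rw [h1, Fintype.card_fin] at h3
    omega
  obtain ⟨s, hs, i, hi⟩ := Fintype.not_linearIndependent_iff.1 hdep
  refine plucker_of_relation (W := fun a b => L a b) hanti d hi fun e => ?_
  have := congrArg (fun l : RSpace n →L[ℝ] ℝ => l e) hs
  simpa [Fin.sum_univ_three] using this

variable {G M : Type*} [TopologicalSpace G] [ChartedSpace (RSpace n) G] [Group G]
  [TopologicalSpace M] [ChartedSpace (RSpace n) M] [MulAction G M]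

variable (n G) in
/-- The differential at the identity of `z ↦ Ad_{z⁻¹}`. -/
def adDeriv : RSpace n →L[ℝ] RSpace n →L[ℝ] RSpace n :=
  fderiv ℝ (fun u => AdRep (expChart n G u)⁻¹) (oneCoord n G)

variable [LieGroup 𝓘(ℝ, RSpace n) ∞ G] [IsManifold 𝓘(ℝ, RSpace n) ∞ M]
  [ContMDiffSMul 𝓘(ℝ, RSpace n) 𝓘(ℝ, RSpace n) ∞ G M]
  {c : OpenPartialHomeomorph M (RSpace n)}

theorem eventually_smul_mem_source {x : RSpace n} (hx : x ∈ c.target) :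
    ∀ᶠ w in 𝓝 (1 : G), w • c.symm x ∈ c.source := by
  have h : ContinuousAt (fun w : G => w • c.symm x) 1 :=
    (contMDiff_orbit n G (c.symm x)).continuous.continuousAt
  exact h.eventually_mem (c.open_source.mem_nhds (by simpa using c.map_target hx))

theorem eventually_mul_smul_mem_source (hsimple : SimplyTransitive G M) (o : M)
    {x : RSpace n} (hx : x ∈ c.target) :
    ∀ᶠ w in 𝓝 (1 : G), (psiInv G o (c.symm x) * w) • o ∈ c.source := by
  have h : ContinuousAt (fun w : G => (psiInv G o (c.symm x) * w) • o) 1 :=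
    ((contMDiff_orbit n G o).continuous.comp
      (contMDiff_mul_left (I := 𝓘(ℝ, RSpace n)) (n := ∞)).continuous).continuousAt
  exact h.eventually_mem (c.open_source.mem_nhds
    (by simpa [smul_psiInv hsimple] using c.map_target hx))

theorem tendsto_expChart : Tendsto (expChart n G) (𝓝 (oneCoord n G)) (𝓝 1) := by
  have := (contMDiffAt_expChart (n := n) (G := G)).continuousAt
  rwa [ContinuousAt, expChart_oneCoord] at this

theorem hasFDerivAt_coord_smul (hc : c ∈ IsManifold.maximalAtlas 𝓘(ℝ, RSpace n) ∞ M)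
    {x : RSpace n} (hx : x ∈ c.target) :
    HasFDerivAt (fun u => c (expChart n G u • c.symm x)) (killingOp G c x) (oneCoord n G) := by
  rw [killingOp_eq_fderiv hc hx]
  have h : ContDiffAt ℝ ∞ (fun u => c (expChart n G u • c.symm x)) (oneCoord n G) :=
    (contDiffAt_coord_smul hc hx).comp (oneCoord n G) (contDiffAt_const.prodMk contDiffAt_id)
  exact (h.differentiableAt (by simp)).hasFDerivAt

theorem coord_smul_oneCoord {x : RSpace n} (hx : x ∈ c.target) :
    c (expChart n G (oneCoord n G) • c.symm x) = x := by
  rw [expChart_oneCoord, one_smul, c.right_inv hx]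

theorem hasFDerivAt_coord_mul_smul (hsimple : SimplyTransitive G M)
    (hc : c ∈ IsManifold.maximalAtlas 𝓘(ℝ, RSpace n) ∞ M) (o : M)
    {x : RSpace n} (hx : x ∈ c.target) :
    HasFDerivAt (fun u => c ((psiInv G o (c.symm x) * expChart n G u) • o))
      (invariantOp G c o x) (oneCoord n G) := by
  rw [invariantOp_eq_fderiv hsimple hc o hx]
  have h : ContDiffAt ℝ ∞ (fun u => c ((psiInv G o (c.symm x) * expChart n G u) • o))
      (oneCoord n G) :=
    (contDiffAt_coord_mul_smul hsimple hc o hx).comp (oneCoord n G)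
      (contDiffAt_const.prodMk contDiffAt_id)
  exact (h.differentiableAt (by simp)).hasFDerivAt

theorem coord_mul_smul_oneCoord (hsimple : SimplyTransitive G M) (o : M)
    {x : RSpace n} (hx : x ∈ c.target) :
    c ((psiInv G o (c.symm x) * expChart n G (oneCoord n G)) • o) = x := by
  rw [expChart_oneCoord, mul_one, smul_psiInv hsimple, c.right_inv hx]

/-- The Killing fields and the invariant fields commute. -/
theorem fderiv_invariantOp_killingOp (hsimple : SimplyTransitive G M)
    (hc : c ∈ IsManifold.maximalAtlas 𝓘(ℝ, RSpace n) ∞ M) (o : M)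
    {x : RSpace n} (hx : x ∈ c.target) (a b : RSpace n) :
    fderiv ℝ (invariantOp G c o) x (killingOp G c x a) b =
      fderiv ℝ (killingOp G c) x (invariantOp G c o x b) a := by
  -- Moving a point by u on the left and by u' on the right gives one function of (u, u'); the two
  -- orders of its mixed derivative are the two sides.
  have key := fderiv_fderiv_swap (contDiffAt_coord_mul_mul_smul hsimple hc o hx) a b
  have h1 : (fun u => fderiv ℝ (fun u' =>
      c ((expChart n G u * psiInv G o (c.symm x) * expChart n G u') • o)) (oneCoord n G))
      =ᶠ[𝓝 (oneCoord n G)]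
      fun u => invariantOp G c o (c (expChart n G u • c.symm x)) := by
    filter_upwards [tendsto_expChart.eventually (eventually_smul_mem_source (G := G) hx)] with u hu
    rw [invariantOp_eq_fderiv hsimple hc o (c.map_source hu), c.left_inv hu]
    congr 1
    funext u'
    congr 3
    conv_rhs => rw [← smul_psiInv (G := G) hsimple o (c.symm x), ← mul_smul, psiInv_smul hsimple]
  have h2 : (fun u' => fderiv ℝ (fun u =>
      c ((expChart n G u * psiInv G o (c.symm x) * expChart n G u') • o)) (oneCoord n G))
      =ᶠ[𝓝 (oneCoord n G)]
      fun u' => killingOp G c (c ((psiInv G o (c.symm x) * expChart n G u') • o)) := by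
    filter_upwards [tendsto_expChart.eventually
      (eventually_mul_smul_mem_source hsimple o hx)] with u hu
    rw [killingOp_eq_fderiv hc (c.map_source hu), c.left_inv hu]
    congr 1
    funext u'
    rw [← mul_smul, mul_assoc]
  have hd1 : HasFDerivAt (invariantOp G c o) (fderiv ℝ (invariantOp G c o) x)
      (c (expChart n G (oneCoord n G) • c.symm x)) := by
    rw [coord_smul_oneCoord hx]
    exact ((contDiffAt_invariantOp hsimple hc o hx).differentiableAt (by simp)).hasFDerivAt
  have hd2 : HasFDerivAt (killingOp G c) (fderiv ℝ (killingOp G c) x)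
      (c ((psiInv G o (c.symm x) * expChart n G (oneCoord n G)) • o)) := by
    rw [coord_mul_smul_oneCoord hsimple o hx]
    exact ((contDiffAt_killingOp hc hx).differentiableAt (by simp)).hasFDerivAt
  have h3 := (hd1.comp (oneCoord n G) (hasFDerivAt_coord_smul hc hx)).fderiv
  have h4 := (hd2.comp (oneCoord n G) (hasFDerivAt_coord_mul_smul hsimple hc o hx)).fderiv
  simp only [Function.comp_def] at h3 h4
  rw [h1.fderiv_eq, h2.fderiv_eq, h3, h4] at key
  exact key

theorem contDiffAt_transition (hsimple : SimplyTransitive G M)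
    (hc : c ∈ IsManifold.maximalAtlas 𝓘(ℝ, RSpace n) ∞ M) (o : M)
    {x : RSpace n} (hx : x ∈ c.target) :
    ContDiffAt ℝ ∞ (transition (invariantOp G c o) (killingOp G c)) x :=
  (((isInvertible_invariantOp hsimple hc o hx).contDiffAt_map_inverse).comp x
    (contDiffAt_invariantOp hsimple hc o hx)).clm_comp (contDiffAt_killingOp hc hx)

/-- The transition matrix along the orbit of a point. -/
theorem transition_smul (hsimple : SimplyTransitive G M)
    (hc : c ∈ IsManifold.maximalAtlas 𝓘(ℝ, RSpace n) ∞ M) (o : M)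
    {x : RSpace n} (hx : x ∈ c.target) {w : G} (hw : w • c.symm x ∈ c.source) :
    transition (invariantOp G c o) (killingOp G c) (c (w • c.symm x)) =
      (transition (invariantOp G c o) (killingOp G c) x).comp (AdRep w⁻¹) := by
  rw [transition_eq_AdRep hsimple hc o (c.map_source hw), transition_eq_AdRep hsimple hc o hx,
    c.left_inv hw, ← AdRep_mul]
  congr 1
  conv_lhs => rw [← smul_psiInv (G := G) hsimple o (c.symm x), ← mul_smul, psiInv_smul hsimple]
  exact mul_inv_rev _ _

/-- Differentiability of w ↦ Ad(w⁻¹) at 1 is drawn from the frames: Ad is recovered from the smooth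
transition matrix along the orbit of x. -/
theorem AdRep_inv_eventuallyEq (hsimple : SimplyTransitive G M)
    (hc : c ∈ IsManifold.maximalAtlas 𝓘(ℝ, RSpace n) ∞ M) (o : M)
    {x : RSpace n} (hx : x ∈ c.target) :
    (fun w : G => AdRep (n := n) w⁻¹) =ᶠ[𝓝 1] fun w => (AdRep (psiInv G o (c.symm x))).comp
      (transition (invariantOp G c o) (killingOp G c) (c (w • c.symm x))) := by
  filter_upwards [eventually_smul_mem_source (G := G) hx] with w hw
  rw [transition_smul hsimple hc o hx hw, transition_eq_AdRep hsimple hc o hx,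
    ← ContinuousLinearMap.comp_assoc, AdRep_comp_inv, ContinuousLinearMap.id_comp]

theorem mdifferentiableAt_AdRep_inv (hsimple : SimplyTransitive G M)
    (hc : c ∈ IsManifold.maximalAtlas 𝓘(ℝ, RSpace n) ∞ M)
    {x : RSpace n} (hx : x ∈ c.target) :
    MDifferentiableAt 𝓘(ℝ, RSpace n) 𝓘(ℝ, RSpace n →L[ℝ] RSpace n)
      (fun w : G => AdRep (n := n) w⁻¹) 1 := by
  set o := c.symm x
  have h1 : DifferentiableAt ℝ (fun y => (AdRep (psiInv G o (c.symm x))).comp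
      (transition (invariantOp G c o) (killingOp G c) y)) (c ((1 : G) • c.symm x)) := by
    rw [one_smul, c.right_inv hx]
    exact (differentiableAt_const _).clm_comp
      ((contDiffAt_transition hsimple hc o hx).differentiableAt (by simp))
  have h2 : MDifferentiableAt 𝓘(ℝ, RSpace n) 𝓘(ℝ, RSpace n →L[ℝ] RSpace n)
      (fun w : G => (AdRep (psiInv G o (c.symm x))).comp
        (transition (invariantOp G c o) (killingOp G c) (c (w • c.symm x)))) 1 :=
    h1.mdifferentiableAt.comp (1 : G) (mdifferentiableAt_coord_smul hc hx)
  exact h2.congr_of_eventuallyEq (AdRep_inv_eventuallyEq hsimple hc o hx)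

theorem hasFDerivAt_AdRep_inv (hsimple : SimplyTransitive G M)
    (hc : c ∈ IsManifold.maximalAtlas 𝓘(ℝ, RSpace n) ∞ M)
    {x : RSpace n} (hx : x ∈ c.target) :
    HasFDerivAt (fun u => AdRep (n := n) (expChart n G u)⁻¹) (adDeriv n G) (oneCoord n G) := by
  have h1 : MDifferentiableAt 𝓘(ℝ, RSpace n) 𝓘(ℝ, RSpace n →L[ℝ] RSpace n)
      (fun w : G => AdRep (n := n) w⁻¹) (expChart n G (oneCoord n G)) := by
    rw [expChart_oneCoord]
    exact mdifferentiableAt_AdRep_inv hsimple hc hx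
  have h2 := h1.comp (oneCoord n G) (contMDiffAt_expChart.mdifferentiableAt (by simp))
  exact h2.differentiableAt.hasFDerivAt

theorem fderiv_transition_killingOp (hsimple : SimplyTransitive G M)
    (hc : c ∈ IsManifold.maximalAtlas 𝓘(ℝ, RSpace n) ∞ M) (o : M)
    {x : RSpace n} (hx : x ∈ c.target) (a : RSpace n) :
    fderiv ℝ (transition (invariantOp G c o) (killingOp G c)) x (killingOp G c x a) =
      (transition (invariantOp G c o) (killingOp G c) x).comp (adDeriv n G a) := by
  have hd : HasFDerivAt (transition (invariantOp G c o) (killingOp G c))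
      (fderiv ℝ (transition (invariantOp G c o) (killingOp G c)) x)
      (c (expChart n G (oneCoord n G) • c.symm x)) := by
    rw [coord_smul_oneCoord hx]
    exact ((contDiffAt_transition hsimple hc o hx).differentiableAt (by simp)).hasFDerivAt
  have h1 := hd.comp (oneCoord n G) (hasFDerivAt_coord_smul hc hx)
  have h2 := (hasFDerivAt_const (transition (invariantOp G c o) (killingOp G c) x)
    (oneCoord n G)).clm_comp (hasFDerivAt_AdRep_inv (G := G) hsimple hc hx)
  have h3 := h1.unique (h2.congr_of_eventuallyEq ?_)
  · simpa using congrArg (fun L : RSpace n →L[ℝ] (RSpace n →L[ℝ] RSpace n) => L a) h3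
  · filter_upwards [tendsto_expChart.eventually (eventually_smul_mem_source (G := G) hx)] with u hu
    exact transition_smul hsimple hc o hx hu

/-- Differentiating η = ξ∘R along ηa yields ξ(R(B a b)) + dξ(ηa)(R b). Commutation of the frames
turns the second term into dη(ξ(R b))a = dη(ηb)a, and the first is η(B a b). -/
theorem bracket_killingOp (hsimple : SimplyTransitive G M)
    (hc : c ∈ IsManifold.maximalAtlas 𝓘(ℝ, RSpace n) ∞ M) (o : M)
    {x : RSpace n} (hx : x ∈ c.target) (a b : RSpace n) :
    fderiv ℝ (killingOp G c) x (killingOp G c x a) b -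
      fderiv ℝ (killingOp G c) x (killingOp G c x b) a = killingOp G c x (adDeriv n G a b) := by
  set ξ := invariantOp G c o with hξ
  set R := transition ξ (killingOp G c) with hR
  have heq : ∀ y ∈ c.target, killingOp G c y = (ξ y).comp (R y) := fun y hy => by
    rw [hR, transition_eq_AdRep hsimple hc o hy, hξ, invariantOp_comp_AdRep hsimple hc o hy]
  have hξd : HasFDerivAt ξ (fderiv ℝ ξ x) x :=
    ((contDiffAt_invariantOp hsimple hc o hx).differentiableAt (by simp)).hasFDerivAt
  have hRd : HasFDerivAt R (fderiv ℝ R x) x :=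
    ((contDiffAt_transition hsimple hc o hx).differentiableAt (by simp)).hasFDerivAt
  have hη : (killingOp G c) =ᶠ[𝓝 x] fun y => (ξ y).comp (R y) := by
    filter_upwards [c.open_target.mem_nhds hx] with y hy using heq y hy
  have h1 : fderiv ℝ (killingOp G c) x (killingOp G c x a) b =
      ξ x (fderiv ℝ R x (killingOp G c x a) b) + fderiv ℝ ξ x (killingOp G c x a) (R x b) := by
    rw [hη.fderiv_eq, (hξd.clm_comp hRd).fderiv]
    simp
  rw [h1, hR, fderiv_transition_killingOp hsimple hc o hx, ← hR,
    fderiv_invariantOp_killingOp hsimple hc o hx, ContinuousLinearMap.comp_apply]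
  simp only [heq x hx, ContinuousLinearMap.comp_apply, hξ, add_sub_cancel_right]

/-- The tangent space of the orbit is the image of a ↦ l∘B a, so its dimension is the rank of the
form l(B a b). -/
theorem coadjointOrbitDim_eq (hsimple : SimplyTransitive G M)
    (hc : c ∈ IsManifold.maximalAtlas 𝓘(ℝ, RSpace n) ∞ M)
    {x : RSpace n} (hx : x ∈ c.target) (l : RSpace n →L[ℝ] ℝ) :
    coadjointOrbitDim G l = Module.finrank ℝ
      ((ContinuousLinearMap.compL ℝ (RSpace n) (RSpace n) ℝ l).comp (adDeriv n G)).range := by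
  have hd : HasFDerivAt (ContinuousLinearMap.compL ℝ (RSpace n) (RSpace n) ℝ l)
      (ContinuousLinearMap.compL ℝ (RSpace n) (RSpace n) ℝ l) (AdRep (n := n) (1 : G)⁻¹) :=
    ContinuousLinearMap.hasFDerivAt _
  have hm : MDifferentiableAt 𝓘(ℝ, RSpace n) 𝓘(ℝ, RSpace n →L[ℝ] ℝ)
      (fun z : G => coAd (n := n) z l) 1 :=
    MDifferentiableAt.comp (g := ContinuousLinearMap.compL ℝ (RSpace n) (RSpace n) ℝ l)
      (f := fun z : G => AdRep (n := n) z⁻¹) (1 : G) hd.differentiableAt.mdifferentiableAt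
      (mdifferentiableAt_AdRep_inv hsimple hc hx)
  have h1 : (mfderiv 𝓘(ℝ, RSpace n) 𝓘(ℝ, RSpace n →L[ℝ] ℝ) (fun z : G => coAd (n := n) z l) 1 :
      RSpace n →L[ℝ] (RSpace n →L[ℝ] ℝ)) =
      fderiv ℝ (fun u => coAd (expChart n G u) l) (oneCoord n G) := by
    refine hm.mfderiv.trans ?_
    simp [writtenInExtChartAt, Function.comp_def, fderivWithin_univ]
    rfl
  have h2 : fderiv ℝ (fun u => coAd (expChart n G u) l) (oneCoord n G) =
      (ContinuousLinearMap.compL ℝ (RSpace n) (RSpace n) ℝ l).comp (adDeriv n G) :=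
    ((ContinuousLinearMap.compL ℝ (RSpace n) (RSpace n) ℝ l).hasFDerivAt.comp (oneCoord n G)
      (hasFDerivAt_AdRep_inv (G := G) hsimple hc hx)).fderiv
  rw [← h2, ← h1]
  rfl

/-- If the regular coadjoint orbits have dimension at most two, so have all of them. -/
theorem coadjointOrbitDim_le_two (hsimple : SimplyTransitive G M)
    (hc : c ∈ IsManifold.maximalAtlas 𝓘(ℝ, RSpace n) ∞ M)
    {x : RSpace n} (hx : x ∈ c.target)
    (horbits : ∀ l : RSpace n →L[ℝ] ℝ, IsRegularCovector G l → coadjointOrbitDim G l ≤ 2)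
    (l : RSpace n →L[ℝ] ℝ) : coadjointOrbitDim G l ≤ 2 := by
  -- The dimensions are bounded by that of 𝔤*, so the maximum is attained, and a covector attaining
  -- it is regular.
  have hbdd : BddAbove (Set.range fun l : RSpace n →L[ℝ] ℝ => coadjointOrbitDim G l) := by
    refine ⟨Module.finrank ℝ (RSpace n →L[ℝ] ℝ), ?_⟩
    rintro _ ⟨l, rfl⟩
    simp only [coadjointOrbitDim_eq (G := G) hsimple hc hx l]
    exact Submodule.finrank_le _
  obtain ⟨l', hl'⟩ := Nat.sSup_mem (Set.range_nonempty _) hbdd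
  have hmax : ∀ l : RSpace n →L[ℝ] ℝ, coadjointOrbitDim G l ≤ coadjointOrbitDim G l' := fun l =>
    (le_csSup hbdd ⟨l, rfl⟩).trans hl'.ge
  exact (hmax l).trans (horbits l' hmax)

theorem quadratureMapAt_killingOp (hc : c ∈ IsManifold.maximalAtlas 𝓘(ℝ, RSpace n) ∞ M) (o : M)
    {x : RSpace n} (hx : x ∈ c.target) :
    QuadratureMapAt (ActionData G c o) (killingOp G c) x := fun i j => by
  refine ⟨c.target, hx, c.open_target, fun y hy => ?_, .known c.open_target (.killing i j)⟩
  exact (contDiffAt_pi.1 ((contDiffAt_killingOp hc hy).clm_apply contDiffAt_const)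
    j).contDiffWithinAt

theorem quadratureMapAt_invariantOp (hsimple : SimplyTransitive G M)
    (hc : c ∈ IsManifold.maximalAtlas 𝓘(ℝ, RSpace n) ∞ M) (o : M)
    {x : RSpace n} (hx : x ∈ c.target) :
    QuadratureMapAt (ActionData G c o) (invariantOp G c o) x := fun i j => by
  refine ⟨c.target, hx, c.open_target, fun y hy => ?_, .known c.open_target (.invariant i j)⟩
  exact (contDiffAt_pi.1 ((contDiffAt_invariantOp hsimple hc o hy).clm_apply contDiffAt_const)
    j).contDiffWithinAt

/-- The rank criterion for the `plucker` field needs an alternating form, so antisymmetry is derived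
before `InvariantFrames` is available. -/
theorem adDeriv_antisymm (hsimple : SimplyTransitive G M)
    (hc : c ∈ IsManifold.maximalAtlas 𝓘(ℝ, RSpace n) ∞ M)
    {x : RSpace n} (hx : x ∈ c.target) (a b : RSpace n) : adDeriv n G a b = -adDeriv n G b a := by
  have h1 : killingOp G c x (adDeriv n G a b + adDeriv n G b a) = 0 := by
    rw [map_add, ← bracket_killingOp hsimple hc (c.symm x) hx a b,
      ← bracket_killingOp hsimple hc (c.symm x) hx b a]
    abel
  obtain ⟨e, he⟩ := isInvertible_killingOp (G := G) hsimple hc hx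
  rw [← he] at h1
  exact eq_neg_of_add_eq_zero_left (e.injective (h1.trans (map_zero e).symm))

theorem invariantFrames (hsimple : SimplyTransitive G M)
    (horbits : ∀ l : RSpace n →L[ℝ] ℝ, IsRegularCovector G l → coadjointOrbitDim G l ≤ 2)
    (hc : c ∈ IsManifold.maximalAtlas 𝓘(ℝ, RSpace n) ∞ M) (o : M)
    {x : RSpace n} (hx : x ∈ c.target) :
    InvariantFrames (ActionData G c o) x (invariantOp G c o) (killingOp G c) (adDeriv n G) where
  quadrature_ξ := quadratureMapAt_invariantOp hsimple hc o hx
  quadrature_η := quadratureMapAt_killingOp hc o hx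
  isInvertible_ξ := isInvertible_invariantOp hsimple hc o hx
  isInvertible_η := isInvertible_killingOp hsimple hc hx
  fderiv_transition := by
    filter_upwards [c.open_target.mem_nhds hx] with y hy a
    exact fderiv_transition_killingOp hsimple hc o hy a
  bracket := by
    filter_upwards [c.open_target.mem_nhds hx] with y hy a b
    exact bracket_killingOp hsimple hc o hy a b
  plucker l := plucker_of_finrank_range_le_two
    ((ContinuousLinearMap.compL ℝ (RSpace n) (RSpace n) ℝ l).comp (adDeriv n G))
    (fun a b => by
      simpa using congrArg l (adDeriv_antisymm (G := G) hsimple hc hx a b))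
    (coadjointOrbitDim_eq (G := G) hsimple hc hx l ▸
      coadjointOrbitDim_le_two hsimple hc hx horbits l)

end Algebra

/-! ### The metric in the invariant frame -/

section Metric

set_option linter.unusedSectionVars false

open Filter Topology Matrix

variable {n : ℕ} {M : Type*} [TopologicalSpace M] [ChartedSpace (RSpace n) M]
  [IsManifold 𝓘(ℝ, RSpace n) ∞ M]

/-- The metric as a bilinear form on the model space. -/
def PseudoRiemannianMetric.form (g : PseudoRiemannianMetric n M) (x : M) :
    RSpace n →L[ℝ] RSpace n →L[ℝ] ℝ :=
  g.val x

theorem sum_sum_mul_mul_eq (q : Matrix (Fin n) (Fin n) ℝ) (u v : RSpace n) :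
    ∑ i, ∑ j, q i j * u i * v j = u ⬝ᵥ q *ᵥ v := by
  simp only [dotProduct, mulVec, Finset.mul_sum]
  exact Finset.sum_congr rfl fun i _ => Finset.sum_congr rfl fun j _ => by ring

theorem covectorForm_eq (q : Matrix (Fin n) (Fin n) ℝ) (l : RSpace n →L[ℝ] ℝ) :
    covectorForm q l = (fun i => l (Pi.single i 1)) ⬝ᵥ q *ᵥ fun i => l (Pi.single i 1) :=
  sum_sum_mul_mul_eq q _ _

/-- The matrix of a bilinear form. -/
def formMatrix (b : RSpace n →L[ℝ] RSpace n →L[ℝ] ℝ) : Matrix (Fin n) (Fin n) ℝ :=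
  Matrix.of fun i j => b (Pi.single i 1) (Pi.single j 1)

theorem dotProduct_formMatrix_mulVec (b : RSpace n →L[ℝ] RSpace n →L[ℝ] ℝ) (u v : RSpace n) :
    u ⬝ᵥ formMatrix b *ᵥ v = b u v := by
  rw [← sum_sum_mul_mul_eq, clm_apply_eq_sum b u, _root_.sum_apply]
  refine Finset.sum_congr rfl fun i _ => ?_
  rw [_root_.smul_apply, clm_apply_eq_sum (b (Pi.single i 1)) v, Finset.smul_sum]
  refine Finset.sum_congr rfl fun j _ => ?_
  simp only [formMatrix, of_apply, smul_eq_mul]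
  ring

/-- The pullback of a bilinear form by a linear map. -/
def pullbackForm (b : RSpace n →L[ℝ] RSpace n →L[ℝ] ℝ) (L : RSpace n →L[ℝ] RSpace n) :
    RSpace n →L[ℝ] RSpace n →L[ℝ] ℝ :=
  b.bilinearComp L L

theorem pullbackForm_pullbackForm (b : RSpace n →L[ℝ] RSpace n →L[ℝ] ℝ)
    (L L' : RSpace n →L[ℝ] RSpace n) :
    pullbackForm (pullbackForm b L) L' = pullbackForm b (L.comp L') := rfl

theorem metricMatrix_eq (g : PseudoRiemannianMetric n M)
    (c : OpenPartialHomeomorph M (RSpace n)) (x : RSpace n) :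
    metricMatrix g c x = formMatrix (pullbackForm (g.form (c.symm x)) (dmap n c.symm x)) := rfl

theorem formMatrix_pullbackForm (b : RSpace n →L[ℝ] RSpace n →L[ℝ] ℝ)
    (L : RSpace n →L[ℝ] RSpace n) :
    formMatrix (pullbackForm b L) = (LinearMap.toMatrix' (L : RSpace n →ₗ[ℝ] RSpace n))ᵀ *
      formMatrix b * LinearMap.toMatrix' (L : RSpace n →ₗ[ℝ] RSpace n) := by
  ext i j
  have h := dotProduct_formMatrix_mulVec b (L (Pi.single i 1)) (L (Pi.single j 1))
  change b (L (Pi.single i 1)) (L (Pi.single j 1)) = _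
  rw [← h]
  simp only [mul_apply, dotProduct, mulVec, Finset.sum_mul, Finset.mul_sum, mul_assoc,
    LinearMap.toMatrix'_apply, transpose_apply]
  exact Finset.sum_comm

/-- The inverse matrix of a bilinear form, evaluated on a covector, in another basis. -/
theorem sum_sum_formMatrix_inv (b : RSpace n →L[ℝ] RSpace n →L[ℝ] ℝ)
    {L : RSpace n →L[ℝ] RSpace n} (hL : L.IsInvertible) (p : RSpace n →L[ℝ] ℝ) :
    ∑ i, ∑ j, (formMatrix b)⁻¹ i j * p (Pi.single i 1) * p (Pi.single j 1) =
      covectorForm (formMatrix (pullbackForm b L))⁻¹ (p.comp L) := by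
  set X := LinearMap.toMatrix' (L : RSpace n →ₗ[ℝ] RSpace n) with hX
  have hdet : IsUnit X.det := isUnit_iff_ne_zero.2 (det_toMatrix_ne_zero L hL)
  have hinv : (formMatrix b)⁻¹ = X * (formMatrix (pullbackForm b L))⁻¹ * Xᵀ := by
    rw [formMatrix_pullbackForm, ← hX, Matrix.mul_inv_rev, Matrix.mul_inv_rev, ← mul_assoc,
      ← mul_assoc,
      mul_nonsing_inv X hdet, one_mul, mul_assoc, nonsing_inv_mul _ (by rwa [det_transpose]),
      mul_one]
  have hp : (fun i => (p.comp L) (Pi.single i 1)) = Xᵀ *ᵥ fun i => p (Pi.single i 1) := by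
    funext i
    rw [ContinuousLinearMap.comp_apply, clm_apply_eq_sum p]
    simp [mulVec, dotProduct, hX, LinearMap.toMatrix'_apply]
  rw [sum_sum_mul_mul_eq _ (fun i => p (Pi.single i 1)) (fun i => p (Pi.single i 1)),
    covectorForm_eq, hp, hinv, ← mulVec_mulVec, ← mulVec_mulVec, dotProduct_mulVec,
    ← mulVec_transpose]

/-- A quadratic form that takes a positive value has a dual form that takes a positive value. -/
theorem exists_covectorForm_pos {b : RSpace n →L[ℝ] RSpace n →L[ℝ] ℝ}
    (hb : ∀ v, (∀ w, b w v = 0) → v = 0) (hpos : ∃ v, 0 < b v v) :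
    ∃ l, 0 < covectorForm (formMatrix b)⁻¹ l := by
  obtain ⟨v, hv⟩ := hpos
  have hunit : IsUnit (formMatrix b) := by
    refine mulVec_injective_iff_isUnit.1 fun u u' huu => sub_eq_zero.1 (hb _ fun w => ?_)
    rw [← dotProduct_formMatrix_mulVec, mulVec_sub, sub_eq_zero.2 huu, dotProduct_zero]
  refine ⟨covector n (formMatrix b *ᵥ v), ?_⟩
  simp only [covectorForm_eq, covector_single]
  rw [mulVec_mulVec, nonsing_inv_mul _ ((isUnit_iff_isUnit_det _).1 hunit), one_mulVec,
    dotProduct_comm, dotProduct_formMatrix_mulVec]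
  exact hv

variable {G : Type*} [TopologicalSpace G] [ChartedSpace (RSpace n) G] [Group G]
  [LieGroup 𝓘(ℝ, RSpace n) ∞ G] [MulAction G M]
  [ContMDiffSMul 𝓘(ℝ, RSpace n) 𝓘(ℝ, RSpace n) ∞ G M]
  {g : PseudoRiemannianMetric n M} {c : OpenPartialHomeomorph M (RSpace n)}

variable (G) in
/-- The scalar products of the invariant fields, which are constant. -/
def invariantForm (g : PseudoRiemannianMetric n M) (o : M) : RSpace n →L[ℝ] RSpace n →L[ℝ] ℝ :=
  pullbackForm (g.form o) (dmap n (fun w : G => w • o) 1)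

theorem pullbackForm_motion (hmotions : ActsByMotions G g) (z : G) (x : M) :
    pullbackForm (g.form (z • x)) (dmap n (fun y : M => z • y) x) = g.form x := by
  ext u v
  exact hmotions z x u v

theorem dmap_symm_comp_invariantOp (hsimple : SimplyTransitive G M)
    (hc : c ∈ IsManifold.maximalAtlas 𝓘(ℝ, RSpace n) ∞ M) (o : M)
    {x : RSpace n} (hx : x ∈ c.target) :
    (dmap n c.symm x).comp (invariantOp G c o x) =
      (dmap n (fun y : M => psiInv G o (c.symm x) • y) o).comp
        (dmap n (fun w : G => w • o) 1) := by
  rw [invariantOp, ← dmap_comp (mdifferentiableAt_coord_symm hc hx)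
    (mdifferentiableAt_coord_mul_smul hsimple hc o hx)
    (by rw [mul_one, smul_psiInv hsimple, c.right_inv hx]),
    ← dmap_comp (mdifferentiable_translation _ o) (mdifferentiable_orbit o 1) (one_smul G o)]
  refine dmap_congr ?_
  filter_upwards [eventually_mul_smul_mem_source hsimple o hx] with w hw
  rw [c.left_inv hw, mul_smul]

/-- The motion that takes o to x carries the invariant frame at o to the one at x and preserves g,
so the Gram matrix of the frame does not depend on x. -/
theorem pullbackForm_invariantOp (hmotions : ActsByMotions G g) (hsimple : SimplyTransitive G M)
    (hc : c ∈ IsManifold.maximalAtlas 𝓘(ℝ, RSpace n) ∞ M) (o : M)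
    {x : RSpace n} (hx : x ∈ c.target) :
    pullbackForm (pullbackForm (g.form (c.symm x)) (dmap n c.symm x)) (invariantOp G c o x) =
      invariantForm G g o := by
  have h := pullbackForm_motion hmotions (psiInv G o (c.symm x)) o
  rw [smul_psiInv hsimple] at h
  rw [pullbackForm_pullbackForm, dmap_symm_comp_invariantOp hsimple hc o hx,
    ← pullbackForm_pullbackForm, h, invariantForm]

/-- The inverse metric transforms contragrediently to the frame, so the Hamiltonian is a form with
constant coefficients in the momenta p∘ξ. -/
theorem metricMatrix_inv_apply (hmotions : ActsByMotions G g) (hsimple : SimplyTransitive G M)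
    (hc : c ∈ IsManifold.maximalAtlas 𝓘(ℝ, RSpace n) ∞ M) (o : M)
    {x : RSpace n} (hx : x ∈ c.target) (p : RSpace n →L[ℝ] ℝ) :
    ∑ i, ∑ j, (metricMatrix g c x)⁻¹ i j * p (Pi.single i 1) * p (Pi.single j 1) =
      covectorForm (formMatrix (invariantForm G g o))⁻¹ (p.comp (invariantOp G c o x)) := by
  rw [metricMatrix_eq, sum_sum_formMatrix_inv _ (isInvertible_invariantOp hsimple hc o hx),
    pullbackForm_invariantOp hmotions hsimple hc o hx]

/-- A vector of positive square can be brought to o by a motion, and lowering its index gives a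
covector on which the dual form takes the same value. -/
theorem exists_covectorForm_invariantForm_pos (hmotions : ActsByMotions G g)
    (hsimple : SimplyTransitive G M)
    (hpos : ∃ (x : M) (v : TangentSpace 𝓘(ℝ, RSpace n) x), 0 < g.val x v v) (o : M) :
    ∃ l, 0 < covectorForm (formMatrix (invariantForm G g o))⁻¹ l := by
  obtain ⟨L, hL⟩ := isInvertible_of_forall_eq_zero
    (dmap_orbit_one_injective (n := n) (G := G) hsimple o)
  have hval : ∀ u v, invariantForm G g o u v = g.form o (L u) (L v) := fun u v => by
    rw [invariantForm, ← hL]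
    rfl
  have hnondeg : ∀ v : RSpace n, (∀ w : RSpace n, g.form o w v = 0) → v = 0 := fun v hv =>
    g.nondegenerate o v fun w => (g.symm o v w).trans (hv w)
  have hpos' : ∃ v : RSpace n, 0 < g.form o v v := by
    obtain ⟨x, v, hv⟩ := hpos
    obtain ⟨z, rfl, -⟩ := hsimple x o
    exact ⟨_, hv.trans_eq (hmotions z x v v).symm⟩
  obtain ⟨v, hv⟩ := hpos'
  refine exists_covectorForm_pos (fun v hv => ?_) ⟨L.symm v, ?_⟩
  · have h1 : L v = 0 := hnondeg _ fun w => by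
      have h2 := hv (L.symm w)
      rwa [hval, L.apply_symm_apply] at h2
    exact L.injective (h1.trans (map_zero L).symm)
  · rwa [hval, L.apply_symm_apply]

end Metric

end

theorem mainTheorem2 {n : ℕ}
    {M : Type*} [TopologicalSpace M] [ChartedSpace (RSpace n) M]
    [IsManifold 𝓘(ℝ, RSpace n) ∞ M]
    (g : PseudoRiemannianMetric n M)
    {G : Type*} [TopologicalSpace G] [ChartedSpace (RSpace n) G] [Group G]
    [LieGroup 𝓘(ℝ, RSpace n) ∞ G] [MulAction G M]
    [ContMDiffSMul 𝓘(ℝ, RSpace n) 𝓘(ℝ, RSpace n) ∞ G M]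
    (hmotions : ActsByMotions G g)
    (hsimple : SimplyTransitive G M)
    (horbits : ∀ l : RSpace n →L[ℝ] ℝ, IsRegularCovector G l → coadjointOrbitDim G l ≤ 2)
    -- the metric is not negative definite (otherwise the equation has no nonconstant solutions)
    (hpos : ∃ (x : M) (v : TangentSpace 𝓘(ℝ, RSpace n) x), 0 < g.val x v v)
    -- the base point of the map `z ↦ z • o`
    (o : M)
    -- local coordinates around a point of `M`, and a value of the parameter `m`
    (c : OpenPartialHomeomorph M (RSpace n))
    (hc : c ∈ IsManifold.maximalAtlas 𝓘(ℝ, RSpace n) ∞ M)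
    (x₀ : M) (hx₀ : x₀ ∈ c.source)
    (m₀ : ℝ) (hm₀ : 0 < m₀) :
    ∃ (U A : Set (RSpace n)) (S : RSpace n → RSpace n → ℝ) (m : RSpace n → ℝ),
      IsOpen U ∧ IsOpen A ∧ U ⊆ c.target ∧ c x₀ ∈ U ∧ (∃ α₀ ∈ A, m α₀ = m₀) ∧
      IsCompleteIntegral g c U A S m ∧
      ByQuadratures (ActionData G c o) (n + n)
        {y | (fun i => y (Fin.castAdd n i)) ∈ U ∧ (fun i => y (Fin.natAdd n i)) ∈ A}
        (fun y => S (fun i => y (Fin.castAdd n i)) (fun i => y (Fin.natAdd n i))) ∧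
      ByQuadratures (ActionData G c o) n A m := by
  exact (invariantFrames hsimple horbits hc o (c.map_source hx₀)).integrableByQuadratures
    (Filter.eventually_of_mem (c.open_target.mem_nhds (c.map_source hx₀)) fun _ hx p =>
      metricMatrix_inv_apply hmotions hsimple hc o hx p)
    (exists_covectorForm_invariantForm_pos hmotions hsimple hpos o)
    (c.open_target.mem_nhds (c.map_source hx₀)) hm₀
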